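/- **Setting.** Let $\Lambda\subset\mathbb R^n$ be a full-rank lattice and $\Phi$ an endomorphism of $\mathbb R^n$ with $\Phi(\Lambda)\subseteq\Lambda$, all of whose (complex) eigenvalues have the same absolute value $\rho>1$, with $\rho^n\in\mathbb N$. Let $\lambda$ be Lebesgue measure. Let $T\subseteq\mathbb R^n$ be closed with $\lambda(\partial T)=0$, $\bigcup_{z\in\Lambda}(z+T)=\mathbb R^n$ and $T\cap(z+T)\subseteq\partial T$ for $0\ne z\in\Lambda$; put $T_z=z+T$ and $d_\Lambda=\lambda(T)$. Let $\widetilde T\subseteq T$ be such that $\mathbb R^n$ is the disjoint union of the sets $z+\widetilde T$, $z\in\Lambda$, and for $x=u+v$ with $u\in\Lambda$, $v\in\widetilde T$ put $\{x\}_\Lambda=v$. Let $\|\cdot\|$ be a norm on $\mathbb R^n$ whose induced operator norm satisfies $\|\Phi\|=\rho$, $\|\Phi^{-1}\|=\rho^{-1}$. Let $r,R>0$ with $\{\|x\|\le r\}\subseteq T\subseteq\{\|x\|\le R\}$, and let $w\ge1$ be an integer with $R/r<\rho^w-1$. Let $\mathcal D\subset\Lambda$ consist of $0$ and exactly one representative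 of each residue class of $\Lambda$ modulo $\Phi^w\Lambda$ not contained in $\Phi\Lambda$, with $\mathcal D\subseteq\Phi^wT$ and $|\mathcal D|=\rho^{n(w-1)}(\rho^n-1)+1$. A $w$-NAF is a sequence $\xi\in\mathcal D^{\mathbb Z}$ such that among any $w$ consecutive digits at most one is non-zero; if $\xi_j=0$ for all large $j$, its value is $\sum_{j\in\mathbb Z}\Phi^j\xi_j$. It is an integer $w$-NAF if moreover $\xi_j=0$ for all $j<0$. For $B\subseteq\mathbb R^n$ put $\lfloor B\rfloor_T=\bigcup_{z\in\Lambda,\,T_z\subseteq B}T_z$, $\lceil B\rceil_T=\overline{(\lfloor B^c\rfloor_T)^c}$, $\{B\}_T=B\setminus\lfloor B\rfloor_T$, $\partial_T B=\overline{\lceil B\rceil_T\setminus\lfloor B\rfloor_T}$, $\operatorname{cov}_T B=\bigcup_{z\in B\cap\Lambda}T_z$, and for $j\in\mathbb Z$ put $\{B\}_{T,j}=\Phi^{-j}\{\Phi^jB\}_T$ and $\operatorname{cov}_{T,j}B=\Phi^{-j}\operatorname{cov}_T(\Phi^jB)$. For $0\ne\eta\in\mathcal D$ let $\mathcal W_\eta$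 be the set of values of $w$-NAFs $\xi$ with $\xi_i=0$ for all $i\ge0$ and $\xi_{-w}=\eta$; let $\mathcal W_{\eta,j}$ ($j\ge0$) be the set of values of those which also satisfy $\xi_i=0$ for $i<-(j+w)$. Let $W=\{\mathcal W_\eta\}_\Lambda$ and $\beta_j=\lambda(\operatorname{cov}_{T,j+w}\mathcal W_{\eta,j})-\lambda(\mathcal W_\eta)$. **Theorem.** Let $0\ne\eta\in\mathcal D$. Let $U\subseteq\mathbb R^n$ be Lebesgue measurable with $U\subseteq\{\|x\|<d\}$, $0<d<\infty$, and let $1\le\delta<n$ be such that $\#(\Lambda\cap\partial_T(NU))=O(N^\delta)$ as $N\to\infty$. Every $z\in\Lambda$ is the value of exactly one integer $w$-NAF; let $Z_\eta(N)$ (which is finite) be the number of pairs $(z,j)$ with $z\in NU\cap\Lambda$, $j\ge0$, such that the $j$th digit of the integer $w$-NAF of $z$ is $\eta$. Put $$E=\frac1{\rho^{n(w-1)}((\rho^n-1)w+1)},\quad \mu=\Bigl(1+\frac1{\rho^nw^3}\Bigr)^{-1}<1,\quad \alpha=n+\log_\rho\mu<n,\quad J_0=\lfloor\log_\rho d-\log_\rho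 B_L\rfloor+1,$$ where $B_L=\rho^{-(w-1)}\bigl(r-\frac R{\rho^w-1}\bigr)$; if $\Phi^{-1}T\subseteq T$, one may also take $B_L=r-\frac R{\rho^w-1}$. Then, as $N\to\infty$, $$Z_\eta(N)=N^n\frac{\lambda(U)}{d_\Lambda}E\log_\rho N+N^n\psi_\eta(\log_\rho N)+O(N^\alpha\log_\rho N)+O(N^\delta\log_\rho N),$$ where $\psi_\eta=\psi_{\mathcal M}+\psi_{\mathcal P}+\psi_{\mathcal Q}$ with $$\psi_{\mathcal M}(x)=\frac{\lambda(U)}{d_\Lambda}\,(J_0+1-\{x\})\,E,\qquad \psi_{\mathcal Q}=\frac{\lambda(U)}{d_\Lambda^2}\sum_{j\ge0}\beta_j,$$ $$\psi_{\mathcal P}(x)=\frac{\rho^{n(J_0-\{x\})}}{d_\Lambda}\sum_{j\ge0}\int_{\{\Phi^{-\lfloor x\rfloor-J_0}\rho^xU\}_{T,\,j-w}}\Bigl(\mathbf 1_W(\{\Phi^{j-w}y\}_\Lambda)-\frac{\lambda(W)}{d_\Lambda}\Bigr)\,dy,$$ and all these integrals and series converge. Further, let $\Phi=Q\operatorname{diag}(\rho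 e^{i\theta_1},\dots,\rho e^{i\theta_n})Q^{-1}$ with a regular complex matrix $Q$ and real $\theta_1,\dots,\theta_n$. If $p\ge1$ is an integer with $Q\operatorname{diag}(e^{i\theta_1p},\dots,e^{i\theta_np})Q^{-1}U=U$, then $\psi_\eta$ is $p$-periodic. Moreover, if $\psi_\eta$ is $p$-periodic for some integer $p\ge1$, then it is continuous. -/

import Mathlib

open Set Filter Topology MeasureTheory Asymptotics
open scoped Pointwise Matrix

noncomputable section

/-- The operator norm of a matrix induced by a vector norm on `ℝⁿ`. -/
def inducedOpNorm {n : ℕ} (nrm : Seminorm ℝ (Fin n → ℝ)) (A : Matrix (Fin n) (Fin n) ℝ) : ℝ :=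
  sInf {c : ℝ | 0 ≤ c ∧ ∀ x, nrm (A *ᵥ x) ≤ c * nrm x}

/-- The set-up: a full rank lattice, an expanding endomorphism all of whose eigenvalues have
absolute value `ρ`, a tile, a vector norm, a width and a digit set that corresponds to the tile. -/
structure NAFSystem (n : ℕ) where
  /-- the lattice -/
  Λ : Submodule ℤ (Fin n → ℝ)
  [discrete : DiscreteTopology Λ]
  [isZLattice : IsZLattice ℝ Λ]
  /-- the endomorphism -/
  Φ : Matrix (Fin n) (Fin n) ℝ
  map_lattice : ∀ z ∈ Λ, Φ *ᵥ z ∈ Λ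
  /-- the common absolute value of the complex eigenvalues -/
  ρ : ℝ
  one_lt_rho : 1 < ρ
  eigenvalues : ∀ κ ∈ spectrum ℂ (Φ.map Complex.ofReal), ‖κ‖ = ρ
  rho_pow_nat : ∃ k : ℕ, ρ ^ n = k
  /-- the tile -/
  T : Set (Fin n → ℝ)
  tile_cover : ⋃ z ∈ Λ, (fun x => z + x) '' T = univ
  tile_inter : ∀ z ∈ Λ, z ≠ 0 → T ∩ (fun x => z + x) '' T ⊆ frontier T
  tile_closed : IsClosed T
  tile_frontier : volume (frontier T) = 0
  /-- the restricted tile: its lattice translates partition the space -/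
  T' : Set (Fin n → ℝ)
  restricted_subset : T' ⊆ T
  restricted_partition : ∀ x : Fin n → ℝ, ∃! u : Fin n → ℝ, u ∈ Λ ∧ x - u ∈ T'
  /-- the vector norm -/
  nrm : Seminorm ℝ (Fin n → ℝ)
  nrm_definite : ∀ x, nrm x = 0 → x = 0
  nrm_endo : inducedOpNorm nrm Φ = ρ
  nrm_endo_inv : inducedOpNorm nrm Φ⁻¹ = ρ⁻¹
  /-- the inner radius of the tile -/
  r : ℝ
  /-- the outer radius of the tile -/
  R : ℝ
  r_pos : 0 < r
  R_pos : 0 < R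
  ball_subset : {x | nrm x ≤ r} ⊆ T
  subset_ball : T ⊆ {x | nrm x ≤ R}
  /-- the width -/
  w : ℕ
  w_pos : 0 < w
  existence_condition : R / r < ρ ^ w - 1
  /-- the digit set: zero and exactly one representative of every residue class modulo `Φ ^ w Λ`
  that is not contained in `Φ Λ` -/
  D : Set (Fin n → ℝ)
  digits_lattice : ∀ a ∈ D, a ∈ Λ
  zero_digit : 0 ∈ D
  digits_reduced : ∀ a ∈ D, a ≠ 0 → ¬ ∃ y ∈ Λ, a = Φ *ᵥ y
  digits_residue : ∀ z ∈ Λ, (¬ ∃ y ∈ Λ, z = Φ *ᵥ y) →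
    ∃! a : Fin n → ℝ, a ∈ D ∧ ∃ y ∈ Λ, z - a = (Φ ^ w) *ᵥ y
  digits_tile : D ⊆ (fun x => (Φ ^ w) *ᵥ x) '' T
  digits_card : (D.ncard : ℝ) = ρ ^ (n * (w - 1)) * (ρ ^ n - 1) + 1

namespace NAFSystem

variable {n : ℕ} (S : NAFSystem n)

/-- The image `Φ ^ j B` for an integer `j`. -/
def act (j : ℤ) (B : Set (Fin n → ℝ)) : Set (Fin n → ℝ) := (fun x => (S.Φ ^ j) *ᵥ x) '' B

/-- The volume of the tile. -/
def dΛ : ℝ := volume.real S.T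

/-- The fractional part with respect to the lattice and the restricted tile. -/
def frac (x : Fin n → ℝ) : Fin n → ℝ := x - (S.restricted_partition x).choose

/-- The translated tile `z + T`. -/
def cell (z : Fin n → ℝ) : Set (Fin n → ℝ) := (fun x => z + x) '' S.T

/-- Cell packing. -/
def floorV (B : Set (Fin n → ℝ)) : Set (Fin n → ℝ) :=
  ⋃ z ∈ {z : Fin n → ℝ | z ∈ S.Λ ∧ S.cell z ⊆ B}, S.cell z

/-- Cell covering. -/
def ceilV (B : Set (Fin n → ℝ)) : Set (Fin n → ℝ) := closure (S.floorV Bᶜ)ᶜ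

/-- Fractional cells. -/
def fracV (B : Set (Fin n → ℝ)) : Set (Fin n → ℝ) := B \ S.floorV B

/-- Fractional cells at level `j`. -/
def fracVAt (j : ℤ) (B : Set (Fin n → ℝ)) : Set (Fin n → ℝ) := S.act (-j) (S.fracV (S.act j B))

/-- Cell covering of the boundary. -/
def boundaryV (B : Set (Fin n → ℝ)) : Set (Fin n → ℝ) := closure (S.ceilV B \ S.floorV B)

/-- Cell covering of the lattice points inside a set. -/
def coverV (B : Set (Fin n → ℝ)) : Set (Fin n → ℝ) := ⋃ z ∈ B ∩ (S.Λ : Set (Fin n → ℝ)), S.cell z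

/-- Cell covering of the lattice points at level `j`. -/
def coverVAt (j : ℤ) (B : Set (Fin n → ℝ)) : Set (Fin n → ℝ) := S.act (-j) (S.coverV (S.act j B))

/-- The number of lattice points inside a set. -/
def cardV (B : Set (Fin n → ℝ)) : ℕ := (B ∩ (S.Λ : Set (Fin n → ℝ))).ncard

/-- Width-`w` non-adjacent forms: each block of width `w` has at most one non-zero digit. -/
def IsNAF (ξ : ℤ → Fin n → ℝ) : Prop :=
  (∀ j, ξ j ∈ S.D) ∧ ∀ j : ℤ, {i : ℤ | j ≤ i ∧ i < j + S.w ∧ ξ i ≠ 0}.Subsingleton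

/-- The value `∑ Φ ^ j ξ_j`. -/
def value (ξ : ℤ → Fin n → ℝ) : Fin n → ℝ := ∑' j : ℤ, (S.Φ ^ j) *ᵥ ξ j

/-- Integer non-adjacent forms with value `z`: only finitely many non-zero digits, all of them
at non-negative positions. -/
def IsExpansion (ξ : ℤ → Fin n → ℝ) (z : Fin n → ℝ) : Prop :=
  S.IsNAF ξ ∧ (∃ l : ℕ, ∀ i : ℤ, (l : ℤ) ≤ i → ξ i = 0) ∧ (∀ i < 0, ξ i = 0) ∧ S.value ξ = z

/-- The occurrences of the digit `η` in the expansions of the lattice points in `B`: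
pairs of a lattice point and a position. -/
def occurrences (η : Fin n → ℝ) (B : Set (Fin n → ℝ)) : Set ((Fin n → ℝ) × ℕ) :=
  {p | p.1 ∈ B ∧ p.1 ∈ S.Λ ∧ ∃ ξ, S.IsExpansion ξ p.1 ∧ ξ p.2 = η}

/-- The counting function `Z_η(N)`. -/
def Z (η : Fin n → ℝ) (U : Set (Fin n → ℝ)) (N : ℝ) : ℕ := (S.occurrences η (N • U)).ncard

/-- The values of the forms `ξ` of left-length `0` and right-length at most `j + w`
with digit `η` at position `-w`. -/
def charSetAt (η : Fin n → ℝ) (j : ℕ) : Set (Fin n → ℝ) :=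
  S.value '' {ξ | S.IsNAF ξ ∧ (∀ i : ℤ, 0 ≤ i → ξ i = 0) ∧
    (∀ i : ℤ, i < -(j + S.w : ℤ) → ξ i = 0) ∧ ξ (-(S.w : ℤ)) = η}

/-- The values of the forms `ξ` of left-length `0` with digit `η` at position `-w`. -/
def charSet (η : Fin n → ℝ) : Set (Fin n → ℝ) :=
  S.value '' {ξ | S.IsNAF ξ ∧ (∀ i : ℤ, 0 ≤ i → ξ i = 0) ∧ ξ (-(S.w : ℤ)) = η}

/-- The characteristic set `W_η`. -/
def W (η : Fin n → ℝ) : Set (Fin n → ℝ) := S.frac '' S.charSet η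

/-- The numbers `β_{η,j}`. -/
def β (η : Fin n → ℝ) (j : ℕ) : ℝ :=
  volume.real (S.coverVAt (j + S.w) (S.charSetAt η j)) - volume.real (S.charSet η)

/-- The constant of the expectation. -/
def E : ℝ := 1 / (S.ρ ^ (n * (S.w - 1)) * ((S.ρ ^ n - 1) * S.w + 1))

/-- The constant `μ`. -/
def μ : ℝ := (1 + 1 / (S.ρ ^ n * (S.w : ℝ) ^ 3))⁻¹

/-- The exponent `α`. -/
def α : ℝ := n + Real.logb S.ρ S.μ

/-- The constant `J₀`, depending on the radius `d` and the lower bound constant `BL`. -/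
def J₀ (d BL : ℝ) : ℤ := ⌊Real.logb S.ρ d - Real.logb S.ρ BL⌋ + 1

/-- The first part of the fluctuation. -/
def ψM (U : Set (Fin n → ℝ)) (J : ℤ) (x : ℝ) : ℝ :=
  volume.real U / S.dΛ * (J + 1 - Int.fract x) * S.E

/-- The region of integration in the `j`-th summand of the second part of the fluctuation. -/
def region (U : Set (Fin n → ℝ)) (J : ℤ) (x : ℝ) (j : ℕ) : Set (Fin n → ℝ) :=
  S.fracVAt (j - S.w) (S.act (-⌊x⌋ - J) (S.ρ ^ x • U))

/-- The integrand in the `j`-th summand of the second part of the fluctuation. -/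
def integrand (η : Fin n → ℝ) (j : ℕ) (y : Fin n → ℝ) : ℝ :=
  (S.W η).indicator 1 (S.frac ((S.Φ ^ ((j : ℤ) - S.w)) *ᵥ y)) - volume.real (S.W η) / S.dΛ

/-- The second part of the fluctuation. -/
def ψP (η : Fin n → ℝ) (U : Set (Fin n → ℝ)) (J : ℤ) (x : ℝ) : ℝ :=
  S.ρ ^ (n * (J - Int.fract x)) / S.dΛ *
    ∑' j : ℕ, ∫ y in S.region U J x j, S.integrand η j y

/-- The third part of the fluctuation. -/
def ψQ (η : Fin n → ℝ) (U : Set (Fin n → ℝ)) : ℝ :=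
  volume.real U / S.dΛ ^ 2 * ∑' j : ℕ, S.β η j

/-- The fluctuation `ψ_η`. -/
def ψ (η : Fin n → ℝ) (U : Set (Fin n → ℝ)) (J : ℤ) (x : ℝ) : ℝ :=
  S.ψM U J x + S.ψP η U J x + S.ψQ η U

end NAFSystem

end

noncomputable section

namespace NAFSystem

/-! ### The norm, the powers of `Φ`, and volumes. -/

variable {n : ℕ} (S : NAFSystem n)

/-! Dropping the last digit turns `Λ` into a tree with root `0`: `par u` is the parent and `dig u`
the dropped digit. The `w`-NAF condition says that a non-zero digit may only be appended to a point
of `Φ^(w-1)Λ`. The condition `R / r < ρ^w - 1` makes norms drop on the way to the root, so every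
lattice point has exactly one expansion. The real points with integer part `v` form a compact set
`tile v`, and `Φ^k` maps it onto the union of the tiles of the `k`-th descendants of `v`. Volumes
obey the same recursion (`sum_κ_desc`), so the tiles overlap only in null sets (`aedisjoint_tile`).
The characteristic set is one of them: `charSet η` is `Φ^(-w)` applied to `tile η` (`charSet_eq`).

The real points with digit `η` at position `i` form `Φ^i (digitSet η)`. The number of lattice points
of `NU` with `i`-th digit `η` is therefore compared with the volume of `NU ∩ Φ^i (digitSet η)`
divided by `dΛ`. The comparison rests on mixing: a lattice point `v` has `q^k κ(v) / dΛ` descendants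
of level `k` up to `O((qθ)^k)`, with `q = ρ^n` and some `θ < μ` (`exists_mixing`). This comes from a
linear recursion with a quadratic Lyapunov function (`exists_geometric_decay`). Grouping the lattice
points of `NU` by ancestors, at the price of one boundary term per level (`sum_pts_le`), gives an
error `O(N^α + N^δ)` uniformly in `i` once the systematic deviation `dev η i`, which equals `β η i`,
is taken out (`exists_count_bound`). The number of relevant positions is `O(log N)`, whence the
logarithm in the error terms.

The rest concerns volumes. The periodic set `perSet η` fills the share `E` of every cell, so only
fractional cells contribute to the discrepancy `disc` at a position. Because `δ < n`, discrepancies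
are summable towards low positions. Above `⌊log_ρ N⌋ + J₀` the digit does not occur in `NU` and the
discrepancy is exactly `-E λ(NU)`. Summing over positions gives the exact identity `count_sub_eq`,
whose right-hand side consists of the error terms. The same fact shows that the cut-off in the
fluctuation may be raised freely (`fluct_eq`), so that locally `ψ` is a uniformly convergent series
of continuous functions. -/

theorem nrm_mulVec_le (A : Matrix (Fin n) (Fin n) ℝ) (c : ℝ) (hc : 0 < c)
    (h : inducedOpNorm S.nrm A = c) (x : Fin n → ℝ) : S.nrm (A *ᵥ x) ≤ c * S.nrm x := by
  have hne : {c : ℝ | 0 ≤ c ∧ ∀ x, S.nrm (A *ᵥ x) ≤ c * S.nrm x}.Nonempty := by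
    -- The infimum of the empty set is `0` by default, so the positive value `c` guarantees that
    -- some bound exists.
    by_contra hemp
    rw [Set.not_nonempty_iff_eq_empty] at hemp
    rw [inducedOpNorm, hemp, Real.sInf_empty] at h
    exact hc.ne h
  refine le_of_forall_pos_le_add fun ε hε => ?_
  have hx : 0 ≤ S.nrm x := apply_nonneg _ _
  obtain ⟨c', ⟨-, hc'⟩, hlt⟩ := exists_lt_of_csInf_lt hne
    (show sInf _ < c + ε / (S.nrm x + 1) by
      rw [show sInf _ = c from h]
      have : 0 < ε / (S.nrm x + 1) := by positivity
      linarith)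
  calc S.nrm (A *ᵥ x) ≤ c' * S.nrm x := hc' x
    _ ≤ (c + ε / (S.nrm x + 1)) * S.nrm x := by gcongr
    _ = c * S.nrm x + ε * (S.nrm x / (S.nrm x + 1)) := by ring
    _ ≤ c * S.nrm x + ε * 1 := by
      gcongr
      rw [div_le_one (by positivity)]
      linarith
    _ = c * S.nrm x + ε := by ring

theorem rho_pos : 0 < S.ρ := by linarith [S.one_lt_rho]

/-- The inverse of a singular matrix is `0` by convention, and its induced norm would then be `0`
instead of `ρ⁻¹`. -/
theorem isUnit_det : IsUnit S.Φ.det := by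
  by_contra h
  have h0 : S.Φ⁻¹ = 0 := Matrix.nonsing_inv_apply_not_isUnit _ h
  have h1 := S.nrm_endo_inv
  rw [h0] at h1
  have : inducedOpNorm S.nrm (0 : Matrix (Fin n) (Fin n) ℝ) ≤ 0 :=
    csInf_le ⟨0, fun c hc => hc.1⟩ ⟨le_rfl, fun x => by simp⟩
  rw [h1] at this
  exact absurd this (not_le.mpr (inv_pos.mpr S.rho_pos))

/-- The automorphism `Φ ^ j` of the space. -/
def app (j : ℤ) : (Fin n → ℝ) ≃L[ℝ] (Fin n → ℝ) :=
  LinearEquiv.toContinuousLinearEquiv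
    (LinearEquiv.ofLinearMap (S.Φ ^ j).mulVecLin (S.Φ ^ (-j)).mulVecLin
      (by
        rw [← Matrix.mulVecLin_mul, ← Matrix.zpow_add S.isUnit_det]
        simp)
      (by
        rw [← Matrix.mulVecLin_mul, ← Matrix.zpow_add S.isUnit_det]
        simp))

theorem app_apply (j : ℤ) (x : Fin n → ℝ) : S.app j x = (S.Φ ^ j) *ᵥ x := rfl

theorem act_eq (j : ℤ) (B : Set (Fin n → ℝ)) : S.act j B = S.app j '' B := rfl

theorem app_add (i j : ℤ) (x : Fin n → ℝ) : S.app (i + j) x = S.app i (S.app j x) := by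
  simp only [app_apply, Matrix.zpow_add S.isUnit_det, Matrix.mulVec_mulVec]

@[simp] theorem app_zero (x : Fin n → ℝ) : S.app 0 x = x := by simp [app_apply]

theorem app_one (x : Fin n → ℝ) : S.app 1 x = S.Φ *ᵥ x := by simp [app_apply]

theorem app_natCast (k : ℕ) (x : Fin n → ℝ) : S.app k x = (S.Φ ^ k) *ᵥ x := by
  simp [app_apply]

@[simp] theorem app_neg_app (j : ℤ) (x : Fin n → ℝ) : S.app (-j) (S.app j x) = x := by
  rw [← app_add]; simp

@[simp] theorem app_app_neg (j : ℤ) (x : Fin n → ℝ) : S.app j (S.app (-j) x) = x := by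
  rw [← app_add]; simp

theorem app_image_add (i j : ℤ) (B : Set (Fin n → ℝ)) :
    S.app (i + j) '' B = S.app i '' (S.app j '' B) := by
  rw [Set.image_image]
  exact Set.image_congr fun x _ => S.app_add i j x

theorem mem_app_image {j : ℤ} {B : Set (Fin n → ℝ)} {x : Fin n → ℝ} :
    x ∈ S.app j '' B ↔ S.app (-j) x ∈ B := by
  constructor
  · rintro ⟨y, hy, rfl⟩
    simpa using hy
  · intro h
    exact ⟨_, h, by simp⟩

/-- The bounds for `Φ` and for `Φ⁻¹` match, so `ρ⁻¹ Φ` is an isometry of the norm. Everything later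
about "rotations" relies on this exact scaling. -/
theorem nrm_app_one (x : Fin n → ℝ) : S.nrm (S.app 1 x) = S.ρ * S.nrm x := by
  have hρ := S.rho_pos
  refine le_antisymm ?_ ?_
  · rw [app_one]
    exact S.nrm_mulVec_le _ _ hρ S.nrm_endo x
  · have h := S.nrm_mulVec_le _ _ (inv_pos.mpr hρ) S.nrm_endo_inv (S.app 1 x)
    rw [app_one, Matrix.mulVec_mulVec, Matrix.nonsing_inv_mul _ S.isUnit_det,
      Matrix.one_mulVec, inv_mul_eq_div, le_div_iff₀ hρ] at h
    rw [app_one]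
    linarith

theorem nrm_app_nat (k : ℕ) (x : Fin n → ℝ) : S.nrm (S.app k x) = S.ρ ^ k * S.nrm x := by
  induction k with
  | zero => simp
  | succ k ih =>
    rw [Nat.cast_succ, add_comm, app_add, nrm_app_one, ih]
    ring

theorem nrm_app (j : ℤ) (x : Fin n → ℝ) : S.nrm (S.app j x) = S.ρ ^ j * S.nrm x := by
  obtain ⟨k, rfl | rfl⟩ := Int.eq_nat_or_neg j
  · rw [nrm_app_nat, zpow_natCast]
  · have h := S.nrm_app_nat k (S.app (-k) x)
    rw [app_app_neg] at h
    rw [h, zpow_neg, zpow_natCast, inv_mul_cancel_left₀ (pow_ne_zero _ S.rho_pos.ne')]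

theorem nrm_continuous : Continuous S.nrm := by
  have hb : ∀ x : Fin n → ℝ, S.nrm x ≤ (∑ i, S.nrm (Pi.single i 1)) * ‖x‖ := by
    intro x
    calc S.nrm x = S.nrm (∑ i, x i • Pi.single i (1 : ℝ)) := by
          congr 1
          ext j
          simp [Finset.sum_apply, Pi.single_apply]
      _ ≤ ∑ i, S.nrm (x i • Pi.single i (1 : ℝ)) := Finset.le_sum_of_subadditive S.nrm (map_zero _).le (map_add_le_add S.nrm) _ _
      _ ≤ ∑ i, ‖x‖ * S.nrm (Pi.single i (1 : ℝ)) := by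
          gcongr with i
          rw [map_smul_eq_mul]
          gcongr
          exact norm_le_pi_norm x i
      _ = (∑ i, S.nrm (Pi.single i 1)) * ‖x‖ := by rw [← Finset.mul_sum, mul_comm]
  refine Seminorm.continuous_of_continuousAt_zero ?_
  have h0 : Tendsto (fun x : Fin n → ℝ => (∑ i, S.nrm (Pi.single i (1 : ℝ))) * ‖x‖) (𝓝 0) (𝓝 0) := by
    have : Continuous fun x : Fin n → ℝ => (∑ i, S.nrm (Pi.single i (1 : ℝ))) * ‖x‖ := by fun_prop
    simpa using this.tendsto 0
  show Tendsto S.nrm (𝓝 0) (𝓝 (S.nrm 0))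
  rw [map_zero]
  exact squeeze_zero (fun x => apply_nonneg _ _) hb h0

theorem exists_norm_le_nrm : ∃ C : ℝ, 0 < C ∧ ∀ x : Fin n → ℝ, ‖x‖ ≤ C * S.nrm x := by
  rcases (Metric.sphere (0 : Fin n → ℝ) 1).eq_empty_or_nonempty with h | h
  · refine ⟨1, one_pos, fun x => ?_⟩
    have hx : ‖x‖ = 0 := by
      by_contra hx
      have : ‖x‖⁻¹ • x ∈ Metric.sphere (0 : Fin n → ℝ) 1 := by
        simp [norm_smul, hx]
      rw [h] at this
      exact this
    rw [hx, one_mul]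
    exact apply_nonneg _ _
  · obtain ⟨y, hy, hmin⟩ := (isCompact_sphere (0 : Fin n → ℝ) 1).exists_isMinOn h
      S.nrm_continuous.continuousOn
    have hy1 : ‖y‖ = 1 := by simpa using hy
    have hpos : 0 < S.nrm y := by
      refine lt_of_le_of_ne (apply_nonneg _ _) fun h0 => ?_
      have := S.nrm_definite y h0.symm
      simp [this] at hy1
    refine ⟨(S.nrm y)⁻¹, inv_pos.mpr hpos, fun x => ?_⟩
    by_cases hx : ‖x‖ = 0
    · rw [hx]
      exact mul_nonneg (inv_pos.mpr hpos).le (apply_nonneg _ _)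
    · have h1 : ‖x‖⁻¹ • x ∈ Metric.sphere (0 : Fin n → ℝ) 1 := by
        simp [norm_smul, hx]
      have h2 : S.nrm y ≤ S.nrm (‖x‖⁻¹ • x) := hmin h1
      rw [map_smul_eq_mul, norm_inv, norm_norm, inv_mul_eq_div,
        le_div_iff₀ (lt_of_le_of_ne (norm_nonneg x) (Ne.symm hx))] at h2
      rw [inv_mul_eq_div, le_div_iff₀ hpos]
      linarith

/-- The closed ball of the vector norm. -/
def ball (x : Fin n → ℝ) (c : ℝ) : Set (Fin n → ℝ) := {y | S.nrm (y - x) ≤ c}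

theorem mem_ball {x y : Fin n → ℝ} {c : ℝ} : y ∈ S.ball x c ↔ S.nrm (y - x) ≤ c := Iff.rfl

theorem isClosed_ball (x : Fin n → ℝ) (c : ℝ) : IsClosed (S.ball x c) :=
  isClosed_le (S.nrm_continuous.comp (continuous_id.sub continuous_const)) continuous_const

theorem isBounded_ball (x : Fin n → ℝ) (c : ℝ) : Bornology.IsBounded (S.ball x c) := by
  obtain ⟨C, hC, h⟩ := S.exists_norm_le_nrm
  refine (Metric.isBounded_closedBall (x := x) (r := C * c)).subset fun y hy => ?_
  rw [Metric.mem_closedBall, dist_eq_norm]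
  exact (h _).trans (by have := S.mem_ball.1 hy; gcongr)

theorem isCompact_ball (x : Fin n → ℝ) (c : ℝ) : IsCompact (S.ball x c) :=
  Metric.isCompact_of_isClosed_isBounded (S.isClosed_ball x c) (S.isBounded_ball x c)

theorem volume_ball_lt_top (x : Fin n → ℝ) (c : ℝ) : volume (S.ball x c) < ⊤ :=
  (S.isCompact_ball x c).measure_lt_top

theorem nrm_sub_comm (x y : Fin n → ℝ) : S.nrm (x - y) = S.nrm (y - x) := map_sub_rev _ _ _

theorem isOpen_nrm_lt (x : Fin n → ℝ) (c : ℝ) : IsOpen {y | S.nrm (y - x) < c} :=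
  isOpen_lt (S.nrm_continuous.comp (continuous_id.sub continuous_const)) continuous_const

theorem ball_mem_nhds (x : Fin n → ℝ) {c : ℝ} (hc : 0 < c) : S.ball x c ∈ 𝓝 x := by
  refine Filter.mem_of_superset ((S.isOpen_nrm_lt x c).mem_nhds (by simpa using hc)) ?_
  intro y hy
  exact S.mem_ball.2 (le_of_lt hy)

theorem convex_ball (x : Fin n → ℝ) (c : ℝ) : Convex ℝ (S.ball x c) := by
  have h := S.nrm.convex_closedBall x c
  rwa [show S.nrm.closedBall x c = S.ball x c by ext; simp [Seminorm.mem_closedBall, mem_ball]] at h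

theorem volume_ball_pos (x : Fin n → ℝ) {c : ℝ} (hc : 0 < c) : 0 < volume.real (S.ball x c) := by
  rw [measureReal_def]
  exact ENNReal.toReal_pos (Measure.measure_pos_of_mem_nhds volume (S.ball_mem_nhds x hc)).ne'
    (S.volume_ball_lt_top x c).ne

theorem volume_smul (t : ℝ) (ht : 0 ≤ t) (B : Set (Fin n → ℝ)) :
    volume.real (t • B) = t ^ n * volume.real B := by
  rw [measureReal_def, Measure.addHaar_smul, ENNReal.toReal_mul, measureReal_def]
  simp only [abs_of_nonneg (pow_nonneg ht _), Module.finrank_fin_fun,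
    ENNReal.toReal_ofReal (pow_nonneg ht _)]

theorem volume_ball (c : ℝ) (hc : 0 ≤ c) :
    volume.real (S.ball 0 c) = c ^ n * volume.real (S.ball 0 1) := by
  rcases hc.eq_or_lt with rfl | hc
  · have : S.ball 0 0 = (0 : ℝ) • S.ball 0 1 := by
      rw [zero_smul_set ⟨0, by simp [mem_ball]⟩]
      ext y
      simp only [mem_ball, sub_zero, Set.mem_zero]
      constructor
      · intro h
        exact S.nrm_definite y (le_antisymm h (apply_nonneg _ _))
      · rintro rfl
        simp
    rw [this, volume_smul _ le_rfl]
  · rw [← volume_smul _ hc.le]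
    congr 1
    ext y
    rw [Set.mem_smul_set_iff_inv_smul_mem₀ hc.ne', mem_ball, mem_ball, sub_zero, sub_zero,
      map_smul_eq_mul, norm_inv, Real.norm_of_nonneg hc.le, inv_mul_le_iff₀ hc, mul_one]

theorem app_image_ball (j : ℤ) (x : Fin n → ℝ) (c : ℝ) :
    S.app j '' S.ball x c = S.ball (S.app j x) (S.ρ ^ j * c) := by
  ext y
  have hρ : 0 < S.ρ ^ j := zpow_pos S.rho_pos j
  rw [mem_app_image, mem_ball, mem_ball,
    show S.app (-j) y - x = S.app (-j) (y - S.app j x) by simp [map_sub], nrm_app, zpow_neg,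
    inv_mul_le_iff₀ hρ]

/-- The factor `ρ ^ n` by which `Φ` scales volumes. -/
def q : ℝ := S.ρ ^ n

theorem q_pos : 0 < S.q := pow_pos S.rho_pos n

/-- `Φ^j` maps the unit ball of the norm to the ball of radius `ρ^j`; comparing the two volumes
identifies the determinant without eigenvalues. -/
theorem volume_app_image (j : ℤ) (B : Set (Fin n → ℝ)) :
    volume (S.app j '' B) = ENNReal.ofReal (S.q ^ j) * volume B := by
  rw [Measure.addHaar_image_continuousLinearEquiv]
  congr 2
  have h := Measure.addHaar_image_continuousLinearEquiv (volume : Measure (Fin n → ℝ)) (S.app j)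
    (S.ball 0 1)
  have hρ : 0 < S.ρ ^ j := zpow_pos S.rho_pos j
  rw [app_image_ball, map_zero, mul_one] at h
  have h2 : volume.real (S.ball 0 (S.ρ ^ j)) =
      |LinearMap.det (S.app j : (Fin n → ℝ) →ₗ[ℝ] (Fin n → ℝ))| * volume.real (S.ball 0 1) := by
    rw [measureReal_def, h, ENNReal.toReal_mul, ENNReal.toReal_ofReal (abs_nonneg _),
      measureReal_def]
  rw [S.volume_ball _ hρ.le] at h2
  rw [← mul_right_cancel₀ (S.volume_ball_pos 0 one_pos).ne' h2, q, ← zpow_natCast, ← zpow_natCast,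
    ← zpow_mul, ← zpow_mul, mul_comm]

theorem volumeReal_app_image (j : ℤ) (B : Set (Fin n → ℝ)) :
    volume.real (S.app j '' B) = S.q ^ j * volume.real B := by
  rw [measureReal_def, volume_app_image, ENNReal.toReal_mul,
    ENNReal.toReal_ofReal (zpow_pos S.q_pos j).le, measureReal_def]

theorem dim_ne_zero {n : ℕ} (S : NAFSystem n) : n ≠ 0 := by
  rintro rfl
  have h : inducedOpNorm S.nrm S.Φ ≤ 0 :=
    csInf_le ⟨0, fun c hc => hc.1⟩ ⟨le_rfl, fun x => by
      rw [show S.Φ *ᵥ x = 0 from Subsingleton.elim _ _, map_zero, zero_mul]⟩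
  rw [S.nrm_endo] at h
  exact absurd h (not_le.mpr S.rho_pos)

theorem one_lt_q : 1 < S.q := one_lt_pow₀ S.one_lt_rho S.dim_ne_zero


/-! ### The digit tree on the lattice. -/

instance : DiscreteTopology S.Λ := S.discrete

instance : IsZLattice ℝ S.Λ := S.isZLattice

theorem finite_lattice_ball (x : Fin n → ℝ) (c : ℝ) :
    {u : S.Λ | (u : Fin n → ℝ) ∈ S.ball x c}.Finite := by
  have : DiscreteTopology S.Λ.toAddSubgroup := S.discrete
  have h := Metric.finite_isBounded_inter_isClosed (K := S.ball x c)
    (s := (S.Λ.toAddSubgroup : Set (Fin n → ℝ)))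
    DiscreteTopology.isDiscrete (S.isBounded_ball x c) AddSubgroup.isClosed_of_discrete
  refine Set.Finite.of_finite_image (f := Subtype.val) (h.subset ?_) Subtype.val_injective.injOn
  rintro _ ⟨u, hu, rfl⟩
  exact ⟨hu, u.2⟩

/-- The endomorphism of the lattice induced by `Φ`. -/
def up : S.Λ →+ S.Λ where
  toFun u := ⟨S.app 1 u, by rw [app_one]; exact S.map_lattice u u.2⟩
  map_zero' := by ext1; simp
  map_add' u v := by ext1; simp

@[simp] theorem coe_up (u : S.Λ) : (S.up u : Fin n → ℝ) = S.app 1 u := rfl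

theorem coe_up_iterate (k : ℕ) (u : S.Λ) : (S.up^[k] u : Fin n → ℝ) = S.app k u := by
  induction k with
  | zero => simp
  | succ k ih => rw [Function.iterate_succ_apply', coe_up, ih, ← app_add]; push_cast; rw [add_comm]

theorem up_injective : Function.Injective S.up := by
  intro u v h
  have : S.app 1 (u : Fin n → ℝ) = S.app 1 v := congrArg Subtype.val h
  exact Subtype.ext ((S.app 1).injective this)

theorem up_iterate_add (k : ℕ) (u v : S.Λ) : S.up^[k] (u + v) = S.up^[k] u + S.up^[k] v :=
  Subtype.ext (by simp [coe_up_iterate])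

theorem up_iterate_zero (k : ℕ) : S.up^[k] 0 = 0 := Subtype.ext (by simp)

/-- The lattice point `u` arises from `v` by appending the digit `a`. -/
def IsStep (u v : S.Λ) (a : Fin n → ℝ) : Prop :=
  a ∈ S.D ∧ (u : Fin n → ℝ) = S.app 1 v + a ∧ (a ≠ 0 → v ∈ range S.up^[S.w - 1])

theorem digit_notMem_range {u : S.Λ} (hu : (u : Fin n → ℝ) ∈ S.D) (h0 : u ≠ 0) :
    u ∉ range S.up := by
  rintro ⟨v, rfl⟩
  exact S.digits_reduced _ hu (fun h => h0 (Subtype.ext h)) ⟨v, v.2, S.app_one v⟩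

theorem coe_eq_app_one_iff {u : S.Λ} :
    (∃ y ∈ S.Λ, (u : Fin n → ℝ) = S.Φ *ᵥ y) ↔ u ∈ range S.up := by
  constructor
  · rintro ⟨y, hy, h⟩
    exact ⟨⟨y, hy⟩, Subtype.ext (by rw [coe_up, app_one, h])⟩
  · rintro ⟨v, rfl⟩
    exact ⟨v, v.2, S.app_one v⟩

theorem app_w (x : Fin n → ℝ) : S.app 1 (S.app (S.w - 1 : ℕ) x) = (S.Φ ^ S.w) *ᵥ x := by
  rw [← app_add, ← app_natCast]
  congr 2
  have := S.w_pos
  omega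

/-- For `u ∉ ΦΛ` the digit `a` is congruent to `u` modulo `Φ^w Λ`, so that `u = Φ v + a` with `v ∈
Φ^(w-1)Λ`. This divisibility expresses that the `w - 1` digits before `a` vanish, hence the NAF
condition becomes local. -/
theorem exists_isStep (u : S.Λ) : ∃ v a, S.IsStep u v a := by
  by_cases hu : u ∈ range S.up
  · obtain ⟨v, rfl⟩ := hu
    exact ⟨v, 0, S.zero_digit, by simp, fun h => (h rfl).elim⟩
  · obtain ⟨a, ⟨ha, y, hy, h⟩, -⟩ :=
      S.digits_residue u u.2 (fun h => hu (S.coe_eq_app_one_iff.1 h))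
    refine ⟨S.up^[S.w - 1] ⟨y, hy⟩, a, ha, ?_, fun _ => ⟨_, rfl⟩⟩
    rw [coe_up_iterate, app_w, ← h]
    simp

theorem IsStep.mem_range_iff {u v : S.Λ} {a : Fin n → ℝ} (h : S.IsStep u v a) :
    u ∈ range S.up ↔ a = 0 := by
  obtain ⟨ha, hu, -⟩ := h
  constructor
  · rintro ⟨t, rfl⟩
    by_contra ha0
    refine S.digits_reduced a ha ha0 ⟨t - v, (t - v).2, ?_⟩
    rw [coe_up] at hu
    rw [← app_one]
    simp [hu]
  · rintro rfl
    exact ⟨v, Subtype.ext (by simp [hu])⟩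

theorem IsStep.unique {u v v' : S.Λ} {a a' : Fin n → ℝ} (h : S.IsStep u v a)
    (h' : S.IsStep u v' a') : v = v' ∧ a = a' := by
  have haa : a = a' := by
    by_cases hu : u ∈ range S.up
    · rw [(h.mem_range_iff S).1 hu, (h'.mem_range_iff S).1 hu]
    · obtain ⟨b, -, hb⟩ := S.digits_residue u u.2 (fun h => hu (S.coe_eq_app_one_iff.1 h))
      have key : ∀ v a, S.IsStep u v a → a = b := by
        rintro v a hs
        obtain ⟨ha, huv, hv⟩ := id hs
        have ha0 : a ≠ 0 := fun h0 => hu ((hs.mem_range_iff S).2 h0)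
        obtain ⟨y, rfl⟩ := hv ha0
        refine hb a ⟨ha, y, y.2, ?_⟩
        rw [huv, coe_up_iterate, app_w]
        simp
      rw [key v a h, key v' a' h']
  subst haa
  refine ⟨?_, rfl⟩
  have h1 := h.2.1
  rw [h'.2.1] at h1
  exact Subtype.ext ((S.app 1).injective (add_right_cancel h1)).symm

/-- The lattice point that remains after the last digit of the expansion is removed. -/
def par (u : S.Λ) : S.Λ := (S.exists_isStep u).choose

/-- The last digit of the expansion of a lattice point. -/
def dig (u : S.Λ) : Fin n → ℝ := (S.exists_isStep u).choose_spec.choose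

theorem isStep_par (u : S.Λ) : S.IsStep u (S.par u) (S.dig u) :=
  (S.exists_isStep u).choose_spec.choose_spec

theorem par_dig_of_isStep {u v : S.Λ} {a : Fin n → ℝ} (h : S.IsStep u v a) :
    S.par u = v ∧ S.dig u = a :=
  (S.isStep_par u).unique S h

theorem dig_mem (u : S.Λ) : S.dig u ∈ S.D := (S.isStep_par u).1

theorem coe_eq_par (u : S.Λ) : (u : Fin n → ℝ) = S.app 1 (S.par u) + S.dig u := (S.isStep_par u).2.1

theorem par_mem_range {u : S.Λ} (h : S.dig u ≠ 0) : S.par u ∈ range S.up^[S.w - 1] :=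
  (S.isStep_par u).2.2 h

theorem dig_eq_zero_iff {u : S.Λ} : S.dig u = 0 ↔ u ∈ range S.up :=
  ((S.isStep_par u).mem_range_iff S).symm

theorem isStep_up (u : S.Λ) : S.IsStep (S.up u) u 0 :=
  ⟨S.zero_digit, by simp, fun h => (h rfl).elim⟩

@[simp] theorem par_up (u : S.Λ) : S.par (S.up u) = u := (S.par_dig_of_isStep (S.isStep_up u)).1

@[simp] theorem dig_up (u : S.Λ) : S.dig (S.up u) = 0 := (S.par_dig_of_isStep (S.isStep_up u)).2

@[simp] theorem par_zero : S.par 0 = 0 := by simpa using S.par_up 0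

@[simp] theorem dig_zero : S.dig 0 = 0 := by simpa using S.dig_up 0

theorem par_iterate_up_iterate (k : ℕ) (u : S.Λ) : S.par^[k] (S.up^[k] u) = u := by
  induction k with
  | zero => rfl
  | succ k ih => rw [Function.iterate_succ_apply, Function.iterate_succ_apply', par_up, ih]

theorem par_iterate_zero (k : ℕ) : S.par^[k] 0 = 0 := by
  simpa [up_iterate_zero] using S.par_iterate_up_iterate k 0

/-- Translation by `Φ^(w-1)Λ` is a symmetry of the tree: it changes neither digits nor the
permission to append digits. It is the source of the periodicity of tiles and of descendant counts.
-/
theorem isStep_add {u z : S.Λ} (hz : z ∈ range S.up^[S.w - 1]) :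
    S.IsStep (u + S.up z) (S.par u + z) (S.dig u) := by
  refine ⟨S.dig_mem u, ?_, fun h => ?_⟩
  · push_cast
    rw [map_add, coe_up]
    nth_rewrite 1 [S.coe_eq_par u]
    abel
  · obtain ⟨y, hy⟩ := S.par_mem_range h
    obtain ⟨y', rfl⟩ := hz
    exact ⟨y + y', by rw [up_iterate_add, hy]⟩

theorem par_add {u z : S.Λ} (hz : z ∈ range S.up^[S.w - 1]) :
    S.par (u + S.up z) = S.par u + z := (S.par_dig_of_isStep (S.isStep_add hz)).1

theorem dig_add {u z : S.Λ} (hz : z ∈ range S.up^[S.w - 1]) :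
    S.dig (u + S.up z) = S.dig u := (S.par_dig_of_isStep (S.isStep_add hz)).2

theorem up_iterate_mem_range {z : S.Λ} {j : ℕ} (hz : z ∈ range S.up^[j]) (k : ℕ) :
    S.up^[k] z ∈ range S.up^[j] := by
  obtain ⟨y, rfl⟩ := hz
  exact ⟨S.up^[k] y, by rw [← Function.iterate_add_apply, ← Function.iterate_add_apply, add_comm]⟩

theorem par_iterate_add {z : S.Λ} (hz : z ∈ range S.up^[S.w - 1]) (k : ℕ) (u : S.Λ) :
    S.par^[k] (u + S.up^[k] z) = S.par^[k] u + z := by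
  induction k generalizing u with
  | zero => rfl
  | succ k ih =>
    rw [Function.iterate_succ_apply, Function.iterate_succ_apply' S.up,
      par_add S (S.up_iterate_mem_range hz k), ih, Function.iterate_succ_apply]

/-- The step of a digit: digits are their own expansions. -/
theorem isStep_digit {u : S.Λ} (hu : (u : Fin n → ℝ) ∈ S.D) : S.IsStep u 0 u :=
  ⟨hu, by simp, fun _ => ⟨0, S.up_iterate_zero _⟩⟩

theorem par_digit {u : S.Λ} (hu : (u : Fin n → ℝ) ∈ S.D) : S.par u = 0 :=
  (S.par_dig_of_isStep (S.isStep_digit hu)).1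

theorem dig_digit {u : S.Λ} (hu : (u : Fin n → ℝ) ∈ S.D) : S.dig u = u :=
  (S.par_dig_of_isStep (S.isStep_digit hu)).2

theorem nrm_digit_le {a : Fin n → ℝ} (ha : a ∈ S.D) : S.nrm (S.app (-S.w) a) ≤ S.R := by
  obtain ⟨x, hx, rfl⟩ := S.digits_tile ha
  simp only [← app_natCast, app_neg_app]
  exact S.subset_ball hx

theorem app_digit_mem {a : Fin n → ℝ} (ha : a ∈ S.D) : S.app (-S.w) a ∈ S.T := by
  obtain ⟨x, hx, rfl⟩ := S.digits_tile ha
  simpa only [← app_natCast, app_neg_app] using hx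

theorem nrm_digit_le' {a : Fin n → ℝ} (ha : a ∈ S.D) : S.nrm a ≤ S.ρ ^ S.w * S.R := by
  have h := S.nrm_digit_le ha
  rw [nrm_app, zpow_neg, zpow_natCast, inv_mul_le_iff₀ (pow_pos S.rho_pos _)] at h
  exact h

theorem one_lt_rho_pow : 1 < S.ρ ^ S.w := one_lt_pow₀ S.one_lt_rho S.w_pos.ne'

theorem R_lt : S.R < S.r * (S.ρ ^ S.w - 1) := by
  have := S.existence_condition
  rw [div_lt_iff₀ S.r_pos] at this
  linarith

/-- Points near a lattice point lie in no other cell. -/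
theorem eq_zero_of_nrm_lt {u : S.Λ} {t : Fin n → ℝ} (ht : t ∈ S.T)
    (h : S.nrm (u + t) < S.r) : u = 0 := by
  by_contra hu
  have h1 : (u : Fin n → ℝ) + t ∈ S.T := S.ball_subset h.le
  -- Distinct translates of `T` meet only in `frontier T`, while the open ball of radius `r` lies in
  -- the interior.
  have h2 : (u : Fin n → ℝ) + t ∈ frontier S.T :=
    S.tile_inter u u.2 (fun h => hu (Subtype.ext h)) ⟨h1, t, ht, rfl⟩
  have h3 : (u : Fin n → ℝ) + t ∈ interior S.T := by
    refine interior_maximal (s := S.T) (t := {y | S.nrm (y - 0) < S.r}) ?_ (S.isOpen_nrm_lt 0 S.r)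
      (by simpa using h)
    intro y hy
    exact S.ball_subset (by simpa using (show S.nrm (y - 0) < S.r from hy).le)
  exact h2.2 h3

theorem zero_mem_T : (0 : Fin n → ℝ) ∈ S.T := S.ball_subset (by simpa using S.r_pos.le)

theorem r_le_nrm {u : S.Λ} (hu : u ≠ 0) : S.r ≤ S.nrm u := by
  by_contra! h
  exact hu (S.eq_zero_of_nrm_lt S.zero_mem_T (by simpa using h))

/-- A zero digit is removed by dividing the norm by `ρ`. Otherwise `Φ^(-w) u = y + t` with `t ∈ T`
and `y` the point reached after `w` steps. If `‖Φ^(-w) u‖ < r`, then `y = 0`. If not, `‖y‖ ≤ ‖Φ^(-w)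
u‖ + R`, which is less than `‖u‖` because `R < r (ρ^w - 1)`. -/
theorem par_iterate_lt (u : S.Λ) (hu : u ≠ 0) : ∃ k, S.nrm (S.par^[k] u) < S.nrm u := by
  have hpos : 0 < S.nrm u := S.r_pos.trans_le (S.r_le_nrm hu)
  by_cases hd : S.dig u = 0
  · refine ⟨1, ?_⟩
    have h := S.coe_eq_par u
    rw [hd, add_zero] at h
    rw [Function.iterate_one]
    have h2 : S.nrm u = S.ρ * S.nrm (S.par u) := by rw [h, nrm_app_one]
    have h3 : 0 ≤ S.nrm (S.par u) := apply_nonneg _ _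
    have h4 := S.one_lt_rho
    have h5 : 0 < S.nrm (S.par u) := by
      rcases h3.eq_or_lt with h0 | h0
      · rw [h2, ← h0, mul_zero] at hpos
        exact absurd hpos (lt_irrefl _)
      · exact h0
    rw [h2]
    nlinarith
  · obtain ⟨y, hy⟩ := S.par_mem_range hd
    refine ⟨S.w, ?_⟩
    have hw : S.par^[S.w] u = y := by
      have : S.w = (S.w - 1) + 1 := by have := S.w_pos; omega
      rw [this, Function.iterate_succ_apply, ← hy, par_iterate_up_iterate]
    rw [hw]
    have h1 : S.app (-S.w) u = y + S.app (-S.w) (S.dig u) := by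
      nth_rewrite 1 [S.coe_eq_par u]
      rw [← hy, coe_up_iterate, app_w, ← app_natCast, map_add, app_neg_app]
    have hρ : 0 < S.ρ ^ S.w := pow_pos S.rho_pos _
    have h2 : S.nrm (S.app (-S.w) u) = S.nrm u / S.ρ ^ S.w := by
      rw [nrm_app, zpow_neg, zpow_natCast, inv_mul_eq_div]
    by_cases hlt : S.nrm u < S.ρ ^ S.w * S.r
    · have : y = 0 := by
        refine S.eq_zero_of_nrm_lt (S.app_digit_mem (S.dig_mem u)) ?_
        rw [← h1, h2, div_lt_iff₀ hρ]
        linarith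
      rw [this]
      simpa using hpos
    · push Not at hlt
      have h3 : S.nrm y ≤ S.nrm u / S.ρ ^ S.w + S.R := by
        rw [← h2]
        have : (y : Fin n → ℝ) = S.app (-S.w) u - S.app (-S.w) (S.dig u) := by rw [h1]; simp
        rw [this]
        exact (map_sub_le_add _ _ _).trans (by gcongr; exact S.nrm_digit_le (S.dig_mem u))
      refine h3.trans_lt ?_
      have h4 := S.R_lt
      have h5 := S.one_lt_rho_pow
      have h6 : S.r ≤ S.nrm u / S.ρ ^ S.w := by rw [le_div_iff₀ hρ]; linarith
      have h7 : S.nrm u = S.nrm u / S.ρ ^ S.w * S.ρ ^ S.w := by field_simp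
      nlinarith

theorem exists_par_iterate_eq_zero (u : S.Λ) : ∃ k, S.par^[k] u = 0 := by
  have hfin : ∀ u : S.Λ, {v : S.Λ | S.nrm v < S.nrm u}.Finite := fun u =>
    (S.finite_lattice_ball 0 (S.nrm u)).subset fun v hv => by
      simpa [mem_ball] using (show S.nrm v < S.nrm u from hv).le
  induction hk : {v : S.Λ | S.nrm v < S.nrm u}.ncard using Nat.strong_induction_on generalizing u with
  | _ k ih =>
    by_cases hu : u = 0
    · exact ⟨0, hu⟩
    · obtain ⟨j, hj⟩ := S.par_iterate_lt u hu
      obtain ⟨i, hi⟩ := ih _ (by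
        rw [← hk]
        refine Set.ncard_lt_ncard ⟨fun v hv => lt_trans hv hj, fun h => ?_⟩ (hfin u)
        exact lt_irrefl (S.nrm (S.par^[j] u)) (h (a := S.par^[j] u) hj)) (S.par^[j] u) rfl
      exact ⟨i + j, by rw [Function.iterate_add_apply, hi]⟩


/-! ### Tiles of points with a given integer part. -/

/-- A radius that bounds the tiles of the digit system. -/
def rad : ℝ := S.ρ ^ S.w * S.R / (S.ρ - 1)

theorem rho_sub_one_pos : 0 < S.ρ - 1 := by linarith [S.one_lt_rho]

theorem rad_pos : 0 < S.rad :=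
  div_pos (mul_pos (pow_pos S.rho_pos _) S.R_pos) S.rho_sub_one_pos

theorem nrm_dig_le (u : S.Λ) : S.nrm (S.dig u) ≤ (S.ρ - 1) * S.rad := by
  rw [rad, mul_div_cancel₀ _ S.rho_sub_one_pos.ne']
  exact S.nrm_digit_le' (S.dig_mem u)

theorem R_le_rad : S.R ≤ S.rad := by
  rw [rad, le_div_iff₀ S.rho_sub_one_pos, mul_comm]
  have h : S.ρ ≤ S.ρ ^ S.w := le_self_pow₀ S.one_lt_rho.le S.w_pos.ne'
  have := S.R_pos
  nlinarith

/-- Digits have norm at most `(ρ - 1) rad`, so `rad` is the fixed point of `c ↦ (c + (ρ - 1) rad) /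
ρ`: a distance of at most `rad` survives the passage to the parent. -/
theorem nrm_par_le {x : Fin n → ℝ} {u : S.Λ} (h : S.nrm (S.app 1 x - u) ≤ S.rad) :
    S.nrm (x - S.par u) ≤ S.rad := by
  have h1 : S.nrm (S.app 1 (x - S.par u)) ≤ S.rad + (S.ρ - 1) * S.rad := by
    have : S.app 1 (x - S.par u) = (S.app 1 x - u) + S.dig u := by
      rw [map_sub, S.coe_eq_par u]
      abel
    rw [this]
    exact (map_add_le_add _ _ _).trans (add_le_add h (S.nrm_dig_le u))
  rw [nrm_app_one] at h1
  have := S.rho_pos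
  nlinarith

theorem nrm_par_iterate_le (k : ℕ) {x : Fin n → ℝ} {u : S.Λ} (h : S.nrm (S.app k x - u) ≤ S.rad) :
    S.nrm (x - S.par^[k] u) ≤ S.rad := by
  induction k generalizing u with
  | zero => simpa using h
  | succ k ih =>
    rw [Function.iterate_succ_apply]
    apply ih
    apply S.nrm_par_le
    rw [← app_add]
    convert h using 3
    push_cast
    rw [add_comm]

theorem finite_par_iterate (k : ℕ) (v : S.Λ) : {u : S.Λ | S.par^[k] u = v}.Finite := by
  refine (S.finite_lattice_ball (S.app k v) (S.ρ ^ k * S.rad)).subset fun u hu => ?_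
  have h := S.nrm_par_iterate_le k (x := S.app (-k) u) (u := u)
    (by simpa using S.rad_pos.le)
  rw [show S.par^[k] u = v from hu] at h
  have h2 : (u : Fin n → ℝ) - S.app k v = S.app k (S.app (-k) u - v) := by simp
  rw [Set.mem_ofPred_eq, mem_ball, h2, nrm_app_nat]
  gcongr
  exact (pow_pos S.rho_pos _).le

/-- The lattice points whose expansion arises from the expansion of `v` by appending `k` digits. -/
def desc (k : ℕ) (v : S.Λ) : Finset S.Λ := (S.finite_par_iterate k v).toFinset

@[simp] theorem mem_desc {k : ℕ} {u v : S.Λ} : u ∈ S.desc k v ↔ S.par^[k] u = v := by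
  simp [desc]

theorem desc_zero (v : S.Λ) : S.desc 0 v = {v} := by
  ext u
  simp

theorem sum_desc_add (j k : ℕ) (v : S.Λ) (f : S.Λ → ℝ) :
    ∑ u ∈ S.desc (k + j) v, f u = ∑ t ∈ S.desc j v, ∑ u ∈ S.desc k t, f u := by
  classical
  rw [← Finset.sum_fiberwise_of_maps_to (s := S.desc (k + j) v) (t := S.desc j v)
    (g := fun u => S.par^[k] u)]
  · refine Finset.sum_congr rfl fun t ht => Finset.sum_congr ?_ fun _ _ => rfl
    ext u
    rw [mem_desc] at ht
    simp only [Finset.mem_filter, mem_desc]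
    constructor
    · exact fun h => h.2
    · intro h
      refine ⟨?_, h⟩
      rw [add_comm, Function.iterate_add_apply, h, ht]
  · intro u hu
    rw [mem_desc] at hu ⊢
    rw [← Function.iterate_add_apply, add_comm, hu]

theorem card_desc_add (j k : ℕ) (v : S.Λ) :
    ((S.desc (k + j) v).card : ℝ) = ∑ t ∈ S.desc j v, ((S.desc k t).card : ℝ) := by
  have h := S.sum_desc_add j k v (fun _ => 1)
  simpa using h

/-- The tile of all points with an expansion whose integer part is the expansion of `v`. -/
def tile (v : S.Λ) : Set (Fin n → ℝ) :=
  {x | ∀ m : ℕ, ∃ u : S.Λ, S.par^[m] u = v ∧ S.nrm (S.app m x - u) ≤ S.rad}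

theorem tile_subset_ball (v : S.Λ) : S.tile v ⊆ S.ball v S.rad := by
  intro x hx
  obtain ⟨u, hu, h⟩ := hx 0
  have : u = v := hu
  subst this
  rw [mem_ball]
  simpa using h

theorem isClosed_tile (v : S.Λ) : IsClosed (S.tile v) := by
  have : S.tile v = ⋂ m : ℕ, ⋃ u ∈ {u : S.Λ | S.par^[m] u = v},
      S.app m ⁻¹' S.ball u S.rad := by
    ext x
    simp [tile, mem_ball]
  rw [this]
  exact isClosed_iInter fun m => (S.finite_par_iterate m v).isClosed_biUnion fun u _ =>
    (S.isClosed_ball _ _).preimage (S.app m).continuous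

theorem measurableSet_tile (v : S.Λ) : MeasurableSet (S.tile v) := (S.isClosed_tile v).measurableSet

theorem volume_tile_lt_top (v : S.Λ) : volume (S.tile v) < ⊤ :=
  (measure_mono (S.tile_subset_ball v)).trans_lt (S.volume_ball_lt_top _ _)

/-- The condition of a tile on one level follows from the condition on a deeper level. -/
theorem tile_level_of_le {x : Fin n → ℝ} {v : S.Λ} {m k : ℕ} (hmk : m ≤ k)
    (h : ∃ u : S.Λ, S.par^[k] u = v ∧ S.nrm (S.app k x - u) ≤ S.rad) :
    ∃ u : S.Λ, S.par^[m] u = v ∧ S.nrm (S.app m x - u) ≤ S.rad := by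
  obtain ⟨u, hu, h⟩ := h
  refine ⟨S.par^[k - m] u, ?_, ?_⟩
  · rw [← Function.iterate_add_apply, Nat.add_sub_cancel' hmk, hu]
  · apply S.nrm_par_iterate_le
    rwa [← app_add, show ((k - m : ℕ) : ℤ) + m = k by omega]

/-- The conditions are nested, so infinitely many levels give all of them. This lets pigeonhole
arguments over finitely many lattice points replace compactness. -/
theorem mem_tile_of_frequently {x : Fin n → ℝ} {v : S.Λ}
    (h : ∃ᶠ k : ℕ in atTop, ∃ u : S.Λ, S.par^[k] u = v ∧ S.nrm (S.app k x - u) ≤ S.rad) :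
    x ∈ S.tile v := by
  intro m
  obtain ⟨k, hmk, hk⟩ := (frequently_atTop.1 h) m
  exact S.tile_level_of_le hmk hk

theorem mem_tile_par {x : Fin n → ℝ} {u : S.Λ} (h : S.app 1 x ∈ S.tile u) : x ∈ S.tile (S.par u) := by
  intro m
  refine S.tile_level_of_le (Nat.le_succ m) ?_
  obtain ⟨t, ht, hn⟩ := h m
  refine ⟨t, by rw [Function.iterate_succ_apply', ht], ?_⟩
  rw [← app_add] at hn
  exact_mod_cast hn

/-- Approximants of every deeper level pass through one of the finitely many children of `v`; some
child serves infinitely many levels and hence all. -/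
theorem exists_mem_tile_of_par {x : Fin n → ℝ} {v : S.Λ} (h : x ∈ S.tile v) :
    ∃ u, S.par u = v ∧ S.app 1 x ∈ S.tile u := by
  have h1 : ∃ᶠ k : ℕ in atTop, ∃ u ∈ {u : S.Λ | S.par^[1] u = v}, ∃ t : S.Λ, S.par^[k] t = u ∧
      S.nrm (S.app k (S.app 1 x) - t) ≤ S.rad := by
    refine Eventually.frequently (Eventually.of_forall fun k => ?_)
    obtain ⟨t, ht, hn⟩ := h (k + 1)
    refine ⟨S.par^[k] t, ?_, t, rfl, ?_⟩
    · rw [Set.mem_ofPred_eq, Function.iterate_one, ← Function.iterate_succ_apply' S.par, ht]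
    · rw [← app_add]
      exact_mod_cast hn
  have h2 : ∃ u ∈ {u : S.Λ | S.par^[1] u = v}, ∃ᶠ k : ℕ in atTop, ∃ t : S.Λ, S.par^[k] t = u ∧
      S.nrm (S.app k (S.app 1 x) - t) ≤ S.rad := by
    by_contra! hcon
    have := (S.finite_par_iterate 1 v).eventually_all (l := atTop)
      (p := fun u k => ¬ ∃ t : S.Λ, S.par^[k] t = u ∧
      S.nrm (S.app k (S.app 1 x) - t) ≤ S.rad)
    refine h1 ?_
    have h3 := this.2 (fun u hu => by simpa using hcon u hu)
    filter_upwards [h3] with k hk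
    rintro ⟨u, hu, hk'⟩
    exact hk u hu hk'
  obtain ⟨u, hu, h3⟩ := h2
  exact ⟨u, hu, S.mem_tile_of_frequently h3⟩

theorem app_one_image_tile (v : S.Λ) : S.app 1 '' S.tile v = ⋃ u ∈ S.desc 1 v, S.tile u := by
  ext y
  simp only [mem_iUnion, mem_desc, Function.iterate_one, exists_prop]
  constructor
  · rintro ⟨x, hx, rfl⟩
    exact S.exists_mem_tile_of_par hx
  · rintro ⟨u, rfl, hy⟩
    refine ⟨S.app (-1) y, S.mem_tile_par (by simpa using hy), by simp⟩

theorem app_image_tile (k : ℕ) (v : S.Λ) : S.app k '' S.tile v = ⋃ u ∈ S.desc k v, S.tile u := by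
  induction k with
  | zero =>
    rw [desc_zero]
    simp
  | succ k ih =>
    rw [Nat.cast_succ, add_comm, app_image_add, ih, Set.image_iUnion₂]
    simp_rw [app_one_image_tile]
    ext y
    simp only [mem_iUnion, mem_desc, exists_prop, Function.iterate_one]
    constructor
    · rintro ⟨t, ht, u, hu, hy⟩
      exact ⟨u, by rw [Function.iterate_succ_apply, hu, ht], hy⟩
    · rintro ⟨u, hu, hy⟩
      exact ⟨_, by rw [← Function.iterate_succ_apply, hu], u, rfl, hy⟩

theorem exists_lattice_near (x : Fin n → ℝ) : ∃ u : S.Λ, ∃ t ∈ S.T, x = u + t := by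
  have h : x ∈ ⋃ z ∈ S.Λ, (fun x => z + x) '' S.T := by rw [S.tile_cover]; trivial
  simp only [mem_iUnion] at h
  obtain ⟨z, hz, t, ht, rfl⟩ := h
  exact ⟨⟨z, hz⟩, t, ht, rfl⟩

theorem exists_nrm_sub_le (x : Fin n → ℝ) : ∃ u : S.Λ, S.nrm (x - u) ≤ S.R := by
  obtain ⟨u, t, ht, rfl⟩ := S.exists_lattice_near x
  exact ⟨u, by simpa using S.subset_ball ht⟩

/-- Choose lattice points near `Φ^m x` and look at their `m`-th ancestors. These all lie within
`rad` of `x`, so one ancestor occurs for infinitely many `m`. -/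
theorem exists_mem_tile (x : Fin n → ℝ) : ∃ v, x ∈ S.tile v := by
  choose u hu using fun m : ℕ => S.exists_nrm_sub_le (S.app m x)
  have hu' : ∀ m : ℕ, S.nrm (S.app m x - u m) ≤ S.rad := fun m => (hu m).trans S.R_le_rad
  by_contra! hcon
  have hfin := S.finite_lattice_ball x S.rad
  have h3 := (hfin.eventually_all (l := atTop) (p := fun v k => ¬ ∃ t : S.Λ, S.par^[k] t = v ∧
      S.nrm (S.app k x - t) ≤ S.rad)).2 (fun v _ => by
        have := mt S.mem_tile_of_frequently (hcon v)
        simpa using this)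
  obtain ⟨k, hk⟩ := h3.exists
  refine hk (S.par^[k] (u k)) ?_ ⟨u k, rfl, hu' k⟩
  rw [Set.mem_ofPred_eq, mem_ball, nrm_sub_comm]
  exact S.nrm_par_iterate_le k (hu' k)

theorem coe_mem_tile (v : S.Λ) : (v : Fin n → ℝ) ∈ S.tile v := fun m =>
  ⟨S.up^[m] v, S.par_iterate_up_iterate m v, by simpa [coe_up_iterate] using S.rad_pos.le⟩

theorem add_mem_tile {v z : S.Λ} (hz : z ∈ range S.up^[S.w - 1]) {x : Fin n → ℝ}
    (hx : x ∈ S.tile v) : x + z ∈ S.tile (v + z) := by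
  intro m
  obtain ⟨u, hu, hn⟩ := hx m
  refine ⟨u + S.up^[m] z, by rw [par_iterate_add S hz, hu], ?_⟩
  convert hn using 2
  push_cast
  rw [map_add, coe_up_iterate]
  abel

theorem neg_mem_range_up_iterate {z : S.Λ} {j : ℕ} (hz : z ∈ range S.up^[j]) :
    -z ∈ range S.up^[j] := by
  obtain ⟨y, rfl⟩ := hz
  exact ⟨-y, Subtype.ext (by simp [coe_up_iterate])⟩

theorem tile_add {v z : S.Λ} (hz : z ∈ range S.up^[S.w - 1]) :
    S.tile (v + z) = (fun x => (z : Fin n → ℝ) + x) '' S.tile v := by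
  ext x
  constructor
  · intro hx
    refine ⟨x - z, ?_, by simp⟩
    have := S.add_mem_tile (S.neg_mem_range_up_iterate hz) hx
    simpa [sub_eq_add_neg] using this
  · rintro ⟨y, hy, rfl⟩
    simpa [add_comm] using S.add_mem_tile hz hy

/-- The volume of a tile. -/
def κ (v : S.Λ) : ℝ := volume.real (S.tile v)

theorem κ_nonneg (v : S.Λ) : 0 ≤ S.κ v := measureReal_nonneg

theorem κ_add {v z : S.Λ} (hz : z ∈ range S.up^[S.w - 1]) : S.κ (v + z) = S.κ v := by
  rw [κ, κ, tile_add S hz, measureReal_def, measureReal_def, Set.image_add_left, measure_preimage_add]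

theorem κ_of_mem_range {v : S.Λ} (hv : v ∈ range S.up^[S.w - 1]) : S.κ v = S.κ 0 := by
  simpa using S.κ_add (v := 0) hv

theorem card_desc_add_range {v z : S.Λ} (hz : z ∈ range S.up^[S.w - 1]) (k : ℕ) :
    (S.desc k (v + z)).card = (S.desc k v).card := by
  symm
  refine Finset.card_nbij' (fun u => u + S.up^[k] z) (fun u => u - S.up^[k] z) ?_ ?_ ?_ ?_
  · intro u hu
    have hu' : S.par^[k] u = v := by simpa using hu
    simp [par_iterate_add S hz, hu']
  · intro u hu
    have hu' : S.par^[k] u = v + z := by simpa using hu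
    have h := S.par_iterate_add (S.neg_mem_range_up_iterate hz) k u
    rw [hu'] at h
    have h2 : S.up^[k] (-z) = -S.up^[k] z := Subtype.ext (by simp [coe_up_iterate])
    rw [h2, ← sub_eq_add_neg] at h
    simp [h]
  · intro u _
    simp
  · intro u _
    simp

theorem card_desc_of_mem_range {v : S.Λ} (hv : v ∈ range S.up^[S.w - 1]) (k : ℕ) :
    (S.desc k v).card = (S.desc k 0).card := by
  simpa using S.card_desc_add_range (v := 0) hv k

theorem desc_one_of_notMem {v : S.Λ} (hv : v ∉ range S.up^[S.w - 1]) : S.desc 1 v = {S.up v} := by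
  ext u
  simp only [mem_desc, Function.iterate_one, Finset.mem_singleton]
  constructor
  · rintro rfl
    have h : S.dig u = 0 := by
      by_contra h
      exact hv (S.par_mem_range h)
    have := S.coe_eq_par u
    rw [h, add_zero] at this
    exact Subtype.ext this
  · rintro rfl
    simp


/-! ### Tile volumes and descendant counts. -/

theorem finite_D : S.D.Finite := by
  refine Set.finite_of_ncard_ne_zero fun h => ?_
  have h1 := S.digits_card
  rw [h] at h1
  have h2 : 0 ≤ S.ρ ^ (n * (S.w - 1)) * (S.ρ ^ n - 1) :=
    mul_nonneg (pow_nonneg S.rho_pos.le _) (sub_nonneg.2 S.one_lt_q.le)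
  push_cast at h1
  linarith

theorem finite_digits : {u : S.Λ | (u : Fin n → ℝ) ∈ S.D}.Finite :=
  S.finite_D.preimage Subtype.val_injective.injOn

/-- The digits as lattice points. -/
def digits : Finset S.Λ := S.finite_digits.toFinset

@[simp] theorem mem_digits {u : S.Λ} : u ∈ S.digits ↔ (u : Fin n → ℝ) ∈ S.D := by simp [digits]

theorem card_digits : (S.digits.card : ℝ) = S.q ^ (S.w - 1) * (S.q - 1) + 1 := by
  have h : S.digits.card = S.D.ncard := by
    rw [digits, ← Set.ncard_eq_toFinset_card _ S.finite_digits]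
    refine Set.ncard_congr (fun u _ => (u : Fin n → ℝ)) (fun u hu => hu)
      (fun u v _ _ h => Subtype.ext h) (fun a ha => ⟨⟨a, S.digits_lattice a ha⟩, ha, rfl⟩)
  rw [h, S.digits_card, q, pow_mul]

theorem sum_desc_one {v : S.Λ} (hv : v ∈ range S.up^[S.w - 1]) (f : S.Λ → ℝ) :
    ∑ u ∈ S.desc 1 v, f u = ∑ a ∈ S.digits, f (S.up v + a) := by
  symm
  refine Finset.sum_nbij' (fun a => S.up v + a) (fun u => u - S.up v) ?_ ?_ ?_ ?_ ?_
  · intro a ha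
    rw [mem_digits] at ha
    have : S.IsStep (S.up v + a) v a := ⟨ha, by simp, fun _ => hv⟩
    simp [(S.par_dig_of_isStep this).1]
  · intro u hu
    have hu' : S.par u = v := by simpa using hu
    have h := S.coe_eq_par u
    rw [hu'] at h
    rw [mem_digits]
    push_cast
    rw [h, coe_up, add_sub_cancel_left]
    exact S.dig_mem u
  · intro a _
    simp
  · intro u _
    simp
  · intro a _
    rfl

theorem desc_eq_singleton {s : ℕ} {v : S.Λ} (h : ∀ i < s, S.up^[i] v ∉ range S.up^[S.w - 1]) :
    S.desc s v = {S.up^[s] v} := by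
  induction s with
  | zero => simp [desc_zero]
  | succ s ih =>
    have ih' := ih fun i hi => h i (by omega)
    have h1 := S.desc_one_of_notMem (h s (by omega))
    ext u
    rw [mem_desc, Function.iterate_succ_apply, Function.iterate_succ_apply' S.up]
    have h2 : S.par^[s] (S.par u) = v ↔ S.par u ∈ S.desc s v := S.mem_desc.symm
    rw [h2, ih', Finset.mem_singleton]
    have h3 : S.par u = S.up^[s] v ↔ u ∈ S.desc 1 (S.up^[s] v) := by simp
    rw [h3, h1]

theorem up_iterate_notMem {t : S.Λ} (ht : t ∉ range S.up) {i : ℕ} (hi : i < S.w - 1) :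
    S.up^[i] t ∉ range S.up^[S.w - 1] := by
  rintro ⟨y, hy⟩
  rw [show S.w - 1 = i + (1 + (S.w - 2 - i)) by omega, Function.iterate_add_apply] at hy
  have := S.up_injective.iterate i hy
  rw [Function.iterate_add_apply, Function.iterate_one] at this
  exact ht ⟨_, this⟩

theorem desc_eq_singleton_of_notMem {t : S.Λ} (ht : t ∉ range S.up) {s : ℕ} (hs : s ≤ S.w - 1) :
    S.desc s t = {S.up^[s] t} :=
  S.desc_eq_singleton fun _ hi => S.up_iterate_notMem ht (by omega)

/-- The number `s` counts the zeros that must still be appended to `v` before a non-zero digit is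
allowed. Up to translation by `Φ^(w-1)Λ` it is the state of an automaton. -/
theorem exists_state (v : S.Λ) : ∃ s ≤ S.w - 1, (∀ i ≤ s, S.desc i v = {S.up^[i] v}) ∧
    S.up^[s] v ∈ range S.up^[S.w - 1] ∧ ∀ i < s, S.up^[i] v ∉ range S.up^[S.w - 1] := by
  classical
  have hex : ∃ s, S.up^[s] v ∈ range S.up^[S.w - 1] := ⟨S.w - 1, v, rfl⟩
  refine ⟨Nat.find hex, Nat.find_min' hex ⟨v, rfl⟩, fun i hi => ?_, Nat.find_spec hex,
    fun i hi => Nat.find_min hex hi⟩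
  exact S.desc_eq_singleton fun j hj => Nat.find_min hex (by omega)

theorem κ_up_iterate {s : ℕ} {v : S.Λ} (h : S.desc s v = {S.up^[s] v}) :
    S.κ (S.up^[s] v) = S.q ^ s * S.κ v := by
  have h1 := S.volumeReal_app_image s (S.tile v)
  rw [app_image_tile, h, zpow_natCast] at h1
  simpa [κ] using h1

theorem κ_of_notMem {t : S.Λ} (ht : t ∉ range S.up) : S.q ^ (S.w - 1) * S.κ t = S.κ 0 := by
  rw [← S.κ_up_iterate (S.desc_eq_singleton_of_notMem ht le_rfl)]
  exact S.κ_of_mem_range ⟨t, rfl⟩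

/-- The cardinality of `D` enters here. A point of `Φ^(w-1)Λ` has one child with tile volume `κ 0`
and `q^(w-1) (q - 1)` children with volume `κ 0 / q^(w-1)`, in total `q κ 0`. Any other point has
only the child `Φ v`, whose tile is `Φ (tile v)`. -/
theorem sum_κ_desc_one (v : S.Λ) : ∑ u ∈ S.desc 1 v, S.κ u = S.q * S.κ v := by
  classical
  by_cases hv : v ∈ range S.up^[S.w - 1]
  · rw [S.sum_desc_one hv]
    have hup : S.up v ∈ range S.up^[S.w - 1] := by
      simpa using S.up_iterate_mem_range hv 1
    have hq : 0 < S.q ^ (S.w - 1) := pow_pos S.q_pos _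
    have h0 : (0 : S.Λ) ∈ S.digits := by simpa using S.zero_digit
    rw [← Finset.add_sum_erase _ _ h0, add_zero, S.κ_of_mem_range hup, S.κ_of_mem_range hv]
    have h1 : ∀ a ∈ S.digits.erase 0, S.κ (S.up v + a) = S.κ 0 / S.q ^ (S.w - 1) := by
      intro a ha
      rw [Finset.mem_erase, mem_digits] at ha
      rw [add_comm, S.κ_add hup, eq_div_iff hq.ne', mul_comm]
      exact S.κ_of_notMem (S.digit_notMem_range ha.2 ha.1)
    rw [Finset.sum_congr rfl h1, Finset.sum_const, nsmul_eq_mul, Finset.card_erase_of_mem h0,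
      Nat.cast_sub (Finset.card_pos.2 ⟨_, h0⟩), S.card_digits]
    field_simp
    push_cast
    ring
  · have h := S.desc_one_of_notMem hv
    rw [h, Finset.sum_singleton]
    have := S.κ_up_iterate (s := 1) (v := v) (by simpa using h)
    simpa using this

theorem sum_κ_desc (k : ℕ) (v : S.Λ) : ∑ u ∈ S.desc k v, S.κ u = S.q ^ k * S.κ v := by
  induction k with
  | zero => simp [desc_zero]
  | succ k ih =>
    rw [add_comm, sum_desc_add]
    simp_rw [sum_κ_desc_one]
    rw [← Finset.mul_sum, ih]
    ring

/-- If the measure of a finite union is the sum of the measures, the sets are almost disjoint. -/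
theorem _root_.MeasureTheory.aedisjoint_of_measureReal_biUnion_eq_sum {α ι : Type*}
    [MeasurableSpace α] {μ : Measure α} {s : Finset ι} {A : ι → Set α}
    (hA : ∀ i ∈ s, MeasurableSet (A i)) (hfin : ∀ i ∈ s, μ (A i) ≠ ⊤)
    (h : μ.real (⋃ i ∈ s, A i) = ∑ i ∈ s, μ.real (A i)) {i j : ι} (hi : i ∈ s) (hj : j ∈ s)
    (hij : i ≠ j) : AEDisjoint μ (A i) (A j) := by
  classical
  have hj' : j ∈ s.erase i := Finset.mem_erase.2 ⟨hij.symm, hj⟩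
  rw [← Finset.add_sum_erase _ _ hi, ← Finset.add_sum_erase _ _ hj'] at h
  have h1 : (⋃ k ∈ s, A k) ⊆ (A i ∪ A j) ∪ ⋃ k ∈ (s.erase i).erase j, A k := by
    intro x hx
    simp only [mem_iUnion, exists_prop] at hx
    obtain ⟨k, hk, hx⟩ := hx
    by_cases hki : k = i
    · exact Or.inl (Or.inl (hki ▸ hx))
    by_cases hkj : k = j
    · exact Or.inl (Or.inr (hkj ▸ hx))
    · exact Or.inr (mem_biUnion (Finset.mem_erase.2 ⟨hkj, Finset.mem_erase.2 ⟨hki, hk⟩⟩) hx)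
  have hfu : μ (⋃ k ∈ (s.erase i).erase j, A k) ≠ ⊤ := by
    refine ((measure_biUnion_finset_le _ _).trans_lt (ENNReal.sum_lt_top.2 fun k hk => ?_)).ne
    exact (hfin k (Finset.mem_of_mem_erase (Finset.mem_of_mem_erase hk))).lt_top
  have hij_fin : μ (A i ∪ A j) ≠ ⊤ := measure_union_ne_top (hfin i hi) (hfin j hj)
  have h2 : μ.real (⋃ k ∈ s, A k) ≤ μ.real (A i ∪ A j) +
      ∑ k ∈ (s.erase i).erase j, μ.real (A k) :=
    (measureReal_mono h1 (measure_union_ne_top hij_fin hfu)).trans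
      ((measureReal_union_le _ _).trans (by gcongr; exact measureReal_biUnion_finset_le _ _))
  have h3 := measureReal_union_add_inter (μ := μ) (s := A i) (hA j hj) (hfin i hi) (hfin j hj)
  have h4 : μ.real (A i ∩ A j) = 0 := by
    have := measureReal_nonneg (μ := μ) (s := A i ∩ A j)
    linarith
  rw [measureReal_def, ENNReal.toReal_eq_zero_iff] at h4
  exact h4.resolve_right (ne_top_of_le_ne_top (hfin i hi) (measure_mono inter_subset_left))

/-- Since `0` is its own parent, two lattice points are descendants of `0` on one common level. The
tiles of that level have union `Φ^k (tile 0)`, and their volumes add up to exactly the volume of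
this union, which leaves no room for overlap. -/
theorem aedisjoint_tile : Pairwise fun u v : S.Λ => AEDisjoint volume (S.tile u) (S.tile v) := by
  intro u v huv
  obtain ⟨k, hk⟩ := S.exists_par_iterate_eq_zero u
  obtain ⟨l, hl⟩ := S.exists_par_iterate_eq_zero v
  have hu : u ∈ S.desc (l + k) 0 := by
    rw [mem_desc, Function.iterate_add_apply, hk, par_iterate_zero]
  have hv : v ∈ S.desc (l + k) 0 := by
    rw [mem_desc, add_comm, Function.iterate_add_apply, hl, par_iterate_zero]
  refine aedisjoint_of_measureReal_biUnion_eq_sum (s := S.desc (l + k) 0) (A := S.tile)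
    (fun i _ => S.measurableSet_tile i) (fun i _ => (S.volume_tile_lt_top i).ne) ?_ hu hv huv
  rw [← app_image_tile, volumeReal_app_image, zpow_natCast]
  exact (S.sum_κ_desc (l + k) 0).symm

/-- With `s` forced zeros left, `v` is in the state that `t` reaches after `j = w - 1 - s` zeros.
All counts and volumes thus reduce to those of one point `t ∉ ΦΛ`. -/
theorem exists_type {t : S.Λ} (ht : t ∉ range S.up) (v : S.Λ) :
    ∃ j ≤ S.w - 1, S.κ v = S.q ^ j * S.κ t ∧ ∀ m, (S.desc m v).card = (S.desc (m + j) t).card := by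
  obtain ⟨s, hs, hsing, hr, -⟩ := S.exists_state v
  have hq := S.q_pos
  refine ⟨S.w - 1 - s, Nat.sub_le _ _, ?_, fun m => ?_⟩
  · have h1 := S.κ_up_iterate (hsing s le_rfl)
    rw [S.κ_of_mem_range hr, ← S.κ_of_notMem ht, show S.w - 1 = s + (S.w - 1 - s) by omega, pow_add] at h1
    have h2 : S.q ^ s ≠ 0 := (pow_pos hq _).ne'
    refine mul_left_cancel₀ h2 ?_
    rw [← h1]
    ring
  · have key : ∀ k, ((S.desc (k + (S.w - 1)) t).card : ℝ) = (S.desc k 0).card := by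
      intro k
      rw [card_desc_add, S.desc_eq_singleton_of_notMem ht le_rfl, Finset.sum_singleton,
        S.card_desc_of_mem_range ⟨t, rfl⟩]
    rcases le_total m s with hms | hms
    · rw [hsing m hms, S.desc_eq_singleton_of_notMem ht (by omega)]
      simp
    · have h1 := S.card_desc_add s (m - s) v
      rw [hsing s le_rfl, Finset.sum_singleton, S.card_desc_of_mem_range hr, ← key,
        Nat.sub_add_cancel hms] at h1
      rw [show m + (S.w - 1 - s) = m - s + (S.w - 1) by omega]
      exact_mod_cast h1

theorem card_desc_small {t : S.Λ} (ht : t ∉ range S.up) {k : ℕ} (hk : k < S.w) :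
    (S.desc k t).card = 1 := by
  rw [S.desc_eq_singleton_of_notMem ht (by omega), Finset.card_singleton]

/-- After `w - 1` forced zeros the point `t` behaves like `0`. The next digit is either `0`, which
leads back to that state, or one of `q^(w-1) (q - 1)` digits that behave like `t`. -/
theorem card_desc_rec {t : S.Λ} (ht : t ∉ range S.up) (k : ℕ) :
    ((S.desc (k + S.w) t).card : ℝ) = (S.desc (k + S.w - 1) t).card +
      S.q ^ (S.w - 1) * (S.q - 1) * (S.desc k t).card := by
  classical
  have key : ∀ t ∉ range S.up, ∀ k, ((S.desc (k + (S.w - 1)) t).card : ℝ) = (S.desc k 0).card := by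
    intro t ht k
    rw [card_desc_add, S.desc_eq_singleton_of_notMem ht le_rfl, Finset.sum_singleton,
      S.card_desc_of_mem_range ⟨t, rfl⟩]
  have key2 : ∀ a ∉ range S.up, ((S.desc k a).card : ℝ) = (S.desc k t).card := by
    intro a ha
    rcases lt_or_ge k S.w with hk | hk
    · rw [S.card_desc_small ha hk, S.card_desc_small ht hk]
    · rw [show k = k - (S.w - 1) + (S.w - 1) by omega, key a ha, key t ht]
  have hw := S.w_pos
  rw [show k + S.w = (k + 1) + (S.w - 1) by omega, key t ht, card_desc_add,
    show (k + 1) + (S.w - 1) - 1 = k + (S.w - 1) by omega, key t ht,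
    S.sum_desc_one ⟨0, S.up_iterate_zero _⟩]
  have h0 : (0 : S.Λ) ∈ S.digits := by simpa using S.zero_digit
  rw [← Finset.add_sum_erase _ _ h0, map_zero, add_zero]
  simp_rw [zero_add]
  congr 1
  have h1 : ∀ a ∈ S.digits.erase 0, ((S.desc k a).card : ℝ) = (S.desc k t).card := by
    intro a ha
    rw [Finset.mem_erase, mem_digits] at ha
    exact key2 a (S.digit_notMem_range ha.2 ha.1)
  rw [Finset.sum_congr rfl h1, Finset.sum_const, nsmul_eq_mul, Finset.card_erase_of_mem h0,
    Nat.cast_sub (Finset.card_pos.2 ⟨_, h0⟩), S.card_digits]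
  push_cast
  ring

end NAFSystem

/-! ### Explicit geometric decay for the descendant recursion. -/

/-- An antitone sequence that contracts over blocks of length `l` decays geometrically. -/
theorem le_geometric_of_block_contraction {A : ℕ → ℝ} {l : ℕ} (hl : 0 < l) {θ : ℝ} (hθ : 0 < θ)
    (hθ1 : θ ≤ 1) (hA0 : ∀ k, 0 ≤ A k) (hanti : ∀ k, A (k + 1) ≤ A k)
    (hcon : ∀ k, A (k + l) ≤ θ ^ l * A k) (k : ℕ) : A k ≤ A 0 / θ ^ l * θ ^ k := by
  induction k using Nat.strong_induction_on with
  | _ k ih =>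
    rcases lt_or_ge k l with hk | hk
    · have h1 : A k ≤ A 0 := antitone_nat_of_succ_le hanti (Nat.zero_le k)
      refine h1.trans ?_
      rw [div_mul_eq_mul_div, le_div_iff₀ (pow_pos hθ _)]
      exact mul_le_mul_of_nonneg_left (pow_le_pow_of_le_one hθ.le hθ1 hk.le) (hA0 0)
    · have h1 := hcon (k - l)
      rw [Nat.sub_add_cancel hk] at h1
      refine h1.trans ?_
      have h2 := ih (k - l) (by omega)
      calc θ ^ l * A (k - l) ≤ θ ^ l * (A 0 / θ ^ l * θ ^ (k - l)) := by gcongr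
        _ = A 0 / θ ^ l * θ ^ k := by
          rw [show θ ^ k = θ ^ l * θ ^ (k - l) by rw [← pow_add]; congr 1; omega]
          ring

/-- Popoviciu's inequality for the weights `p, …, p, 1`. -/
theorem weighted_sq_sum_le {p : ℝ} (hp : 0 ≤ p) {l : ℕ} {y : ℕ → ℝ} {V : ℝ}
    (hmean : y l + p * ∑ i ∈ Finset.range l, y i = 0)
    (hV : ∀ i ≤ l, ∀ j ≤ l, y i - y j ≤ V) :
    y l ^ 2 + p * ∑ i ∈ Finset.range l, y i ^ 2 ≤ (1 + p * l) * (V ^ 2 / 4) := by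
  have hne : (Finset.range (l + 1)).Nonempty := ⟨0, by simp⟩
  obtain ⟨a, ha, hmax⟩ := Finset.exists_max_image (Finset.range (l + 1)) y hne
  obtain ⟨b, hb, hmin⟩ := Finset.exists_min_image (Finset.range (l + 1)) y hne
  rw [Finset.mem_range] at ha hb
  have hab : y a - y b ≤ V := hV a (by omega) b (by omega)
  have hba : y b ≤ y a := hmax b (by simpa using hb)
  -- This is `(max - y i) (y i - min) ≥ 0`. In the weighted sum the linear term drops out because
  -- the mean vanishes, and `-max * min ≤ (max - min)² / 4` remains.
  have hpt : ∀ i ≤ l, y i ^ 2 ≤ (y a + y b) * y i - y a * y b := by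
    intro i hi
    have h1 := hmax i (by simp; omega)
    have h2 := hmin i (by simp; omega)
    nlinarith [mul_nonneg (sub_nonneg.2 h1) (sub_nonneg.2 h2)]
  have hsum : ∑ i ∈ Finset.range l, y i ^ 2 ≤
      (y a + y b) * ∑ i ∈ Finset.range l, y i - l * (y a * y b) := by
    calc ∑ i ∈ Finset.range l, y i ^ 2
        ≤ ∑ i ∈ Finset.range l, ((y a + y b) * y i - y a * y b) :=
          Finset.sum_le_sum fun i hi => hpt i (by simp at hi; omega)
      _ = _ := by rw [Finset.sum_sub_distrib, ← Finset.mul_sum]; simp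
  have hl := hpt l le_rfl
  have h1 : y l ^ 2 + p * ∑ i ∈ Finset.range l, y i ^ 2 ≤ (1 + p * l) * (-(y a * y b)) := by
    have := mul_le_mul_of_nonneg_left hsum hp
    have h2 : (y a + y b) * (y l + p * ∑ i ∈ Finset.range l, y i) = 0 := by rw [hmean, mul_zero]
    nlinarith
  refine h1.trans ?_
  have hpl : 0 ≤ 1 + p * l := by positivity
  refine mul_le_mul_of_nonneg_left ?_ hpl
  nlinarith [sq_nonneg (y a + y b)]

/-- Differences within a window are controlled by the sum of the squares of the increments. -/
theorem sub_le_sqrt_sum_sq (y : ℕ → ℝ) (l i j : ℕ) (hi : i ≤ l) (hj : j ≤ l) :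
    y i - y j ≤ Real.sqrt (l * ∑ k ∈ Finset.range l, (y (k + 1) - y k) ^ 2) := by
  have habs : |y i - y j| ≤ ∑ k ∈ Finset.range l, |y (k + 1) - y k| := by
    wlog hij : j ≤ i generalizing i j
    · rw [abs_sub_comm]
      exact this j i hj hi (by omega)
    · have h1 : y i - y j = ∑ k ∈ Finset.Ico j i, (y (k + 1) - y k) :=
        (Finset.sum_Ico_sub y hij).symm
      rw [h1]
      refine (Finset.abs_sum_le_sum_abs _ _).trans ?_
      refine Finset.sum_le_sum_of_subset_of_nonneg (fun k hk => ?_) fun _ _ _ => abs_nonneg _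
      simp at hk ⊢
      omega
  refine (le_abs_self _).trans (habs.trans ?_)
  refine Real.le_sqrt_of_sq_le ?_
  have := sq_sum_le_card_mul_sum_sq (s := Finset.range l) (f := fun k => |y (k + 1) - y k|)
  simpa using this

/-- The recursion `e (k + w) = e (k + w - 1) / q + (1 - 1 / q) * e k` mixes: a solution with
vanishing invariant decays geometrically, with an explicit rate. -/
theorem exists_geometric_decay {q : ℝ} (hq : 1 < q) {l : ℕ} {e : ℕ → ℝ}
    (hrec : ∀ k, e (k + l + 1) = q⁻¹ * e (k + l) + (1 - q⁻¹) * e k)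
    (h0 : e l + (1 - q⁻¹) * ∑ i ∈ Finset.range l, e i = 0) :
    ∃ θ : ℝ, 0 < θ ∧ θ < (1 + 1 / (q * ((l + 1 : ℕ) : ℝ) ^ 3))⁻¹ ∧
      ∃ C : ℝ, ∀ k, |e k| ≤ C * θ ^ k := by
  set p : ℝ := 1 - q⁻¹ with hp
  have hq0 : 0 < q := by linarith
  have hqi : q⁻¹ < 1 := inv_lt_one_of_one_lt₀ hq
  have hqi0 : 0 < q⁻¹ := inv_pos.2 hq0
  have hp0 : 0 < p := by linarith
  have hp1 : p < 1 := by linarith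
  have hqp : q⁻¹ = 1 - p := by linarith
  set a : ℝ := 1 / (q * ((l + 1 : ℕ) : ℝ) ^ 3) with ha
  have ha0 : 0 < a := by positivity
  have hμ0 : 0 < (1 + a)⁻¹ := by positivity
  -- The weighted mean with weights `p, …, p, 1` is conserved by the recursion.
  have hmean : ∀ k, e (k + l) + p * ∑ i ∈ Finset.range l, e (k + i) = 0 := by
    intro k
    induction k with
    | zero => simpa using h0
    | succ k ih =>
      have h1 : ∑ i ∈ Finset.range l, e (k + 1 + i) =
          ∑ i ∈ Finset.range l, e (k + i) + e (k + l) - e k := by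
        have := Finset.sum_range_succ (fun i => e (k + i)) l
        rw [Finset.sum_range_succ'] at this
        simp only [add_zero] at this
        rw [← this]
        simp only [add_sub_cancel_right]
        exact Finset.sum_congr rfl fun i _ => by congr 1; omega
      rw [h1, show k + 1 + l = k + l + 1 by omega, hrec, hqp]
      linarith
  -- For `l = 0` the invariant is the sequence itself, so `e = 0`; halving the bound makes the rate
  -- strictly smaller.
  rcases Nat.eq_zero_or_pos l with rfl | hl
  · refine ⟨(1 + a)⁻¹ / 2, by positivity, by linarith, 0, fun k => ?_⟩
    have := hmean k
    simp at this
    simp [this]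
  set A : ℕ → ℝ := fun k => e (k + l) ^ 2 + p * ∑ i ∈ Finset.range l, e (k + i) ^ 2 with hA
  have hA0 : ∀ k, 0 ≤ A k := fun k => by positivity
  -- The new term is a convex combination of `e (k + l)` and `e k`; the energy loss is the variance
  -- `p (1 - p) (e k - e (k + l))²`, expressed by the increment `p (e k - e (k + l))`.
  have hstep : ∀ k, A (k + 1) = A k - (q * p)⁻¹ * (e (k + l + 1) - e (k + l)) ^ 2 := by
    intro k
    have h1 : ∑ i ∈ Finset.range l, e (k + 1 + i) ^ 2 =
        ∑ i ∈ Finset.range l, e (k + i) ^ 2 + e (k + l) ^ 2 - e k ^ 2 := by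
      have := Finset.sum_range_succ (fun i => e (k + i) ^ 2) l
      rw [Finset.sum_range_succ'] at this
      simp only [add_zero] at this
      rw [← this]
      simp only [add_sub_cancel_right]
      exact Finset.sum_congr rfl fun i _ => by congr 2; omega
    simp only [hA]
    rw [h1, show k + 1 + l = k + l + 1 by omega, hrec, mul_inv, hqp]
    field_simp
    ring
  have hanti : ∀ k, A (k + 1) ≤ A k := fun k => by
    rw [hstep]
    have : 0 ≤ (q * p)⁻¹ * (e (k + l + 1) - e (k + l)) ^ 2 := by positivity
    linarith
  have hblock : ∀ k m, A (k + m) =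
      A k - (q * p)⁻¹ * ∑ i ∈ Finset.range m, (e (k + l + (i + 1)) - e (k + l + i)) ^ 2 := by
    intro k m
    induction m with
    | zero => simp
    | succ m ih =>
      rw [Finset.sum_range_succ, ← add_assoc, hstep, ih, show k + m + l = k + l + m by omega,
        show k + l + m + 1 = k + l + (m + 1) by omega]
      ring
  have hl' : (0 : ℝ) < l := by exact_mod_cast hl
  -- Over `l` steps the energy loss bounds the sum of squared increments, which by Cauchy-Schwarz
  -- bounds the oscillation on the window, which by Popoviciu bounds the energy. With `(1 + p l) p ≤
  -- l + 1` this reads `A (k + l) ≤ q l (l + 1) / 4 * (A k - A (k + l))`.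
  set γ : ℝ := 1 + 4 / (q * ((l : ℝ) * (l + 1))) with hγ
  have hγ1 : 1 < γ := by
    have : 0 < 4 / (q * ((l : ℝ) * (l + 1))) := by positivity
    linarith
  have hcon : ∀ k, γ * A (k + l) ≤ A k := by
    intro k
    set D := ∑ i ∈ Finset.range l, (e (k + l + (i + 1)) - e (k + l + i)) ^ 2 with hD
    have hD0 : 0 ≤ D := Finset.sum_nonneg fun _ _ => sq_nonneg _
    have h1 := weighted_sq_sum_le hp0.le (y := fun i => e (k + l + i)) (hmean (k + l))
      (V := Real.sqrt (l * D)) (fun i hi j hj => sub_le_sqrt_sum_sq (fun i => e (k + l + i)) l i j hi hj)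
    rw [Real.sq_sqrt (by positivity)] at h1
    have h2 := hblock k l
    have h3 : A (k + l) ≤ (1 + p * l) * (l * D / 4) := h1
    have h4 : D = q * p * (A k - A (k + l)) := by
      rw [h2]
      field_simp
      ring
    have hdiff : 0 ≤ A k - A (k + l) := by
      rw [h2]
      have : 0 ≤ (q * p)⁻¹ * D := by positivity
      linarith
    have h5 : A (k + l) ≤ q * (l * (l + 1)) / 4 * (A k - A (k + l)) := by
      refine h3.trans ?_
      rw [h4]
      have h6 : (1 + p * l) * p ≤ l + 1 := by
        have h6' : p * l ≤ l := mul_le_of_le_one_left hl'.le hp1.le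
        have h6'' : 0 ≤ 1 + p * l := by positivity
        nlinarith
      calc (1 + p * l) * (l * (q * p * (A k - A (k + l))) / 4)
          = ((1 + p * l) * p) * (l * q / 4 * (A k - A (k + l))) := by ring
        _ ≤ (l + 1) * (l * q / 4 * (A k - A (k + l))) := by gcongr
        _ = _ := by ring
    have h7 : 4 / (q * ((l : ℝ) * (l + 1))) * A (k + l) ≤ A k - A (k + l) := by
      rw [div_mul_eq_mul_div, div_le_iff₀ (by positivity)]
      linarith
    rw [hγ]
    linarith
  -- By `exp x ≤ 1 + 2 x` on `[0, 1]` it suffices that `4 l / (q (l + 1)^3) < 4 / (q l (l + 1))`,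
  -- that is, `l² < (l + 1)²`.
  have hgap : (1 + a) ^ (2 * l) < γ := by
    have h1 : (1 + a) ^ (2 * l) ≤ Real.exp (a * (2 * l)) := by
      calc (1 + a) ^ (2 * l) ≤ (Real.exp a) ^ (2 * l) := by
            gcongr
            linarith [Real.add_one_le_exp a]
        _ = _ := by rw [← Real.exp_nat_mul]; congr 1; push_cast; ring
    have ha2 : a * (2 * l) = 2 * l / (q * ((l : ℝ) + 1) ^ 3) := by
      rw [ha]; push_cast; ring
    have hle : a * (2 * l) ≤ 1 := by
      rw [ha2, div_le_one (by positivity)]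
      have h2 : 2 * (l : ℝ) ≤ ((l : ℝ) + 1) ^ 3 := by nlinarith [sq_nonneg (l : ℝ), hl'.le]
      have h3 : 0 < ((l : ℝ) + 1) ^ 3 := by positivity
      nlinarith
    have h3 : Real.exp (a * (2 * l)) ≤ 1 + 2 * (a * (2 * l)) := by
      have h4 := Real.abs_exp_sub_one_le (x := a * (2 * l)) (by rw [abs_of_nonneg (by positivity)]; exact hle)
      rw [abs_of_nonneg (a := a * (2 * l)) (by positivity)] at h4
      linarith [le_abs_self (Real.exp (a * (2 * l)) - 1)]
    refine h1.trans_lt (h3.trans_lt ?_)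
    rw [hγ, ha2]
    have : 2 * (2 * l / (q * ((l : ℝ) + 1) ^ 3)) < 4 / (q * ((l : ℝ) * (l + 1))) := by
      rw [← mul_div_assoc, div_lt_div_iff₀ (by positivity) (by positivity)]
      have : (l : ℝ) * l < (l + 1) ^ 2 := by nlinarith
      have h5 : 0 < 4 * q * ((l : ℝ) + 1) := by positivity
      nlinarith [mul_lt_mul_of_pos_left this h5]
    linarith
  -- The exponent is `2 l` and not `l` because `A` is quadratic in `e`.
  set θ : ℝ := (γ⁻¹) ^ ((2 * l : ℕ) : ℝ)⁻¹ with hθ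
  have hθ0 : 0 < θ := by positivity
  have hθp : θ ^ (2 * l) = γ⁻¹ := Real.rpow_inv_natCast_pow (by positivity) (by omega)
  have hθμ : θ < (1 + a)⁻¹ := by
    refine lt_of_pow_lt_pow_left₀ (2 * l) hμ0.le ?_
    rw [hθp, inv_pow]
    exact inv_strictAnti₀ (by positivity) hgap
  have hθ1 : θ ≤ 1 := hθμ.le.trans (inv_le_one_of_one_le₀ (by linarith))
  refine ⟨θ, hθ0, hθμ, ?_⟩
  have hgeo := le_geometric_of_block_contraction hl (θ := θ ^ 2) (by positivity)
    (pow_le_one₀ hθ0.le hθ1) hA0 hanti (fun k => by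
      rw [← pow_mul, hθp, inv_mul_eq_div, le_div_iff₀ (by positivity), mul_comm]
      exact hcon k)
  have hpt : ∀ k, |e (k + l)| ≤ Real.sqrt (A 0 / (θ ^ 2) ^ l) * θ ^ k := by
    intro k
    refine abs_le_of_sq_le_sq ?_ (by positivity)
    rw [mul_pow, Real.sq_sqrt (div_nonneg (hA0 0) (by positivity)), pow_right_comm θ k 2]
    refine le_trans ?_ (hgeo k)
    have : 0 ≤ p * ∑ i ∈ Finset.range l, e (k + i) ^ 2 := by positivity
    simp only [hA]
    linarith
  refine ⟨Real.sqrt (A 0 / (θ ^ 2) ^ l) / θ ^ l + ∑ i ∈ Finset.range l, |e i| / θ ^ l, fun k => ?_⟩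
  have hs0 : 0 ≤ ∑ i ∈ Finset.range l, |e i| / θ ^ l := Finset.sum_nonneg fun _ _ => by positivity
  rcases lt_or_ge k l with hk | hk
  · have h1 : |e k| / θ ^ l ≤ ∑ i ∈ Finset.range l, |e i| / θ ^ l :=
      Finset.single_le_sum (f := fun i => |e i| / θ ^ l) (fun _ _ => by positivity)
        (Finset.mem_range.2 hk)
    have h2 : |e k| ≤ |e k| / θ ^ l * θ ^ k := by
      rw [div_mul_eq_mul_div, le_div_iff₀ (pow_pos hθ0 _)]
      exact mul_le_mul_of_nonneg_left (pow_le_pow_of_le_one hθ0.le hθ1 hk.le) (abs_nonneg _)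
    refine h2.trans ?_
    gcongr
    have : 0 ≤ Real.sqrt (A 0 / (θ ^ 2) ^ l) / θ ^ l := by positivity
    linarith
  · have h1 := hpt (k - l)
    rw [Nat.sub_add_cancel hk] at h1
    refine h1.trans ?_
    calc Real.sqrt (A 0 / (θ ^ 2) ^ l) * θ ^ (k - l)
        = Real.sqrt (A 0 / (θ ^ 2) ^ l) / θ ^ l * θ ^ k := by
          rw [show θ ^ k = θ ^ l * θ ^ (k - l) by rw [← pow_add]; congr 1; omega]
          field_simp
      _ ≤ _ := by gcongr; linarith

namespace NAFSystem

variable {n : ℕ} (S : NAFSystem n)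

/-! ### Lattice sums against volumes, and the volume of the smallest tile. -/

open Classical in
/-- The lattice points in a bounded set. -/
def pts (B : Set (Fin n → ℝ)) : Finset S.Λ :=
  if h : {u : S.Λ | (u : Fin n → ℝ) ∈ B}.Finite then h.toFinset else ∅

theorem finite_lattice_of_subset {B : Set (Fin n → ℝ)} {X : ℝ} (hB : B ⊆ S.ball 0 X) :
    {u : S.Λ | (u : Fin n → ℝ) ∈ B}.Finite :=
  (S.finite_lattice_ball 0 X).subset fun _ hu => hB hu

theorem mem_pts {B : Set (Fin n → ℝ)} {X : ℝ} (hB : B ⊆ S.ball 0 X) {u : S.Λ} :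
    u ∈ S.pts B ↔ (u : Fin n → ℝ) ∈ B := by
  rw [pts, dif_pos (S.finite_lattice_of_subset hB)]
  simp

/-- The lattice points whose balls of radius `c` meet both a set and its complement. -/
def mixed (c : ℝ) (B : Set (Fin n → ℝ)) : Set S.Λ :=
  {v | (∃ x ∈ B, x ∈ S.ball v c) ∧ ∃ x ∉ B, x ∈ S.ball v c}

theorem nrm_le_add {x y : Fin n → ℝ} {a b : ℝ} (hx : S.nrm x ≤ a) (hy : S.nrm (x - y) ≤ b) :
    S.nrm y ≤ a + b := by
  have : y = x - (x - y) := by simp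
  rw [this]
  exact (map_sub_le_add _ _ _).trans (add_le_add hx hy)

theorem mem_ball_zero_of_mem {x v : Fin n → ℝ} {X c : ℝ} (hx : x ∈ S.ball 0 X)
    (h : x ∈ S.ball v c) : v ∈ S.ball 0 (X + c) := by
  rw [mem_ball, sub_zero] at hx ⊢
  exact S.nrm_le_add hx h

theorem finite_mixed (c : ℝ) {B : Set (Fin n → ℝ)} {X : ℝ} (hB : B ⊆ S.ball 0 X) :
    (S.mixed c B).Finite := by
  refine (S.finite_lattice_ball 0 (X + c)).subset ?_
  rintro v ⟨⟨x, hxB, hx⟩, -⟩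
  exact S.mem_ball_zero_of_mem (hB hxB) hx

/-- A tile within distance `c` of `u` contributes differently to the two sides only if the ball
around `u` meets both `B` and its complement; each such `u` costs at most `K`. -/
theorem tiling_compare {Y : S.Λ → Set (Fin n → ℝ)} (hYm : ∀ u, MeasurableSet (Y u))
    (hYd : Pairwise fun u v => AEDisjoint volume (Y u) (Y v)) {c : ℝ}
    (hc : 0 ≤ c) (hYc : ∀ u : S.Λ, Y u ⊆ S.ball u c) {K : ℝ} (hK : ∀ u, volume.real (Y u) ≤ K)
    (I : Set S.Λ) {B : Set (Fin n → ℝ)} (hB : NullMeasurableSet B) {X : ℝ}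
    (hBX : B ⊆ S.ball 0 X) :
    |volume.real (B ∩ ⋃ u ∈ I, Y u) - ∑ u ∈ S.pts B, I.indicator (fun u => volume.real (Y u)) u| ≤
      K * (S.mixed c B).ncard := by
  classical
  set G : Finset S.Λ := (S.finite_lattice_ball 0 (X + c)).toFinset with hG
  have hmemG : ∀ u : S.Λ, u ∈ G ↔ (u : Fin n → ℝ) ∈ S.ball 0 (X + c) := by simp [hG]
  have hYfin : ∀ u, volume (Y u) ≠ ⊤ := fun u =>
    ((measure_mono (hYc u)).trans_lt (S.volume_ball_lt_top _ _)).ne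
  have hunion : B ∩ ⋃ u ∈ I, Y u = ⋃ u ∈ G.filter (· ∈ I), B ∩ Y u := by
    ext x
    simp only [mem_inter_iff, mem_iUnion, exists_prop, Finset.mem_filter]
    constructor
    · rintro ⟨hx, u, hu, hxu⟩
      exact ⟨u, ⟨(hmemG u).2 (S.mem_ball_zero_of_mem (hBX hx) (hYc u hxu)), hu⟩, hx, hxu⟩
    · rintro ⟨u, ⟨-, hu⟩, hx, hxu⟩
      exact ⟨hx, u, hu, hxu⟩
  have hleft : volume.real (B ∩ ⋃ u ∈ I, Y u) =
      ∑ u ∈ G, I.indicator (fun u => volume.real (B ∩ Y u)) u := by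
    rw [hunion, measureReal_biUnion_finset₀
      (fun u _ v _ huv => (hYd huv).mono inter_subset_right inter_subset_right)
      (fun u _ => hB.inter (hYm u).nullMeasurableSet)
      (fun u _ => ne_top_of_le_ne_top (hYfin u) (measure_mono inter_subset_right)),
      Finset.sum_filter]
    rfl
  have hright : ∑ u ∈ S.pts B, I.indicator (fun u => volume.real (Y u)) u =
      ∑ u ∈ G, if (u : Fin n → ℝ) ∈ B then I.indicator (fun u => volume.real (Y u)) u else 0 := by
    rw [← Finset.sum_filter]
    refine Finset.sum_congr ?_ fun _ _ => rfl
    ext u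
    rw [Finset.mem_filter, S.mem_pts hBX, hmemG]
    refine ⟨fun h => ⟨?_, h⟩, fun h => h.2⟩
    have := hBX h
    rw [mem_ball] at this ⊢
    linarith
  rw [hleft, hright, ← Finset.sum_sub_distrib]
  refine (Finset.abs_sum_le_sum_abs _ _).trans ?_
  have hK0 : 0 ≤ K := (measureReal_nonneg (μ := volume) (s := Y 0)).trans (hK 0)
  have hpt : ∀ u ∈ G, |I.indicator (fun u => volume.real (B ∩ Y u)) u -
      (if (u : Fin n → ℝ) ∈ B then I.indicator (fun u => volume.real (Y u)) u else 0)| ≤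
      if u ∈ S.mixed c B then K else 0 := by
    intro u _
    have hself : (u : Fin n → ℝ) ∈ S.ball u c := by simpa [mem_ball] using hc
    have hle : volume.real (B ∩ Y u) ≤ volume.real (Y u) :=
      measureReal_mono inter_subset_right (hYfin u)
    have h0 : 0 ≤ volume.real (B ∩ Y u) := measureReal_nonneg
    by_cases hI : u ∈ I
    · simp only [Set.indicator_of_mem hI]
      by_cases hm : u ∈ S.mixed c B
      · rw [if_pos hm]
        have := hK u
        split_ifs
        · rw [abs_le]; constructor <;> linarith
        · rw [abs_le]; constructor <;> linarith
      · rw [if_neg hm]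
        by_cases hu : (u : Fin n → ℝ) ∈ B
        · rw [if_pos hu]
          have : B ∩ Y u = Y u := by
            refine inter_eq_right.2 fun x hx => ?_
            by_contra hxB
            exact hm ⟨⟨u, hu, hself⟩, x, hxB, hYc u hx⟩
          rw [this, sub_self, abs_zero]
        · rw [if_neg hu]
          have : B ∩ Y u = ∅ := by
            refine Set.eq_empty_of_forall_notMem fun x hx => ?_
            exact hm ⟨⟨x, hx.1, hYc u hx.2⟩, u, hu, hself⟩
          rw [this]
          simp
    · simp only [Set.indicator_of_notMem hI]
      simp only [ite_self, sub_zero, abs_zero]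
      split_ifs
      · exact hK0
      · exact le_rfl
  refine (Finset.sum_le_sum hpt).trans ?_
  rw [← Finset.sum_filter, Finset.sum_const, nsmul_eq_mul, mul_comm]
  gcongr
  rw [← Set.ncard_coe_finset]
  refine Set.ncard_le_ncard (fun u hu => ?_) (S.finite_mixed c hBX)
  simp at hu
  exact hu.2

theorem isClosed_cell (u : Fin n → ℝ) : IsClosed (S.cell u) :=
  (Homeomorph.addLeft u).isClosedMap _ S.tile_closed

theorem measurableSet_cell (u : Fin n → ℝ) : MeasurableSet (S.cell u) :=
  (S.isClosed_cell u).measurableSet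

theorem mem_cell {u x : Fin n → ℝ} : x ∈ S.cell u ↔ x - u ∈ S.T := by
  constructor
  · rintro ⟨t, ht, rfl⟩
    simpa using ht
  · intro h
    exact ⟨_, h, by simp⟩

theorem cell_subset_ball (u : Fin n → ℝ) : S.cell u ⊆ S.ball u S.R := by
  intro x hx
  exact S.subset_ball (S.mem_cell.1 hx)

theorem volume_translate (u : Fin n → ℝ) (B : Set (Fin n → ℝ)) :
    volume ((fun x => u + x) '' B) = volume B := by
  rw [Set.image_add_left, measure_preimage_add]

theorem volume_cell (u : Fin n → ℝ) : volume (S.cell u) = volume S.T := volume_translate u S.T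

theorem volumeReal_cell (u : Fin n → ℝ) : volume.real (S.cell u) = S.dΛ := by
  rw [measureReal_def, volume_cell, dΛ, measureReal_def]

theorem volume_T_lt_top : volume S.T < ⊤ :=
  (measure_mono S.subset_ball).trans_lt (by simpa [ball] using S.volume_ball_lt_top 0 S.R)

theorem dΛ_pos : 0 < S.dΛ := by
  refine lt_of_lt_of_le (S.volume_ball_pos 0 S.r_pos) (measureReal_mono ?_ S.volume_T_lt_top.ne)
  intro x hx
  exact S.ball_subset (by simpa [mem_ball] using hx)

theorem aedisjoint_cell : Pairwise fun u v : S.Λ => AEDisjoint volume (S.cell u) (S.cell v) := by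
  intro u v huv
  have hsub : S.cell u ∩ S.cell v ⊆ (fun x => (u : Fin n → ℝ) + x) '' frontier S.T := by
    rintro x ⟨hu, hv⟩
    refine ⟨x - u, ?_, by simp⟩
    refine S.tile_inter (v - u) (v - u).2 ?_ ⟨S.mem_cell.1 hu, x - v, S.mem_cell.1 hv, by simp⟩
    intro h
    have h' : (v - u : S.Λ) = 0 := Subtype.ext h
    exact huv (sub_eq_zero.1 h').symm
  refine measure_mono_null hsub ?_
  rw [volume_translate, S.tile_frontier]

theorem exists_mem_cell (x : Fin n → ℝ) : ∃ u : S.Λ, x ∈ S.cell u := by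
  obtain ⟨u, t, ht, rfl⟩ := S.exists_lattice_near x
  exact ⟨u, t, ht, rfl⟩

/-- The total volume of the tiles that belong to the lattice points in a large ball. -/
theorem tendsto_sum_ball {Y : S.Λ → Set (Fin n → ℝ)} (hYm : ∀ u, MeasurableSet (Y u))
    (hYd : Pairwise fun u v => AEDisjoint volume (Y u) (Y v)) {c : ℝ}
    (hYc : ∀ u : S.Λ, Y u ⊆ S.ball u c) (hcov : ∀ x, ∃ u, x ∈ Y u) :
    Tendsto (fun X : ℝ => (∑ u ∈ S.pts (S.ball 0 X), volume.real (Y u)) / X ^ n) atTop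
      (𝓝 (volume.real (S.ball 0 1))) := by
  have hYfin : ∀ u, volume (Y u) ≠ ⊤ := fun u =>
    ((measure_mono (hYc u)).trans_lt (S.volume_ball_lt_top _ _)).ne
  have hsum : ∀ X, ∑ u ∈ S.pts (S.ball 0 X), volume.real (Y u) =
      volume.real (⋃ u ∈ S.pts (S.ball 0 X), Y u) := by
    intro X
    rw [measureReal_biUnion_finset₀ (fun u _ v _ huv => hYd huv)
      (fun u _ => (hYm u).nullMeasurableSet) (fun u _ => hYfin u)]
  have hlim : ∀ b : ℝ, Tendsto (fun X : ℝ => (1 + b * X⁻¹) ^ n * volume.real (S.ball 0 1)) atTop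
      (𝓝 (volume.real (S.ball 0 1))) := by
    intro b
    have h1 := ((tendsto_inv_atTop_zero (𝕜 := ℝ)).const_mul b).const_add 1
    have h2 := (h1.pow n).mul_const (volume.real (S.ball 0 1))
    simpa using h2
  have hscale : ∀ b X : ℝ, 0 < X → 0 ≤ X + b →
      volume.real (S.ball 0 (X + b)) / X ^ n = (1 + b * X⁻¹) ^ n * volume.real (S.ball 0 1) := by
    intro b X hX hb
    rw [S.volume_ball _ hb, show X + b = X * (1 + b * X⁻¹) by field_simp, mul_pow]
    field_simp
  refine tendsto_of_tendsto_of_tendsto_of_le_of_le' (hlim (-c)) (hlim c) ?_ ?_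
  · filter_upwards [eventually_gt_atTop 0, eventually_ge_atTop c] with X hX hXc
    rw [← hscale _ _ hX (by linarith), hsum]
    gcongr
    · exact ((measure_biUnion_finset_le _ _).trans_lt
        (ENNReal.sum_lt_top.2 fun u _ => (hYfin u).lt_top)).ne
    · intro x hx
      obtain ⟨u, hu⟩ := hcov x
      simp only [mem_iUnion, exists_prop]
      refine ⟨u, (S.mem_pts subset_rfl).2 ?_, hu⟩
      simpa using S.mem_ball_zero_of_mem hx (hYc u hu)
  · filter_upwards [eventually_gt_atTop 0, eventually_ge_atTop (-c)] with X hX hXc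
    rw [← hscale _ _ hX (by linarith), hsum]
    gcongr
    · exact (S.volume_ball_lt_top _ _).ne
    · refine iUnion₂_subset fun u hu x hx => ?_
      rw [S.mem_pts subset_rfl] at hu
      have hx' := hYc u hx
      rw [mem_ball, nrm_sub_comm] at hx'
      rw [mem_ball, sub_zero] at hu ⊢
      exact S.nrm_le_add hu hx'

theorem tendsto_card_ball : Tendsto (fun X : ℝ => ((S.pts (S.ball 0 X)).card : ℝ) / X ^ n) atTop
    (𝓝 (volume.real (S.ball 0 1) / S.dΛ)) := by
  have h := (S.tendsto_sum_ball (Y := fun u => S.cell u) (fun u => S.measurableSet_cell u)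
    S.aedisjoint_cell (fun u => S.cell_subset_ball u) S.exists_mem_cell).div_const S.dΛ
  refine h.congr fun X => ?_
  simp only [volumeReal_cell, Finset.sum_const, nsmul_eq_mul]
  have := S.dΛ_pos.ne'
  field_simp

/-- `κ u = q^j κ t`, where `j` is the largest exponent up to `w - 1` with `u ∈ Φ^j Λ`. Telescoping
`q^j` into indicators of the sublattices `Φ^(j+1)Λ` makes the average over `Λ` computable from their
densities. -/
theorem κ_eq_sum {t : S.Λ} (ht : t ∉ range S.up) (u : S.Λ) :
    S.κ u = S.κ t * (1 + ∑ j ∈ Finset.range (S.w - 1),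
      (range S.up^[j + 1]).indicator (fun _ => S.q ^ (j + 1) - S.q ^ j) u) := by
  classical
  obtain ⟨s, hs, hsing, hr, hmin⟩ := S.exists_state u
  have hq := S.q_pos
  have hκ : S.κ u = S.q ^ (S.w - 1 - s) * S.κ t := by
    have h1 := S.κ_up_iterate (hsing s le_rfl)
    rw [S.κ_of_mem_range hr, ← S.κ_of_notMem ht, show S.w - 1 = s + (S.w - 1 - s) by omega,
      pow_add] at h1
    refine mul_left_cancel₀ (pow_pos hq s).ne' ?_
    rw [← h1]
    ring
  have hmem : ∀ j < S.w - 1, (u ∈ range S.up^[j + 1] ↔ j + 1 ≤ S.w - 1 - s) := by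
    intro j hj
    constructor
    · rintro ⟨y, rfl⟩
      by_contra hlt
      refine hmin (S.w - 1 - (j + 1)) (by omega) ⟨y, ?_⟩
      rw [← Function.iterate_add_apply]
      congr 2
      omega
    · intro h
      obtain ⟨y, hy⟩ := hr
      rw [show S.w - 1 = s + ((j + 1) + (S.w - 1 - s - (j + 1))) by omega,
        Function.iterate_add_apply, (S.up_injective.iterate s).eq_iff,
        Function.iterate_add_apply] at hy
      exact ⟨_, hy⟩
  have hsum : ∑ j ∈ Finset.range (S.w - 1),
      (range S.up^[j + 1]).indicator (fun _ => S.q ^ (j + 1) - S.q ^ j) u =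
      S.q ^ (S.w - 1 - s) - 1 := by
    have h1 : ∑ j ∈ Finset.range (S.w - 1 - s), (S.q ^ (j + 1) - S.q ^ j) =
        S.q ^ (S.w - 1 - s) - 1 := by
      rw [Finset.sum_range_sub]
      simp
    rw [← h1, ← Finset.sum_subset (Finset.range_mono (Nat.sub_le (S.w - 1) s))]
    · refine Finset.sum_congr rfl fun j hj => ?_
      rw [Finset.mem_range] at hj
      rw [Set.indicator_of_mem ((hmem j (by omega)).2 hj)]
    · intro j hj hj'
      rw [Finset.mem_range] at hj hj'
      rw [Set.indicator_of_notMem]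
      rw [hmem j hj]
      omega
  rw [hsum, hκ]
  ring

/-- `Φ^j` scales the norm by `ρ^j`, so the points of `Φ^j Λ` in a ball correspond to lattice points
in a ball smaller by that factor. -/
theorem card_filter_range (j : ℕ) (X : ℝ) :
    ∑ u ∈ S.pts (S.ball 0 X), (range S.up^[j]).indicator (fun _ => (1 : ℝ)) u =
      (S.pts (S.ball 0 (X / S.ρ ^ j))).card := by
  classical
  simp only [Set.indicator_apply]
  rw [← Finset.sum_filter, Finset.sum_const, nsmul_eq_mul, mul_one]
  congr 1
  symm
  refine Finset.card_nbij (fun u => S.up^[j] u) ?_ ((S.up_injective.iterate j).injOn) ?_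
  · intro u hu
    have hu' := (S.mem_pts subset_rfl).1 hu
    simp only [Finset.coe_filter, Set.mem_ofPred_eq]
    refine ⟨(S.mem_pts subset_rfl).2 ?_, ⟨u, rfl⟩⟩
    rw [mem_ball, sub_zero, coe_up_iterate, nrm_app_nat]
    rwa [mem_ball, sub_zero, le_div_iff₀ (pow_pos S.rho_pos _), mul_comm] at hu'
  · rintro v hv
    simp only [Finset.coe_filter, Set.mem_ofPred_eq] at hv
    obtain ⟨hv, u, rfl⟩ := hv
    refine ⟨u, (S.mem_pts subset_rfl).2 ?_, rfl⟩
    have hv' := (S.mem_pts subset_rfl).1 hv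
    rw [mem_ball, sub_zero, coe_up_iterate, nrm_app_nat] at hv'
    rwa [mem_ball, sub_zero, le_div_iff₀ (pow_pos S.rho_pos _), mul_comm]

/-- The volume of the smallest tiles. -/
theorem κ_eq {t : S.Λ} (ht : t ∉ range S.up) :
    S.κ t * (1 + ((S.w - 1 : ℕ) : ℝ) * (1 - S.q⁻¹)) = S.dΛ := by
  have hV := S.volume_ball_pos 0 one_pos
  have hd := S.dΛ_pos
  have hq := S.q_pos
  have hcard : ∀ j : ℕ, Tendsto (fun X : ℝ =>
      ((S.pts (S.ball 0 (X / S.ρ ^ j))).card : ℝ) / X ^ n) atTop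
      (𝓝 (volume.real (S.ball 0 1) / S.dΛ / S.q ^ j)) := by
    intro j
    have h1 : Tendsto (fun X : ℝ => X / S.ρ ^ j) atTop atTop :=
      tendsto_id.atTop_div_const (pow_pos S.rho_pos j)
    refine ((S.tendsto_card_ball.comp h1).div_const (S.q ^ j)).congr' ?_
    filter_upwards [eventually_gt_atTop 0] with X hX
    have : S.q ^ j = (S.ρ ^ j) ^ n := by rw [q, ← pow_mul, ← pow_mul, mul_comm]
    have h2 := S.rho_pos
    simp only [Function.comp]
    rw [div_pow, this]
    field_simp
  -- The total tile volume over a large ball is computed twice: the tiles cover space without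
  -- overlap, and `κ_eq_sum` averages their volumes.
  have h1 := S.tendsto_sum_ball S.measurableSet_tile S.aedisjoint_tile S.tile_subset_ball
    S.exists_mem_tile
  have h2 : Tendsto (fun X : ℝ => S.κ t * (((S.pts (S.ball 0 (X / S.ρ ^ 0))).card : ℝ) / X ^ n +
      ∑ j ∈ Finset.range (S.w - 1), (S.q ^ (j + 1) - S.q ^ j) *
        (((S.pts (S.ball 0 (X / S.ρ ^ (j + 1)))).card : ℝ) / X ^ n))) atTop
      (𝓝 (S.κ t * (volume.real (S.ball 0 1) / S.dΛ / S.q ^ 0 +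
      ∑ j ∈ Finset.range (S.w - 1), (S.q ^ (j + 1) - S.q ^ j) *
        (volume.real (S.ball 0 1) / S.dΛ / S.q ^ (j + 1))))) :=
    ((hcard 0).add (tendsto_finsetSum _ fun j _ => (hcard (j + 1)).const_mul _)).const_mul _
  have h3 := tendsto_nhds_unique (h1.congr fun X => ?_) h2
  · have h4 : ∀ j ∈ Finset.range (S.w - 1), (S.q ^ (j + 1) - S.q ^ j) *
        (volume.real (S.ball 0 1) / S.dΛ / S.q ^ (j + 1)) =
        volume.real (S.ball 0 1) / S.dΛ * (1 - S.q⁻¹) := by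
      intro j _
      field_simp
      ring
    rw [Finset.sum_congr rfl h4, Finset.sum_const, Finset.card_range, nsmul_eq_mul] at h3
    field_simp at h3
    field_simp
    linarith
  · have h5 : ∀ u : S.Λ, volume.real (S.tile u) = S.κ t * (1 + ∑ j ∈ Finset.range (S.w - 1),
      (S.q ^ (j + 1) - S.q ^ j) * (range S.up^[j + 1]).indicator (fun _ => (1 : ℝ)) u) := by
      intro u
      have := S.κ_eq_sum ht u
      rw [κ] at this
      rw [this]
      congr 2
      refine Finset.sum_congr rfl fun j _ => ?_
      by_cases hu : u ∈ range S.up^[j + 1]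
      · rw [Set.indicator_of_mem hu, Set.indicator_of_mem hu, mul_one]
      · rw [Set.indicator_of_notMem hu, Set.indicator_of_notMem hu, mul_zero]
    simp_rw [h5]
    rw [← Finset.mul_sum, Finset.sum_add_distrib, Finset.sum_comm]
    simp_rw [← Finset.mul_sum, card_filter_range]
    simp only [pow_zero, div_one, Finset.sum_const, nsmul_eq_mul, mul_one, mul_div_assoc, add_div,
      Finset.sum_div]


/-! ### Mixing of the digit tree. -/

theorem μ_lt_one : S.μ < 1 := by
  have h : 0 < 1 / (S.ρ ^ n * (S.w : ℝ) ^ 3) := by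
    have := S.rho_pos
    have := S.w_pos
    positivity
  rw [μ]
  exact inv_lt_one_of_one_lt₀ (by linarith)

theorem μ_pos : 0 < S.μ := by
  have := S.rho_pos
  rw [μ]
  positivity

/-- Dividing the count by `q^k` turns `card_desc_rec` into the recursion of
`exists_geometric_decay`, which also holds for constants. The first `w` counts are `1`, and with
these values the vanishing of the invariant is precisely `κ_eq`. -/
theorem exists_mixing_of_notMem {t : S.Λ} (ht : t ∉ range S.up) :
    ∃ θ : ℝ, 0 < θ ∧ θ < S.μ ∧ ∃ C : ℝ,
      ∀ k, |S.dΛ * (S.desc k t).card - S.q ^ k * S.κ t| ≤ C * (S.q * θ) ^ k := by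
  have hq := S.q_pos
  have hw : S.w = (S.w - 1) + 1 := by have := S.w_pos; omega
  obtain ⟨θ, hθ0, hθμ, C, hC⟩ := exists_geometric_decay S.one_lt_q (l := S.w - 1)
    (e := fun k => S.dΛ * ((S.desc k t).card / S.q ^ k) - S.κ t) (fun k => by
      have h := S.card_desc_rec ht k
      rw [show k + S.w = k + (S.w - 1) + 1 by omega, add_tsub_cancel_right] at h
      rw [h, pow_succ, pow_add]
      field_simp
      ring) (by
      have h1 : ∀ i ∈ Finset.range (S.w - 1),
          S.dΛ * (((S.desc i t).card : ℝ) / S.q ^ i) - S.κ t = S.dΛ * (S.q⁻¹) ^ i - S.κ t := by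
        intro i hi
        rw [Finset.mem_range] at hi
        rw [S.card_desc_small ht (by omega)]
        simp
      rw [Finset.sum_congr rfl h1, Finset.sum_sub_distrib, ← Finset.mul_sum,
        S.card_desc_small ht (k := S.w - 1) (by omega)]
      have h2 := mul_neg_geom_sum (S.q⁻¹) (S.w - 1)
      have h3 := S.κ_eq ht
      simp only [Finset.sum_const, Finset.card_range, nsmul_eq_mul, Nat.cast_one, one_div]
      rw [← inv_pow]
      linear_combination S.dΛ * h2 - h3)
  refine ⟨θ, hθ0, ?_, C, fun k => ?_⟩
  · rw [← hw] at hθμ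
    exact hθμ
  · have h := hC k
    have hqk : 0 < S.q ^ k := pow_pos hq k
    have h2 : S.dΛ * (S.desc k t).card - S.q ^ k * S.κ t =
        S.q ^ k * (S.dΛ * ((S.desc k t).card / S.q ^ k) - S.κ t) := by
      field_simp
    rw [h2, abs_mul, abs_of_pos hqk, mul_pow]
    calc S.q ^ k * |S.dΛ * ((S.desc k t).card / S.q ^ k) - S.κ t|
        ≤ S.q ^ k * (C * θ ^ k) := by gcongr
      _ = _ := by ring

/-- The number of descendants of a lattice point is asymptotically proportional to the volume of
its tile. -/
theorem exists_mixing {t : S.Λ} (ht : t ∉ range S.up) :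
    ∃ θ : ℝ, 0 < θ ∧ θ < S.μ ∧ ∃ C : ℝ, 0 ≤ C ∧
      ∀ v k, |S.dΛ * (S.desc k v).card - S.q ^ k * S.κ v| ≤ C * (S.q * θ) ^ k := by
  obtain ⟨θ, hθ0, hθμ, C, hC⟩ := S.exists_mixing_of_notMem ht
  have hq := S.q_pos
  have hC0 : 0 ≤ C := by simpa using (abs_nonneg _).trans (hC 0)
  -- The extra factor absorbs the shift `j ≤ w - 1` between the level of `v` and that of `t`,
  -- whether or not `q θ` exceeds `1`.
  refine ⟨θ, hθ0, hθμ, C * (max 1 (S.q * θ)) ^ (S.w - 1), by positivity, fun v k => ?_⟩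
  obtain ⟨j, hj, hκ, hcard⟩ := S.exists_type ht v
  have h := hC (k + j)
  rw [hκ, hcard, ← mul_assoc, ← pow_add]
  refine h.trans ?_
  rw [pow_add, mul_comm ((S.q * θ) ^ k), ← mul_assoc]
  gcongr
  calc (S.q * θ) ^ j ≤ (max 1 (S.q * θ)) ^ j := by gcongr; exact le_max_right _ _
    _ ≤ _ := pow_le_pow_right₀ (le_max_left _ _) hj

/-! ### Summation along the tree and the comparison function. -/

/-- A radius that bounds the tiles, the digits and the cells. -/
def bigRad : ℝ := S.ρ * S.rad

theorem rad_le_bigRad : S.rad ≤ S.bigRad := by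
  have := S.rad_pos
  have := S.one_lt_rho
  rw [bigRad]
  nlinarith

theorem bigRad_pos : 0 < S.bigRad := S.rad_pos.trans_le S.rad_le_bigRad

theorem ball_mono (x : Fin n → ℝ) {a b : ℝ} (h : a ≤ b) : S.ball x a ⊆ S.ball x b :=
  fun _ hy => le_trans (S.mem_ball.1 hy) h

theorem nrm_sub_par_le (u : S.Λ) : S.app 1 (S.par u) ∈ S.ball u S.bigRad := by
  have h : S.app 1 (S.par u) - u = -S.dig u := by
    rw [sub_eq_iff_eq_add, neg_add_eq_sub, eq_sub_iff_add_eq]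
    exact (S.coe_eq_par u).symm
  rw [mem_ball, h, map_neg_eq_map, bigRad]
  refine (S.nrm_dig_le u).trans ?_
  have := S.rad_pos
  linarith

theorem app_image_subset_ball {B : Set (Fin n → ℝ)} {X : ℝ} (hB : B ⊆ S.ball 0 X) (j : ℤ) :
    S.app j '' B ⊆ S.ball 0 (S.ρ ^ j * X) := by
  have h := S.app_image_ball j 0 X
  rw [map_zero] at h
  rw [← h]
  exact image_mono hB

/-- The second sum runs over the `u` with `Φ (par u) ∈ B` instead of `u ∈ B`. These points differ by
a digit, so only `u` close to both `B` and its complement matter. -/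
theorem sum_pts_sub_le {B : Set (Fin n → ℝ)} {X : ℝ} (hB : B ⊆ S.ball 0 X) {g : S.Λ → ℝ} {M : ℝ}
    (hg : ∀ u, |g u| ≤ M) :
    |∑ u ∈ S.pts B, g u - ∑ v ∈ S.pts (S.app (-1) '' B), ∑ u ∈ S.desc 1 v, g u| ≤
      M * (S.mixed S.bigRad B).ncard := by
  classical
  have hB' := S.app_image_subset_ball hB (-1)
  set H : Finset S.Λ := (S.pts (S.app (-1) '' B)).biUnion fun v => S.desc 1 v with hH
  have hmemH : ∀ u, u ∈ H ↔ S.app 1 (S.par u) ∈ B := by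
    intro u
    simp only [hH, Finset.mem_biUnion, mem_desc, Function.iterate_one]
    constructor
    · rintro ⟨v, hv, rfl⟩
      rw [S.mem_pts hB', mem_app_image] at hv
      simpa using hv
    · intro h
      refine ⟨_, (S.mem_pts hB').2 ?_, rfl⟩
      rw [mem_app_image]
      simpa using h
  have hsum : ∑ v ∈ S.pts (S.app (-1) '' B), ∑ u ∈ S.desc 1 v, g u = ∑ u ∈ H, g u := by
    rw [hH, Finset.sum_biUnion]
    intro v _ v' _ hvv
    rw [Function.onFun, Finset.disjoint_left]
    intro u hu hu'
    rw [mem_desc] at hu hu'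
    exact hvv (hu.symm.trans hu')
  rw [hsum]
  have h1 := Finset.sum_sdiff_sub_sum_sdiff (s₁ := S.pts B) (s₂ := H) (f := g)
  rw [abs_sub_comm, ← h1, abs_sub_comm]
  refine (abs_sub _ _).trans ?_
  have hM : 0 ≤ M := (abs_nonneg _).trans (hg 0)
  have hself : ∀ u : S.Λ, (u : Fin n → ℝ) ∈ S.ball u S.bigRad := fun u => by
    simpa [mem_ball] using S.bigRad_pos.le
  calc |∑ u ∈ S.pts B \ H, g u| + |∑ u ∈ H \ S.pts B, g u|
      ≤ ∑ u ∈ S.pts B \ H, |g u| + ∑ u ∈ H \ S.pts B, |g u| := by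
        gcongr <;> exact Finset.abs_sum_le_sum_abs _ _
    _ = ∑ u ∈ (S.pts B \ H) ∪ (H \ S.pts B), |g u| := by
        rw [Finset.sum_union disjoint_sdiff_sdiff]
    _ ≤ ((S.pts B \ H) ∪ (H \ S.pts B)).card • M := Finset.sum_le_card_nsmul _ _ _ fun u _ => hg u
    _ ≤ M * (S.mixed S.bigRad B).ncard := by
        rw [nsmul_eq_mul, mul_comm]
        gcongr
        rw [← Set.ncard_coe_finset]
        refine Set.ncard_le_ncard (fun u hu => ?_) (S.finite_mixed _ hB)
        simp only [Finset.mem_coe, Finset.mem_union, Finset.mem_sdiff, hmemH, S.mem_pts hB] at hu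
        rcases hu with ⟨hu, hp⟩ | ⟨hp, hu⟩
        · exact ⟨⟨u, hu, hself u⟩, _, hp, S.nrm_sub_par_le u⟩
        · exact ⟨⟨_, hp, S.nrm_sub_par_le u⟩, u, hu, hself u⟩

/-- A sum over the lattice points in a set is small if the sums over all sets of descendants are
small and the set has a small boundary on all scales. -/
theorem sum_pts_le {B : Set (Fin n → ℝ)} {X : ℝ} (hB : B ⊆ S.ball 0 X) {f : S.Λ → ℝ} {M : ℕ → ℝ}
    (hf : ∀ k v, |∑ u ∈ S.desc k v, f u| ≤ M k) (L : ℕ) :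
    |∑ u ∈ S.pts B, f u| ≤
      ∑ k ∈ Finset.range L, M k * (S.mixed S.bigRad (S.app (-k) '' B)).ncard +
        M L * (S.pts (S.app (-L) '' B)).card := by
  -- Each level applies `sum_pts_sub_le` to the sums over `L`-th descendants, which are bounded by
  -- `M L`, on the region `Φ^(-L) B`.
  have key : |∑ u ∈ S.pts B, f u -
      ∑ v ∈ S.pts (S.app (-L) '' B), ∑ u ∈ S.desc L v, f u| ≤
      ∑ k ∈ Finset.range L, M k * (S.mixed S.bigRad (S.app (-k) '' B)).ncard := by
    induction L with
    | zero =>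
      have : S.app (-(0 : ℕ)) '' B = B := by simp
      rw [this]
      simp [desc_zero]
    | succ L ih =>
      rw [Finset.sum_range_succ]
      have h := S.sum_pts_sub_le (S.app_image_subset_ball hB (-L)) (g := fun v => ∑ u ∈ S.desc L v, f u)
        (hf L)
      rw [← app_image_add, show (-1 + -(L : ℤ)) = -((L + 1 : ℕ) : ℤ) by push_cast; ring] at h
      simp_rw [← sum_desc_add] at h
      refine le_trans ?_ (add_le_add ih h)
      exact abs_sub_le _ _ _
  have h2 : |∑ v ∈ S.pts (S.app (-L) '' B), ∑ u ∈ S.desc L v, f u| ≤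
      M L * (S.pts (S.app (-L) '' B)).card := by
    refine (Finset.abs_sum_le_sum_abs _ _).trans ?_
    rw [mul_comm, ← nsmul_eq_mul]
    exact Finset.sum_le_card_nsmul _ _ _ fun v _ => hf L v
  have h3 := abs_sub_abs_le_abs_sub (∑ u ∈ S.pts B, f u)
    (∑ v ∈ S.pts (S.app (-L) '' B), ∑ u ∈ S.desc L v, f u)
  linarith

/-- The deviation of the number of descendants of `η` from its expected value. -/
def dev (η : S.Λ) (i : ℕ) : ℝ :=
  (S.dΛ * (S.desc i η).card - S.q ^ i * S.κ η) / S.q ^ (i + S.w)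

/-- The lattice points with `i`-th digit `η`. -/
def withDigit (η : S.Λ) (i : ℕ) : Set S.Λ := {u | S.dig (S.par^[i] u) = η}

theorem eq_add_of_dig {η t : S.Λ} (h : S.dig t = η) (hη0 : η ≠ 0) :
    t = η + S.up (S.par t) ∧ S.up (S.par t) ∈ range S.up^[S.w - 1] := by
  constructor
  · refine Subtype.ext ?_
    have := S.coe_eq_par t
    rw [h] at this
    push_cast
    rw [this, add_comm, coe_up]
  · have h0 : S.dig t ≠ 0 := fun h' => hη0 (Subtype.ext (by rw [← h, h']; rfl))
    simpa using S.up_iterate_mem_range (S.par_mem_range h0) 1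

/-- The points with last digit `η` are `Φ^w y + η`; climbing `w` levels leads to `y`. Hence they
correspond to the descendants `y` of level `m - w`. -/
theorem card_filter_dig {η : S.Λ} (hη : (η : Fin n → ℝ) ∈ S.D) (hη0 : η ≠ 0) {m : ℕ}
    (hm : S.w ≤ m) (v : S.Λ) :
    ∑ t ∈ S.desc m v, (S.withDigit η 0).indicator (fun _ => (1 : ℝ)) t = (S.desc (m - S.w) v).card := by
  classical
  have hw := S.w_pos
  have hstep : ∀ y, S.IsStep (S.up^[S.w] y + η) (S.up^[S.w - 1] y) η := fun y =>
    ⟨hη, by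
      push_cast
      rw [← coe_up, ← Function.iterate_succ_apply' S.up, show (S.w - 1).succ = S.w by omega],
      fun _ => ⟨y, rfl⟩⟩
  have hpar : ∀ t, S.par^[m] t = S.par^[m - S.w] (S.par^[S.w - 1] (S.par t)) := by
    intro t
    rw [← Function.iterate_succ_apply, ← Function.iterate_add_apply]
    congr 2
    omega
  simp only [Set.indicator_apply]
  rw [← Finset.sum_filter, Finset.sum_const, nsmul_eq_mul, mul_one]
  congr 1
  symm
  refine Finset.card_nbij (fun y => S.up^[S.w] y + η) ?_ ?_ ?_
  · intro y hy
    rw [Finset.mem_coe, mem_desc] at hy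
    obtain ⟨h1, h2⟩ := S.par_dig_of_isStep (hstep y)
    rw [Finset.mem_coe, Finset.mem_filter, mem_desc]
    refine ⟨?_, h2⟩
    rw [hpar, h1, par_iterate_up_iterate, hy]
  · intro y _ y' _ h
    exact (S.up_injective.iterate S.w) (add_right_cancel h)
  · intro t ht
    rw [Finset.mem_coe, Finset.mem_filter, mem_desc] at ht
    obtain ⟨ht, hdig⟩ := ht
    have hdig : S.dig t = η := hdig
    have h0 : S.dig t ≠ 0 := fun h' => hη0 (Subtype.ext (by rw [← hdig, h']; rfl))
    obtain ⟨y, hy⟩ := S.par_mem_range h0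
    refine ⟨y, ?_, ?_⟩
    · rw [Finset.mem_coe, mem_desc, ← ht, hpar, ← hy, par_iterate_up_iterate]
    · have h1 := (S.eq_add_of_dig hdig hη0).1
      rw [← hy, ← Function.iterate_succ_apply' S.up, show (S.w - 1).succ = S.w by omega, add_comm] at h1
      exact h1.symm

theorem volume_ball_eq (x : Fin n → ℝ) (c : ℝ) : volume.real (S.ball x c) = volume.real (S.ball 0 c) := by
  have : S.ball x c = (fun y => x + y) '' S.ball 0 c := by
    ext y
    rw [Set.image_add_left, mem_preimage, mem_ball, mem_ball, sub_zero, neg_add_eq_sub]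
  rw [measureReal_def, measureReal_def, this, volume_translate]

theorem κ_le (v : S.Λ) : S.κ v ≤ volume.real (S.ball 0 S.rad) := by
  rw [← S.volume_ball_eq v]
  exact measureReal_mono (S.tile_subset_ball v) (S.volume_ball_lt_top _ _).ne

/-- The function whose sum over the lattice points of a region compares the number of occurrences of
a digit with a volume. -/
def compareFun (η : S.Λ) (i : ℕ) (u : S.Λ) : ℝ :=
  (S.withDigit η i).indicator (fun u => S.dΛ - S.κ u) u - S.dev η i / S.dΛ * S.κ u

/-- Up to level `i` the digit at position `i` belongs to the ancestor `v`, so the indicator is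
constant on its descendants and only the mixing error remains. -/
theorem sum_compareFun_of_le (η : S.Λ) {i k : ℕ} (hki : k ≤ i) (v : S.Λ) :
    ∑ u ∈ S.desc k v, S.compareFun η i u =
      (S.withDigit η (i - k)).indicator
        (fun v => S.dΛ * (S.desc k v).card - S.q ^ k * S.κ v) v
        - S.dev η i / S.dΛ * (S.q ^ k * S.κ v) := by
  classical
  simp only [compareFun, Finset.sum_sub_distrib, ← Finset.mul_sum, sum_κ_desc]
  congr 1
  have hmem : ∀ u ∈ S.desc k v, (u ∈ S.withDigit η i ↔ v ∈ S.withDigit η (i - k)) := by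
    intro u hu
    rw [mem_desc] at hu
    simp only [withDigit, Set.mem_ofPred_eq]
    rw [← hu, ← Function.iterate_add_apply, Nat.sub_add_cancel hki]
  by_cases hv : v ∈ S.withDigit η (i - k)
  · rw [Set.indicator_of_mem hv, Finset.sum_congr rfl fun u hu =>
      Set.indicator_of_mem ((hmem u hu).2 hv) _, Finset.sum_sub_distrib, sum_κ_desc]
    simp [mul_comm]
  · rw [Set.indicator_of_notMem hv, Finset.sum_congr rfl fun u hu =>
      Set.indicator_of_notMem (fun h => hv ((hmem u hu).1 h)) _]
    simp

/-- Beyond level `i` every `t` with last digit `η` contributes the same amount `q^(i+w) dev η i`.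
The second term of `compareFun` subtracts the expected total of these contributions. -/
theorem sum_compareFun_of_ge {η : S.Λ} (hη0 : η ≠ 0) (i m : ℕ) (v : S.Λ) :
    ∑ u ∈ S.desc (i + m) v, S.compareFun η i u =
      S.dev η i * S.q ^ i *
        (S.q ^ S.w * ∑ t ∈ S.desc m v, (S.withDigit η 0).indicator (fun _ => (1 : ℝ)) t
          - S.q ^ m * S.κ v / S.dΛ) := by
  classical
  have hq := S.q_pos
  rw [sum_desc_add]
  simp_rw [S.sum_compareFun_of_le η (le_refl i), Nat.sub_self]
  rw [Finset.sum_sub_distrib, ← Finset.mul_sum, ← Finset.mul_sum, sum_κ_desc]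
  have h : ∀ t, (S.withDigit η 0).indicator
      (fun v => S.dΛ * (S.desc i v).card - S.q ^ i * S.κ v) t =
      S.q ^ (i + S.w) * S.dev η i * (S.withDigit η 0).indicator (fun _ => (1 : ℝ)) t := by
    intro t
    by_cases ht : t ∈ S.withDigit η 0
    · rw [Set.indicator_of_mem ht, Set.indicator_of_mem ht]
      obtain ⟨h1, h2⟩ := S.eq_add_of_dig (η := η) (t := t) ht hη0
      rw [h1, S.card_desc_add_range h2, S.κ_add h2, dev, mul_one, mul_div_cancel₀ _ (pow_pos hq _).ne']
    · rw [Set.indicator_of_notMem ht, Set.indicator_of_notMem ht, mul_zero]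
  simp_rw [h]
  rw [← Finset.mul_sum, pow_add]
  ring

theorem abs_dev_le {η : S.Λ} {θ C : ℝ} (hq : 0 < S.q)
    (hmix : ∀ v k, |S.dΛ * (S.desc k v).card - S.q ^ k * S.κ v| ≤ C * (S.q * θ) ^ k) (i : ℕ) :
    |S.dev η i| ≤ C / S.q ^ S.w * θ ^ i := by
  rw [dev, abs_div, abs_of_pos (pow_pos hq (i + S.w)), div_le_iff₀ (pow_pos hq _)]
  refine (hmix η i).trans (le_of_eq ?_)
  rw [mul_pow, pow_add]
  field_simp

/-- The point is uniformity in `i`. For `k ≤ i` mixing and the decay of `dev` suffice. For `k = i +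
m` the factor `dev η i = O(θ^i)` meets a count discrepancy `O((qθ)^m)`. -/
theorem exists_compareFun_bound {η : S.Λ} (hη : (η : Fin n → ℝ) ∈ S.D) (hη0 : η ≠ 0) {θ C : ℝ}
    (hθ0 : 0 < θ) (hθ1 : θ ≤ 1) (hC : 0 ≤ C)
    (hmix : ∀ v k, |S.dΛ * (S.desc k v).card - S.q ^ k * S.κ v| ≤ C * (S.q * θ) ^ k) :
    ∃ C' : ℝ, 0 ≤ C' ∧
      ∀ i k v, |∑ u ∈ S.desc k v, S.compareFun η i u| ≤ C' * (S.q * θ) ^ k := by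
  have hq := S.q_pos
  have hd := S.dΛ_pos
  set K := volume.real (S.ball 0 S.rad) with hK
  have hK0 : 0 ≤ K := measureReal_nonneg
  have hdev := S.abs_dev_le (η := η) hq hmix
  set C₁ := C / S.q ^ S.w with hC₁
  have hC₁0 : 0 ≤ C₁ := by positivity
  have hκ : ∀ v, |S.κ v| ≤ K := fun v => by
    rw [abs_of_nonneg (S.κ_nonneg v)]; exact S.κ_le v
  -- the discrepancy of the number of descendants with last digit `η`
  set C₂ := C / S.dΛ / θ ^ S.w + (S.q ^ S.w * ((C + K / θ ^ S.w) / S.dΛ) + K / S.dΛ / θ ^ S.w) with hC₂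
  have hθw : 0 < θ ^ S.w := pow_pos hθ0 _
  have hC₂0 : 0 ≤ C₂ := by positivity
  have hcount : ∀ m v, |S.q ^ S.w * ∑ t ∈ S.desc m v, (S.withDigit η 0).indicator (fun _ => (1 : ℝ)) t
          - S.q ^ m * S.κ v / S.dΛ| ≤ C₂ * (S.q * θ) ^ m := by
    intro m v
    have hqθ : 0 < (S.q * θ) ^ m := by positivity
    rcases le_or_gt S.w m with hm | hm
    · rw [S.card_filter_dig hη hη0 hm]
      have h1 := hmix v (m - S.w)
      have e1 : S.q ^ m = S.q ^ S.w * S.q ^ (m - S.w) := by rw [← pow_add]; congr 1; omega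
      have e2 : θ ^ m = θ ^ S.w * θ ^ (m - S.w) := by rw [← pow_add]; congr 1; omega
      have h2 : S.q ^ S.w * ((S.desc (m - S.w) v).card : ℝ) - S.q ^ m * S.κ v / S.dΛ =
          S.q ^ S.w / S.dΛ * (S.dΛ * (S.desc (m - S.w) v).card - S.q ^ (m - S.w) * S.κ v) := by
        rw [e1]
        field_simp
      rw [h2, abs_mul, abs_of_pos (by positivity)]
      calc S.q ^ S.w / S.dΛ * |S.dΛ * (S.desc (m - S.w) v).card - S.q ^ (m - S.w) * S.κ v|
          ≤ S.q ^ S.w / S.dΛ * (C * (S.q * θ) ^ (m - S.w)) := by gcongr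
        _ = C / S.dΛ / θ ^ S.w * (S.q * θ) ^ m := by
          rw [mul_pow, mul_pow, e1, e2]
          field_simp
        _ ≤ C₂ * (S.q * θ) ^ m := by
          gcongr
          rw [hC₂]
          have : 0 ≤ S.q ^ S.w * ((C + K / θ ^ S.w) / S.dΛ) + K / S.dΛ / θ ^ S.w := by positivity
          linarith
    -- There are only finitely many `m < w`, so crude bounds with the constant `θ^(-w)` are enough.
    · have hθm : θ ^ S.w ≤ θ ^ m := pow_le_pow_of_le_one hθ0.le hθ1 hm.le
      have hqm : S.q ^ m ≤ (S.q * θ) ^ m / θ ^ S.w := by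
        rw [le_div_iff₀ hθw, mul_pow]
        gcongr
      have hsum0 : 0 ≤ ∑ t ∈ S.desc m v, (S.withDigit η 0).indicator (fun _ => (1 : ℝ)) t :=
        Finset.sum_nonneg fun t _ => Set.indicator_nonneg (fun _ _ => zero_le_one) t
      have hsum : ∑ t ∈ S.desc m v, (S.withDigit η 0).indicator (fun _ => (1 : ℝ)) t ≤
          (S.desc m v).card := by
        calc _ ≤ ∑ t ∈ S.desc m v, (1 : ℝ) :=
              Finset.sum_le_sum fun t _ => Set.indicator_le_self' (fun _ _ => zero_le_one) t
          _ = _ := by simp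
      have hcard : ((S.desc m v).card : ℝ) ≤ (C + K / θ ^ S.w) / S.dΛ * (S.q * θ) ^ m := by
        have h1 := (le_abs_self _).trans (hmix v m)
        have h2 : S.q ^ m * S.κ v ≤ (S.q * θ) ^ m / θ ^ S.w * K :=
          mul_le_mul hqm (S.κ_le v) (S.κ_nonneg v) (by positivity)
        rw [div_mul_eq_mul_div, le_div_iff₀ hd]
        have h3 : (C + K / θ ^ S.w) * (S.q * θ) ^ m =
            C * (S.q * θ) ^ m + (S.q * θ) ^ m / θ ^ S.w * K := by ring
        rw [h3]
        linarith
      have hsnd : S.q ^ m * S.κ v / S.dΛ ≤ K / S.dΛ / θ ^ S.w * (S.q * θ) ^ m := by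
        rw [div_le_iff₀ hd]
        calc S.q ^ m * S.κ v ≤ (S.q * θ) ^ m / θ ^ S.w * K :=
              mul_le_mul hqm (S.κ_le v) (S.κ_nonneg v) (by positivity)
          _ = _ := by field_simp
      have hsnd0 : 0 ≤ S.q ^ m * S.κ v / S.dΛ :=
        div_nonneg (mul_nonneg (pow_pos hq m).le (S.κ_nonneg v)) hd.le
      have hfst : S.q ^ S.w * ∑ t ∈ S.desc m v, (S.withDigit η 0).indicator (fun _ => (1 : ℝ)) t ≤
          S.q ^ S.w * ((C + K / θ ^ S.w) / S.dΛ) * (S.q * θ) ^ m := by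
        rw [mul_assoc]
        gcongr
        exact hsum.trans hcard
      have hfst0 := mul_nonneg (pow_pos hq S.w).le hsum0
      have h3 : 0 ≤ C / S.dΛ / θ ^ S.w * (S.q * θ) ^ m := by positivity
      rw [abs_le, hC₂, add_mul, add_mul]
      constructor <;> linarith [mul_nonneg (div_nonneg (div_nonneg hK0 hd.le) hθw.le) hqθ.le]
  refine ⟨C + C₁ * K / S.dΛ + C₁ * C₂, by positivity, fun i k v => ?_⟩
  have hqθ : 0 < (S.q * θ) ^ k := by positivity
  rcases le_total k i with hki | hki
  · rw [S.sum_compareFun_of_le η hki]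
    have h1 : |(S.withDigit η (i - k)).indicator
        (fun v => S.dΛ * (S.desc k v).card - S.q ^ k * S.κ v) v| ≤ C * (S.q * θ) ^ k := by
      by_cases hv : v ∈ S.withDigit η (i - k)
      · rw [Set.indicator_of_mem hv]
        exact hmix v k
      · rw [Set.indicator_of_notMem hv, abs_zero]
        positivity
    have h2 : |S.dev η i / S.dΛ * (S.q ^ k * S.κ v)| ≤ C₁ * K / S.dΛ * (S.q * θ) ^ k := by
      rw [abs_mul, abs_div, abs_mul, abs_of_pos hd, abs_of_pos (pow_pos hq k)]
      have h3 : |S.dev η i| ≤ C₁ * θ ^ k :=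
        (hdev i).trans (mul_le_mul_of_nonneg_left (pow_le_pow_of_le_one hθ0.le hθ1 hki) hC₁0)
      calc |S.dev η i| / S.dΛ * (S.q ^ k * |S.κ v|)
          ≤ C₁ * θ ^ k / S.dΛ * (S.q ^ k * K) := by
            gcongr
            exact hκ v
        _ = _ := by rw [mul_pow]; ring
    refine (abs_sub _ _).trans ?_
    have h4 : 0 ≤ C₁ * C₂ * (S.q * θ) ^ k := by positivity
    rw [add_mul, add_mul]
    linarith
  · obtain ⟨m, rfl⟩ := Nat.exists_eq_add_of_le hki
    rw [S.sum_compareFun_of_ge hη0, abs_mul, abs_mul, abs_of_pos (pow_pos hq i)]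
    calc |S.dev η i| * S.q ^ i * _ ≤ C₁ * θ ^ i * S.q ^ i * (C₂ * (S.q * θ) ^ m) := by
          gcongr
          · exact hdev i
          · exact hcount m v
      _ = C₁ * C₂ * (S.q * θ) ^ (i + m) := by rw [pow_add, mul_pow, mul_pow]; ring
      _ ≤ _ := by
          gcongr
          have : 0 ≤ C₁ * K / S.dΛ := by positivity
          linarith


/-- The number of occurrences of the digit `η` at position `i` in the expansions of the lattice points
of a region, compared with a volume. -/
theorem count_compare (η : S.Λ) (i : ℕ) {B : Set (Fin n → ℝ)} (hBm : NullMeasurableSet B) {X : ℝ}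
    (hB : B ⊆ S.ball 0 X) :
    |S.dΛ * ∑ u ∈ S.pts B, (S.withDigit η i).indicator (fun _ => (1 : ℝ)) u -
        volume.real (B ∩ ⋃ u ∈ S.withDigit η i, S.tile u) - S.dev η i / S.dΛ * volume.real B| ≤
      |∑ u ∈ S.pts B, S.compareFun η i u| +
        volume.real (S.ball 0 S.rad) * (1 + |S.dev η i| / S.dΛ) * (S.mixed S.bigRad B).ncard := by
  have hd := S.dΛ_pos
  have hsub : ∀ u : S.Λ, S.tile u ⊆ S.ball u S.bigRad := fun u =>
    (S.tile_subset_ball u).trans (S.ball_mono _ S.rad_le_bigRad)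
  have h1 := S.tiling_compare S.measurableSet_tile S.aedisjoint_tile S.bigRad_pos.le hsub S.κ_le
    (S.withDigit η i) hBm hB
  have h2 := S.tiling_compare S.measurableSet_tile S.aedisjoint_tile S.bigRad_pos.le hsub S.κ_le
    univ hBm hB
  have hcov : ⋃ u ∈ (univ : Set S.Λ), S.tile u = univ := by
    refine eq_univ_of_forall fun x => ?_
    obtain ⟨v, hv⟩ := S.exists_mem_tile x
    exact mem_biUnion (mem_univ v) hv
  rw [hcov, inter_univ] at h2
  simp only [Set.indicator_univ] at h2
  set K := volume.real (S.ball 0 S.rad)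
  set m : ℝ := ((S.mixed S.bigRad B).ncard : ℝ)
  set I₁ := volume.real (B ∩ ⋃ u ∈ S.withDigit η i, S.tile u)
  set s₁ := ∑ u ∈ S.pts B, (S.withDigit η i).indicator (fun u => volume.real (S.tile u)) u with hs₁
  set s₂ := ∑ u ∈ S.pts B, volume.real (S.tile u) with hs₂
  have h3 : ∑ u ∈ S.pts B, S.compareFun η i u =
      S.dΛ * ∑ u ∈ S.pts B, (S.withDigit η i).indicator (fun _ => (1 : ℝ)) u - s₁ -
        S.dev η i / S.dΛ * s₂ := by
    rw [hs₁, hs₂, Finset.mul_sum, Finset.mul_sum, ← Finset.sum_sub_distrib, ← Finset.sum_sub_distrib]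
    refine Finset.sum_congr rfl fun u _ => ?_
    rw [compareFun]
    by_cases hu : u ∈ S.withDigit η i
    · simp only [Set.indicator_of_mem hu, mul_one, κ]
    · simp only [Set.indicator_of_notMem hu, mul_zero, κ, sub_zero]
  -- Both lattice sums of tile volumes are replaced by volumes of regions, each with an error
  -- controlled by `mixed`.
  have h4 : S.dΛ * ∑ u ∈ S.pts B, (S.withDigit η i).indicator (fun _ => (1 : ℝ)) u - I₁ -
      S.dev η i / S.dΛ * volume.real B =
      ∑ u ∈ S.pts B, S.compareFun η i u - (I₁ - s₁) - S.dev η i / S.dΛ * (volume.real B - s₂) := by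
    rw [h3]
    ring
  rw [h4]
  refine (abs_sub _ _).trans ?_
  have h5 : |S.dev η i / S.dΛ * (volume.real B - s₂)| ≤ |S.dev η i| / S.dΛ * (K * m) := by
    rw [abs_mul, abs_div, abs_of_pos hd]
    gcongr
  have h6 := abs_sub (∑ u ∈ S.pts B, S.compareFun η i u) (I₁ - s₁)
  calc _ ≤ |∑ u ∈ S.pts B, S.compareFun η i u| + K * m + |S.dev η i| / S.dΛ * (K * m) := by
        linarith
    _ = _ := by ring

/-! ### Boundary counts on all scales. -/

theorem exists_card_ball_le (c : ℝ) : ∃ M : ℕ, ∀ x, {u : S.Λ | (u : Fin n → ℝ) ∈ S.ball x c}.ncard ≤ M := by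
  refine ⟨{u : S.Λ | (u : Fin n → ℝ) ∈ S.ball 0 (S.R + c)}.ncard, fun x => ?_⟩
  obtain ⟨u₀, hu₀⟩ := S.exists_nrm_sub_le x
  refine Set.ncard_le_ncard_of_injOn (fun u => u - u₀) (fun u hu => ?_)
    (fun u _ v _ h => sub_left_injective h) (S.finite_lattice_ball _ _)
  rw [Set.mem_ofPred_eq, mem_ball] at hu ⊢
  have : ((u - u₀ : S.Λ) : Fin n → ℝ) - 0 = (x - u₀) + (u - x) := by
    push_cast
    abel
  rw [this]
  exact (map_add_le_add _ _ _).trans (add_le_add hu₀ hu)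

/-- Every point of the boundary of a set lies in a cell that meets the set and its complement. -/
theorem exists_cell_of_mem_frontier {B : Set (Fin n → ℝ)} {y : Fin n → ℝ} (hy : y ∈ frontier B) :
    ∃ u : S.Λ, y ∈ S.cell u ∧ ¬ S.cell u ⊆ B ∧ ¬ S.cell u ⊆ Bᶜ := by
  by_contra! hcon
  have hfin := S.finite_lattice_ball y (1 + S.R)
  -- Near `y` all cells that miss `y` are removed. In the remaining neighbourhood every point shares
  -- a cell with `y`; if no such cell were split by `B`, then `y` would not be a boundary point.
  set O : Set (Fin n → ℝ) := {x | S.nrm (x - y) < 1} ∩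
    (⋃ u ∈ {u : S.Λ | (u : Fin n → ℝ) ∈ S.ball y (1 + S.R) ∧ y ∉ S.cell u}, S.cell u)ᶜ with hO
  have hOo : IsOpen O := by
    refine (S.isOpen_nrm_lt y 1).inter (isOpen_compl_iff.2 ?_)
    exact (hfin.subset fun u hu => hu.1).isClosed_biUnion fun u _ => S.isClosed_cell u
  have hyO : y ∈ O := by
    refine ⟨by simp, ?_⟩
    simp only [mem_compl_iff, mem_iUnion, exists_prop, not_exists, not_and]
    exact fun u hu => hu.2
  have hcell : ∀ x ∈ O, ∃ u : S.Λ, x ∈ S.cell u ∧ y ∈ S.cell u := by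
    rintro x ⟨hx1, hx2⟩
    obtain ⟨u, hu⟩ := S.exists_mem_cell x
    refine ⟨u, hu, ?_⟩
    by_contra hyu
    refine hx2 (mem_biUnion (x := u) ⟨?_, hyu⟩ hu)
    rw [mem_ball]
    have h1 : (u : Fin n → ℝ) - y = (x - y) - (x - u) := by abel
    have h2 := S.cell_subset_ball u hu
    rw [h1]
    exact (map_sub_le_add _ _ _).trans (add_le_add (le_of_lt hx1) h2)
  by_cases hyB : y ∈ B
  · refine hy.2 (mem_interior.2 ⟨O, fun x hx => ?_, hOo, hyO⟩)
    obtain ⟨u, hxu, hyu⟩ := hcell x hx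
    by_contra hxB
    exact hcon u hyu (fun h => hxB (h hxu)) hyu hyB
  · have := mem_closure_iff.1 hy.1 O hOo hyO
    obtain ⟨x, hx, hxB⟩ := this
    obtain ⟨u, hxu, hyu⟩ := hcell x hx
    exact hcon u hyu (fun h => hyB (h hyu)) hxu hxB

theorem eq_of_coe_mem_cell {u v : S.Λ} (h : (v : Fin n → ℝ) ∈ S.cell u) : u = v := by
  rw [mem_cell] at h
  have := S.eq_zero_of_nrm_lt (u := u - v) h (by push_cast; simpa using S.r_pos)
  exact sub_eq_zero.1 this

/-- A lattice point lies in no cell but its own, so it belongs to a cell packing only if its own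
cell does. This turns split cells into lattice points counted by the hypothesis on `∂_T(NU)`. -/
theorem coe_mem_boundaryV {B : Set (Fin n → ℝ)} {u : S.Λ} (h1 : ¬ S.cell u ⊆ B)
    (h2 : ¬ S.cell u ⊆ Bᶜ) : (u : Fin n → ℝ) ∈ S.boundaryV B := by
  have key : ∀ A : Set (Fin n → ℝ), ¬ S.cell u ⊆ A → (u : Fin n → ℝ) ∉ S.floorV A := by
    intro A hA hu
    simp only [floorV, mem_iUnion, exists_prop] at hu
    obtain ⟨z, ⟨hz, hzA⟩, huz⟩ := hu
    have := S.eq_of_coe_mem_cell (u := ⟨z, hz⟩) huz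
    exact hA (this ▸ hzA)
  exact subset_closure ⟨subset_closure (key _ h2), key _ h1⟩

theorem boundaryV_subset {B : Set (Fin n → ℝ)} {X : ℝ} (hB : B ⊆ S.ball 0 X) :
    S.boundaryV B ⊆ S.ball 0 (X + S.R + S.R) := by
  have hc : S.ceilV B ⊆ S.ball 0 (X + S.R + S.R) := by
    refine closure_minimal (fun x hx => ?_) (S.isClosed_ball _ _)
    obtain ⟨u, hu⟩ := S.exists_mem_cell x
    have h1 : ¬ S.cell u ⊆ Bᶜ := fun h =>
      hx (mem_biUnion (x := (u : Fin n → ℝ)) ⟨u.2, h⟩ hu)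
    obtain ⟨b, hbu, hb⟩ := Set.not_subset.1 h1
    have hbB : b ∈ B := by simpa using hb
    have h3 := S.mem_ball_zero_of_mem (hB hbB) (S.cell_subset_ball u hbu)
    have h4 := S.cell_subset_ball u hu
    rw [mem_ball, sub_zero] at h3 ⊢
    rw [mem_ball, nrm_sub_comm] at h4
    exact S.nrm_le_add h3 h4
  exact closure_minimal (sdiff_subset.trans hc) (S.isClosed_ball _ _)

/-- Balls are convex, hence connected. -/
theorem exists_frontier_of_mixed {c : ℝ} {B : Set (Fin n → ℝ)} {v : S.Λ} (hv : v ∈ S.mixed c B) :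
    ∃ y ∈ frontier B, y ∈ S.ball v c := by
  obtain ⟨⟨x, hxB, hx⟩, ⟨z, hzB, hz⟩⟩ := hv
  by_contra! hcon
  have hpre := (S.convex_ball v c).isPreconnected
  have hx' : x ∈ interior B := by
    by_contra h
    exact hcon x ⟨subset_closure hxB, h⟩ hx
  have hz' : z ∈ (closure B)ᶜ := by
    intro h
    exact hcon z ⟨h, fun h' => hzB (interior_subset h')⟩ hz
  obtain ⟨y, -, hy1, hy2⟩ := hpre (interior B) (closure B)ᶜ isOpen_interior
    isClosed_closure.isOpen_compl (fun y hy => by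
      by_contra h
      rw [mem_union, not_or, mem_compl_iff, not_not] at h
      exact hcon y ⟨h.2, h.1⟩ hy) ⟨x, hx, hx'⟩ ⟨z, hz, hz'⟩
  exact hy2 (subset_closure (interior_subset hy1))

theorem smul_subset_ball {U : Set (Fin n → ℝ)} {d : ℝ} (hUd : U ⊆ {x | S.nrm x < d}) {N : ℝ}
    (hN : 0 ≤ N) : N • U ⊆ S.ball 0 (N * d) := by
  rintro _ ⟨x, hx, rfl⟩
  rw [mem_ball, sub_zero]
  simp only [map_smul_eq_mul, Real.norm_of_nonneg hN]
  gcongr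
  exact (hUd hx).le

/-- The boundary of the scaled and rotated region is small on all scales. -/
theorem exists_mixed_bound {U : Set (Fin n → ℝ)} {d : ℝ} (hd : 0 < d) (hUd : U ⊆ {x | S.nrm x < d}) {δ : ℝ}
    (hδ0 : 0 ≤ δ)
    (hδ : (fun N : ℝ => (S.cardV (S.boundaryV (N • U)) : ℝ)) =O[atTop] fun N : ℝ => N ^ δ)
    (c : ℝ) : ∃ C : ℝ, 0 ≤ C ∧ ∀ (k : ℤ) (N : ℝ), 0 < N →
      ((S.mixed c (S.app k '' (N • U))).ncard : ℝ) ≤ C * (max 1 (N * S.ρ ^ k)) ^ δ := by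
  obtain ⟨C₁, hC₁⟩ := hδ.bound
  obtain ⟨X₀, hX₀⟩ := eventually_atTop.1 hC₁
  obtain ⟨M, hM⟩ := S.exists_card_ball_le (c + S.R)
  set M₀ := {u : S.Λ | (u : Fin n → ℝ) ∈ S.ball 0 (max X₀ 0 * d + c)}.ncard with hM₀
  refine ⟨max (|C₁| * M) M₀, by positivity, fun k N hN => ?_⟩
  have hρ := zpow_pos S.rho_pos k
  set X := N * S.ρ ^ k with hX
  have hX0 : 0 < X := mul_pos hN hρ
  have hBsub : S.app k '' (N • U) ⊆ S.ball 0 (X * d) := by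
    have := S.app_image_subset_ball (S.smul_subset_ball hUd hN.le) k
    rwa [show S.ρ ^ k * (N * d) = X * d by rw [hX]; ring] at this
  have hmax1 : 1 ≤ (max 1 X) ^ δ := Real.one_le_rpow (le_max_left _ _) hδ0
  -- At small scales the region is contained in a fixed ball, which bounds the count by a constant.
  rcases le_or_gt X X₀ with hle | hgt
  · have h1 : (S.mixed c (S.app k '' (N • U))).ncard ≤ M₀ := by
      refine Set.ncard_le_ncard ?_ (S.finite_lattice_ball _ _)
      rintro v ⟨⟨x, hxB, hx⟩, -⟩
      have h2 := S.mem_ball_zero_of_mem (hBsub hxB) hx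
      refine S.ball_mono 0 ?_ h2
      gcongr
      exact hle.trans (le_max_left _ _)
    calc ((S.mixed c (S.app k '' (N • U))).ncard : ℝ) ≤ M₀ := by exact_mod_cast h1
      _ ≤ max (|C₁| * M) M₀ * 1 := by rw [mul_one]; exact le_max_right _ _
      _ ≤ _ := by gcongr
  · have hXU : X • U ⊆ S.ball 0 (X * d) := S.smul_subset_ball hUd hX0.le
    set Z : Set (Fin n → ℝ) := S.boundaryV (X • U) ∩ (S.Λ : Set (Fin n → ℝ)) with hZ
    have hZfin : Z.Finite := by
      refine ((S.finite_lattice_ball 0 (X * d + S.R + S.R)).image Subtype.val).subset ?_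
      rintro z ⟨hz, hzΛ⟩
      exact ⟨⟨z, hzΛ⟩, S.boundaryV_subset hXU hz, rfl⟩
    -- The hypothesis concerns `X • U`, but the region is `Φ^k (N • U)`, a rotated copy. The
    -- isometry `g = ρ^k Φ^(-k)` carries one to the other without preserving `Λ`; a boundary cell of
    -- `X • U` then accounts for at most `M` lattice points near its pulled-back centre.
    set g : (Fin n → ℝ) ≃ₜ (Fin n → ℝ) :=
      (S.app (-k)).toHomeomorph.trans (Homeomorph.smulOfNeZero (S.ρ ^ k) hρ.ne') with hg
    have hgapp : ∀ x, g x = S.ρ ^ k • S.app (-k) x := fun x => rfl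
    have hgB : g '' (S.app k '' (N • U)) = X • U := by
      rw [Set.image_image]
      simp only [hgapp, app_neg_app]
      rw [show (fun x : Fin n → ℝ => S.ρ ^ k • x) '' (N • U) = S.ρ ^ k • (N • U) from rfl, smul_smul, hX,
        mul_comm]
    have hgnrm : ∀ x y, S.nrm (g x - g y) = S.nrm (x - y) := by
      intro x y
      rw [hgapp, hgapp, ← smul_sub, ← map_sub, map_smul_eq_mul, nrm_app, Real.norm_of_nonneg hρ.le,
        zpow_neg, mul_inv_cancel_left₀ hρ.ne']
    have hcover : S.mixed c (S.app k '' (N • U)) ⊆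
        ⋃ z ∈ hZfin.toFinset, {u : S.Λ | (u : Fin n → ℝ) ∈ S.ball (g.symm z) (c + S.R)} := by
      intro v hv
      obtain ⟨y, hy, hyv⟩ := S.exists_frontier_of_mixed hv
      have hgy : g y ∈ frontier (X • U) := by
        rw [← hgB, ← g.image_frontier]
        exact ⟨y, hy, rfl⟩
      obtain ⟨z, hz1, hz2, hz3⟩ := S.exists_cell_of_mem_frontier hgy
      have hzZ : (z : Fin n → ℝ) ∈ Z := ⟨S.coe_mem_boundaryV hz2 hz3, z.2⟩
      simp only [mem_iUnion, exists_prop, Set.Finite.mem_toFinset]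
      refine ⟨z, hzZ, ?_⟩
      rw [Set.mem_ofPred_eq, mem_ball, ← hgnrm, g.apply_symm_apply]
      have h1 : g v - (z : Fin n → ℝ) = (g v - g y) + (g y - z) := by abel
      rw [h1]
      refine (map_add_le_add _ _ _).trans (add_le_add ?_ (S.cell_subset_ball _ hz1))
      rw [hgnrm, nrm_sub_comm]
      exact hyv
    have hcard : (S.mixed c (S.app k '' (N • U))).ncard ≤ Z.ncard * M := by
      refine (Set.ncard_le_ncard hcover ?_).trans ?_
      · exact hZfin.toFinset.finite_toSet.biUnion fun z _ => S.finite_lattice_ball _ _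
      · refine (Finset.set_ncard_biUnion_le _ _).trans ?_
        rw [Set.ncard_eq_toFinset_card _ hZfin, ← smul_eq_mul]
        exact Finset.sum_le_card_nsmul _ _ _ fun z _ => hM _
    have hZb : (Z.ncard : ℝ) ≤ |C₁| * X ^ δ := by
      have h1 := hX₀ X hgt.le
      rw [Real.norm_of_nonneg (by positivity), Real.norm_of_nonneg (by positivity)] at h1
      refine (show (Z.ncard : ℝ) ≤ C₁ * X ^ δ from h1).trans ?_
      gcongr
      exact le_abs_self _
    calc ((S.mixed c (S.app k '' (N • U))).ncard : ℝ) ≤ Z.ncard * M := by exact_mod_cast hcard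
      _ ≤ |C₁| * X ^ δ * M := by gcongr
      _ = |C₁| * M * X ^ δ := by ring
      _ ≤ max (|C₁| * M) M₀ * (max 1 X) ^ δ := by
        gcongr
        · exact le_max_left _ _
        · exact le_max_right _ _


/-! ### Non-adjacent forms as paths in the tree. -/

/-- The sequences of lattice points that arise by successively appending digits, starting from the
empty expansion. -/
def IsPath (u : ℕ → S.Λ) : Prop := u 0 = 0 ∧ ∀ m, S.par (u (m + 1)) = u m

theorem IsPath.par_iterate {u : ℕ → S.Λ} (hu : S.IsPath u) (m k : ℕ) :
    S.par^[k] (u (m + k)) = u m := by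
  induction k with
  | zero => rfl
  | succ k ih => rw [Function.iterate_succ_apply, ← add_assoc, hu.2, ih]

theorem eq_up_of_dig_eq_zero {u : S.Λ} (h : S.dig u = 0) : u = S.up (S.par u) := by
  refine Subtype.ext ?_
  have := S.coe_eq_par u
  rwa [h, add_zero] at this

theorem IsPath.up_iterate {u : ℕ → S.Λ} (hu : S.IsPath u) {m k : ℕ}
    (h : ∀ j, m ≤ j → j < m + k → S.dig (u (j + 1)) = 0) : u (m + k) = S.up^[k] (u m) := by
  induction k with
  | zero => rfl
  | succ k ih =>
    rw [← add_assoc, S.eq_up_of_dig_eq_zero (h (m + k) (by omega) (by omega)), hu.2,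
      ih (fun j h1 h2 => h j h1 (by omega)), Function.iterate_succ_apply']

/-- Horner's scheme from the most significant digit: the `m`-th point collects the digits at
positions `l - 1, …, l - m`. -/
theorem exists_path_of_isNAF {ξ : ℤ → Fin n → ℝ} (hξ : S.IsNAF ξ) (l : ℤ) :
    ∃ u, S.IsPath u ∧ ∀ m : ℕ, S.dig (u (m + 1)) = ξ (l - 1 - m) := by
  set u : ℕ → S.Λ := fun m => Nat.rec 0
    (fun m v => S.up v + ⟨ξ (l - 1 - m), S.digits_lattice _ (hξ.1 _)⟩) m with hu
  have hsucc : ∀ m : ℕ, u (m + 1) = S.up (u m) + ⟨ξ (l - 1 - m), S.digits_lattice _ (hξ.1 _)⟩ :=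
    fun m => rfl
  have hrun : ∀ m k : ℕ, (∀ j, m ≤ j → j < m + k → ξ (l - 1 - j) = 0) →
      u (m + k) = S.up^[k] (u m) := by
    intro m k h
    induction k with
    | zero => rfl
    | succ k ih =>
      have h0 := h (m + k) (by omega) (by omega)
      rw [← add_assoc, hsucc, ih (fun j h1 h2 => h j h1 (by omega)), Function.iterate_succ_apply']
      refine Subtype.ext ?_
      push_cast at h0 ⊢
      rw [h0, add_zero]
  have hstep : ∀ m : ℕ, S.IsStep (u (m + 1)) (u m) (ξ (l - 1 - m)) := by
    intro m
    refine ⟨hξ.1 _, rfl, fun h0 => ?_⟩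
    have hz : ∀ j : ℕ, j < m → m < j + S.w → ξ (l - 1 - j) = 0 := by
      intro j hj1 hj2
      by_contra hne
      have := hξ.2 (l - 1 - m) (x := l - 1 - m) ⟨le_rfl, by have := S.w_pos; omega, h0⟩
        (y := l - 1 - j) ⟨by omega, by omega, hne⟩
      omega
    -- Before a non-zero digit the last `w - 1` digits vanish. Either so many digits have been read
    -- and `u m` is divisible by `Φ^(w-1)`, or all digits read are zero and `u m = 0`.
    rcases le_or_gt (S.w - 1) m with hm | hm
    · have h1 := hrun (m - (S.w - 1)) (S.w - 1) (fun j h1 h2 => hz j (by omega) (by omega))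
      rw [Nat.sub_add_cancel hm] at h1
      exact ⟨_, h1.symm⟩
    · have h1 := hrun 0 m (fun j h1 h2 => hz j (by omega) (by omega))
      rw [zero_add] at h1
      rw [h1, show u 0 = 0 from rfl, up_iterate_zero]
      exact ⟨0, S.up_iterate_zero _⟩
  exact ⟨u, ⟨rfl, fun m => (S.par_dig_of_isStep (hstep m)).1⟩,
    fun m => (S.par_dig_of_isStep (hstep m)).2⟩

/-- The non-adjacent form that belongs to a path. -/
def nafOfPath (u : ℕ → S.Λ) (l i : ℤ) : Fin n → ℝ := if i < l then S.dig (u (l - i).toNat) else 0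

theorem nafOfPath_apply (u : ℕ → S.Λ) (l : ℤ) (m : ℕ) :
    S.nafOfPath u l (l - 1 - m) = S.dig (u (m + 1)) := by
  rw [nafOfPath, if_pos (by omega)]
  congr 2
  omega

theorem nafOfPath_of_le (u : ℕ → S.Λ) {l i : ℤ} (h : l ≤ i) : S.nafOfPath u l i = 0 := by
  rw [nafOfPath, if_neg (by omega)]

theorem dig_up_iterate {y : S.Λ} {k : ℕ} (hk : 0 < k) : S.dig (S.up^[k] y) = 0 := by
  obtain ⟨k, rfl⟩ := Nat.exists_eq_succ_of_ne_zero hk.ne'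
  rw [Function.iterate_succ_apply', dig_up]

/-- The parent of a point with non-zero last digit lies in `Φ^(w-1)Λ`, and injectivity of `Φ` forces
its own last `w - 1` digits to be zero. -/
theorem isNAF_nafOfPath {u : ℕ → S.Λ} (hu : S.IsPath u) (l : ℤ) : S.IsNAF (S.nafOfPath u l) := by
  constructor
  · intro i
    rw [nafOfPath]
    split_ifs
    · exact S.dig_mem _
    · exact S.zero_digit
  · have key : ∀ i i' : ℤ, i < i' → i' < i + S.w → S.nafOfPath u l i ≠ 0 →
        S.nafOfPath u l i' = 0 := by
      intro i i' h1 h2 h3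
      by_contra h4
      have hi : i < l := by
        by_contra h
        exact h3 (S.nafOfPath_of_le u (by omega))
      have hi' : i' < l := by
        by_contra h
        exact h4 (S.nafOfPath_of_le u (by omega))
      obtain ⟨m, hm⟩ : ∃ m : ℕ, i = l - 1 - m := ⟨(l - 1 - i).toNat, by omega⟩
      obtain ⟨m', hm'⟩ : ∃ m' : ℕ, i' = l - 1 - m' := ⟨(l - 1 - i').toNat, by omega⟩
      rw [hm, nafOfPath_apply] at h3
      rw [hm', nafOfPath_apply] at h4
      obtain ⟨y, hy⟩ := S.par_mem_range h3
      rw [hu.2] at hy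
      obtain ⟨k, hk⟩ : ∃ k : ℕ, m = (m' + 1) + k := ⟨m - (m' + 1), by omega⟩
      have h5 := hu.par_iterate S (m' + 1) k
      rw [← hk, ← hy, show S.w - 1 = k + (S.w - 1 - k) by omega, Function.iterate_add_apply,
        par_iterate_up_iterate] at h5
      rw [← h5] at h4
      exact h4 (S.dig_up_iterate (by omega))
    intro j i hi i' hi'
    obtain ⟨hi1, hi2, hi3⟩ := hi
    obtain ⟨hi'1, hi'2, hi'3⟩ := hi'
    by_contra hne
    rcases lt_or_gt_of_ne hne with h | h
    · exact hi'3 (key i i' h (by omega) hi3)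
    · exact hi3 (key i' i h (by omega) hi'3)

theorem summable_app_neg {a : ℕ → Fin n → ℝ} (ha : ∀ m, a m ∈ S.D) (l : ℤ) :
    Summable fun m : ℕ => S.app (l - m) (a m) := by
  obtain ⟨C, hC, hCn⟩ := S.exists_norm_le_nrm
  have hρ := S.rho_pos
  have hgeo : Summable fun m : ℕ => C * (S.ρ ^ l * (S.ρ ^ S.w * S.R)) * (S.ρ⁻¹) ^ m :=
    (summable_geometric_of_lt_one (by positivity) (inv_lt_one_of_one_lt₀ S.one_lt_rho)).mul_left _
  refine Summable.of_norm_bounded hgeo fun m => ?_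
  refine (hCn _).trans ?_
  rw [nrm_app, zpow_sub₀ hρ.ne', zpow_natCast]
  have := S.nrm_digit_le' (ha m)
  have hz := zpow_pos hρ l
  calc C * (S.ρ ^ l / S.ρ ^ m * S.nrm (a m)) ≤ C * (S.ρ ^ l / S.ρ ^ m * (S.ρ ^ S.w * S.R)) := by
        gcongr
    _ = _ := by rw [inv_pow]; ring

/-- The value of a non-adjacent form is the limit along its path. -/
theorem tendsto_value {u : ℕ → S.Λ} (hu : S.IsPath u) {ξ : ℤ → Fin n → ℝ} {l : ℤ}
    (hl : ∀ i, l ≤ i → ξ i = 0) (hξ : ∀ m : ℕ, S.dig (u (m + 1)) = ξ (l - 1 - m)) :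
    Tendsto (fun m : ℕ => S.app (l - m) (u m)) atTop (𝓝 (S.value ξ)) := by
  have hinj : Function.Injective fun m : ℕ => l - 1 - (m : ℤ) := by
    intro a b h
    simp only at h
    omega
  -- The two-sided series is supported below `l`; it is reindexed by `m ↦ l - 1 - m`.
  have hsupp : Function.support (fun j : ℤ => (S.Φ ^ j) *ᵥ ξ j) ⊆ range fun m : ℕ => l - 1 - (m : ℤ) := by
    intro j hj
    have hjl : j < l := by
      by_contra h
      exact hj (by simp [hl j (by omega)])
    exact ⟨(l - 1 - j).toNat, by simp only; omega⟩
  have hval : S.value ξ = ∑' m : ℕ, S.app (l - 1 - m) (S.dig (u (m + 1))) := by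
    rw [value, ← hinj.tsum_eq hsupp]
    refine tsum_congr fun m => ?_
    rw [hξ]
    rfl
  have hsum := (S.summable_app_neg (fun m => S.dig_mem (u (m + 1))) (l - 1)).hasSum.tendsto_sum_nat
  rw [← hval] at hsum
  refine hsum.congr fun M => ?_
  induction M with
  | zero => simp [hu.1]
  | succ M ih =>
    rw [Finset.sum_range_succ, ih, S.coe_eq_par (u (M + 1)), map_add, hu.2, ← app_add]
    congr 2
    · congr 1
      push_cast
      ring
    · congr 1
      push_cast
      ring

theorem nrm_app_sub_le_of_tendsto {u : ℕ → S.Λ} (hu : S.IsPath u) {l : ℤ} {x : Fin n → ℝ}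
    (hx : Tendsto (fun m : ℕ => S.app (l - m) (u m)) atTop (𝓝 x)) (m : ℕ) :
    S.nrm (S.app (m - l) x - u m) ≤ S.rad := by
  have h1 : Tendsto (fun M : ℕ => S.nrm (S.app (m - l) (S.app (l - M) (u M)) - u m)) atTop
      (𝓝 (S.nrm (S.app (m - l) x - u m))) :=
    (S.nrm_continuous.tendsto _).comp
      ((((S.app (m - l)).continuous.tendsto x).comp hx).sub_const _)
  refine le_of_tendsto h1 ?_
  filter_upwards [eventually_ge_atTop m] with M hM
  obtain ⟨k, rfl⟩ := Nat.exists_eq_add_of_le hM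
  rw [← app_add, show (m : ℤ) - l + (l - (m + k : ℕ)) = -(k : ℤ) by push_cast; ring]
  have := S.nrm_par_iterate_le k (x := S.app (-k) (u (m + k))) (u := u (m + k))
    (by simpa using S.rad_pos.le)
  rwa [hu.par_iterate S] at this

theorem mem_tile_of_path {u : ℕ → S.Λ} (hu : S.IsPath u) {l : ℤ} {x : Fin n → ℝ}
    (hx : Tendsto (fun m : ℕ => S.app (l - m) (u m)) atTop (𝓝 x)) (m : ℕ) :
    S.app (m - l) x ∈ S.tile (u m) := by
  intro k
  refine ⟨u (m + k), hu.par_iterate S m k, ?_⟩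
  rw [← app_add, show (k : ℤ) + (m - l) = (m + k : ℕ) - l by push_cast; ring]
  exact S.nrm_app_sub_le_of_tendsto hu hx (m + k)

theorem tendsto_of_nrm_le {u : ℕ → S.Λ} {l : ℤ} {x : Fin n → ℝ} {C : ℝ}
    (h : ∀ᶠ m : ℕ in atTop, S.nrm (S.app (m - l) x - u m) ≤ C) :
    Tendsto (fun m : ℕ => S.app (l - m) (u m)) atTop (𝓝 x) := by
  obtain ⟨K, hK, hKn⟩ := S.exists_norm_le_nrm
  have hρ := S.rho_pos
  rw [tendsto_iff_norm_sub_tendsto_zero]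
  have hgeo : Tendsto (fun m : ℕ => K * (S.ρ ^ l * C) * (S.ρ⁻¹) ^ m) atTop (𝓝 0) := by
    simpa using (tendsto_pow_atTop_nhds_zero_of_lt_one (by positivity)
      (inv_lt_one_of_one_lt₀ S.one_lt_rho)).const_mul (K * (S.ρ ^ l * C))
  refine squeeze_zero' (Eventually.of_forall fun _ => norm_nonneg _) ?_ hgeo
  filter_upwards [h] with m hm
  refine (hKn _).trans ?_
  have h1 : S.app (l - m) (u m) - x = -(S.app (l - m) (S.app (m - l) x - u m)) := by
    rw [map_sub, ← app_add]
    simp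
  rw [h1, map_neg_eq_map, nrm_app, zpow_sub₀ hρ.ne', zpow_natCast]
  have hz := zpow_pos hρ l
  calc K * (S.ρ ^ l / S.ρ ^ m * S.nrm (S.app (m - l) x - u m)) ≤ K * (S.ρ ^ l / S.ρ ^ m * C) := by
        gcongr
    _ = _ := by rw [inv_pow]; ring

/-- The path that leads to `z` after `L` steps and continues with zero digits. -/
def natPath (L : ℕ) (z : S.Λ) (m : ℕ) : S.Λ := S.par^[L] (S.up^[m] z)

theorem isPath_natPath {L : ℕ} {z : S.Λ} (h : S.par^[L] z = 0) : S.IsPath (S.natPath L z) := by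
  refine ⟨h, fun m => ?_⟩
  rw [natPath, natPath, ← Function.iterate_succ_apply' S.par, Function.iterate_succ_apply,
    Function.iterate_succ_apply' S.up, par_up]

theorem natPath_of_ge {L m : ℕ} (h : L ≤ m) (z : S.Λ) : S.natPath L z m = S.up^[m - L] z := by
  rw [natPath, show m = L + (m - L) by omega, Function.iterate_add_apply, par_iterate_up_iterate]
  congr 2
  omega

theorem natPath_sub {L j : ℕ} (h : j ≤ L) (z : S.Λ) : S.natPath L z (L - j) = S.par^[j] z := by
  rw [natPath]
  nth_rewrite 1 [show L = j + (L - j) by omega]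
  rw [Function.iterate_add_apply, par_iterate_up_iterate]

theorem tendsto_natPath (L : ℕ) (z : S.Λ) (l : ℤ) :
    Tendsto (fun m : ℕ => S.app (l - m) (S.natPath L z m)) atTop (𝓝 (S.app (l - L) z)) := by
  refine S.tendsto_of_nrm_le (C := 0) ?_
  filter_upwards [eventually_ge_atTop L] with m hm
  rw [S.natPath_of_ge hm, coe_up_iterate, ← app_add,
    show (m : ℤ) - l + (l - L) = (m - L : ℕ) by omega, sub_self, map_zero]

theorem IsPath.tendsto_of_dig_eq_zero {u : ℕ → S.Λ} (hu : S.IsPath u) {L : ℕ}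
    (h : ∀ m, L ≤ m → S.dig (u (m + 1)) = 0) (l : ℤ) :
    Tendsto (fun m : ℕ => S.app (l - m) (u m)) atTop (𝓝 (S.app (l - L) (u L))) := by
  refine S.tendsto_of_nrm_le (C := 0) ?_
  filter_upwards [eventually_ge_atTop L] with m hm
  obtain ⟨k, rfl⟩ := Nat.exists_eq_add_of_le hm
  rw [hu.up_iterate S (fun j h1 _ => h j h1), coe_up_iterate, ← app_add,
    show ((L + k : ℕ) : ℤ) - l + (l - L) = (k : ℕ) by push_cast; ring, sub_self, map_zero]

/-- The path of a finite expansion reaches `z` after `l` steps, so its digits are read off by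
iterating `par`. This gives uniqueness of expansions. -/
theorem IsExpansion.digit {ξ : ℤ → Fin n → ℝ} {z : Fin n → ℝ} (h : S.IsExpansion ξ z) :
    ∃ hz : z ∈ S.Λ, ∀ j : ℕ, ξ j = S.dig (S.par^[j] ⟨z, hz⟩) := by
  obtain ⟨hnaf, ⟨l, hl⟩, hneg, hval⟩ := h
  obtain ⟨u, hu, hdig⟩ := S.exists_path_of_isNAF hnaf l
  have h1 := S.tendsto_value hu hl hdig
  have h2 := hu.tendsto_of_dig_eq_zero S (L := l) (fun m hm => by
    rw [hdig]
    exact hneg _ (by omega)) l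
  have hz : z = u l := by
    rw [← hval, tendsto_nhds_unique h1 h2]
    simp
  refine ⟨hz ▸ (u l).2, fun j => ?_⟩
  have hz' : (⟨z, hz ▸ (u l).2⟩ : S.Λ) = u l := Subtype.ext hz
  rw [hz']
  rcases lt_or_ge j l with hj | hj
  · obtain ⟨m, hm⟩ : ∃ m : ℕ, l = (m + 1) + j := ⟨l - 1 - j, by omega⟩
    rw [hm, hu.par_iterate S, hdig, hm]
    congr 1
    push_cast
    ring
  · rw [hl j (by omega), show j = (j - l) + l by omega, Function.iterate_add_apply]
    have := hu.par_iterate S 0 l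
    rw [zero_add, hu.1] at this
    rw [this, par_iterate_zero, dig_zero]

theorem exists_isExpansion (z : S.Λ) : ∃ ξ, S.IsExpansion ξ z := by
  obtain ⟨l, hl⟩ := S.exists_par_iterate_eq_zero z
  have hp := S.isPath_natPath hl
  refine ⟨S.nafOfPath (S.natPath l z) l, S.isNAF_nafOfPath hp l,
    ⟨l, fun i hi => S.nafOfPath_of_le _ hi⟩, fun i hi => ?_, ?_⟩
  · obtain ⟨m, hm⟩ : ∃ m : ℕ, i = l - 1 - m := ⟨(l - 1 - i).toNat, by omega⟩
    rw [hm, nafOfPath_apply, S.natPath_of_ge (by omega)]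
    exact S.dig_up_iterate (by omega)
  · have h1 := S.tendsto_value hp (fun i hi => S.nafOfPath_of_le _ hi)
      (fun m => (S.nafOfPath_apply (S.natPath l z) l m).symm)
    have h2 := S.tendsto_natPath l z l
    rw [tendsto_nhds_unique h1 h2]
    simp

theorem existsUnique_isExpansion {z : Fin n → ℝ} (hz : z ∈ S.Λ) : ∃! ξ, S.IsExpansion ξ z := by
  obtain ⟨ξ, hξ⟩ := S.exists_isExpansion ⟨z, hz⟩
  refine ⟨ξ, hξ, fun ξ' hξ' => ?_⟩
  obtain ⟨_, h1⟩ := hξ.digit S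
  obtain ⟨_, h2⟩ := hξ'.digit S
  funext i
  rcases lt_or_ge i 0 with hi | hi
  · rw [hξ.2.2.1 i hi, hξ'.2.2.1 i hi]
  · lift i to ℕ using hi
    rw [h1, h2]


/-! ### The characteristic sets as tiles. -/

theorem exists_descending_path {v : S.Λ} {x : Fin n → ℝ} (hx : x ∈ S.tile v) :
    ∃ u : ℕ → S.Λ, u 0 = v ∧ (∀ m, S.par (u (m + 1)) = u m) ∧ ∀ m : ℕ, S.app m x ∈ S.tile (u m) := by
  choose f hf1 hf2 using fun p : {p : (Fin n → ℝ) × S.Λ // p.1 ∈ S.tile p.2} =>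
    S.exists_mem_tile_of_par p.2
  set g : ℕ → {p : (Fin n → ℝ) × S.Λ // p.1 ∈ S.tile p.2} := fun m => Nat.rec ⟨(x, v), hx⟩
    (fun _ p => ⟨(S.app 1 p.1.1, f p), hf2 p⟩) m with hg
  have hfst : ∀ m : ℕ, (g m).1.1 = S.app m x := by
    intro m
    induction m with
    | zero => simp [hg]
    | succ m ih =>
      show S.app 1 (g m).1.1 = _
      rw [ih, ← app_add]
      push_cast
      rw [add_comm]
  refine ⟨fun m => (g m).1.2, rfl, fun m => hf1 (g m), fun m => ?_⟩
  rw [← hfst]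
  exact (g m).2

/-- The point before the digit is divisible by `Φ^(w-1)` and lies only `w - 1` levels below the
root, so it is `0`. -/
theorem IsPath.eq_of_dig {u : ℕ → S.Λ} (hu : S.IsPath u) {η : S.Λ} (hη0 : η ≠ 0)
    (h : S.dig (u S.w) = η) : u S.w = η := by
  have hw := S.w_pos
  have h0 : S.dig (u S.w) ≠ 0 := fun h' => hη0 (Subtype.ext (by rw [← h, h']; rfl))
  obtain ⟨y, hy⟩ := S.par_mem_range h0
  have h1 := hu.2 (S.w - 1)
  rw [Nat.sub_add_cancel hw] at h1
  rw [h1] at hy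
  have h2 := hu.par_iterate S 0 (S.w - 1)
  rw [zero_add, ← hy, par_iterate_up_iterate, hu.1] at h2
  refine Subtype.ext ?_
  rw [S.coe_eq_par (u S.w), h1, h, ← hy, h2, up_iterate_zero]
  simp

/-- The `-w`-th digit is the `w`-th in reading order; being non-zero, it is preceded by zeros. The
forms in question are thus the paths that pass through `η` at step `w`. -/
theorem charSet_eq {η : S.Λ} (hη : (η : Fin n → ℝ) ∈ S.D) (hη0 : η ≠ 0) :
    S.charSet η = S.app (-S.w) '' S.tile η := by
  have hw := S.w_pos
  ext x
  constructor
  · rintro ⟨ξ, ⟨hnaf, hpos, hξη⟩, rfl⟩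
    obtain ⟨u, hu, hdig⟩ := S.exists_path_of_isNAF hnaf 0
    have h1 := S.mem_tile_of_path hu (S.tendsto_value hu hpos hdig) S.w
    have h2 : u S.w = η := by
      refine hu.eq_of_dig S hη0 ?_
      have := hdig (S.w - 1)
      rw [Nat.sub_add_cancel hw] at this
      rw [this, ← hξη]
      congr 1
      omega
    rw [h2] at h1
    rw [mem_app_image]
    simpa using h1
  · rw [mem_app_image, neg_neg]
    intro hx
    obtain ⟨u, hu0, hupar, hutile⟩ := S.exists_descending_path hx
    -- The path waits at the root for `w` steps so that `η` is placed at position `-w`.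
    set v : ℕ → S.Λ := fun m => if m < S.w then 0 else u (m - S.w) with hv
    have hpath : S.IsPath v := by
      refine ⟨by simp [hv, hw], fun m => ?_⟩
      simp only [hv]
      rcases lt_trichotomy (m + 1) S.w with h | h | h
      · rw [if_pos h, if_pos (by omega), par_zero]
      · rw [if_neg (by omega), if_pos (by omega), h, Nat.sub_self, hu0, S.par_digit hη]
      · rw [if_neg (by omega), if_neg (by omega), show m + 1 - S.w = (m - S.w) + 1 by omega, hupar]
    have hlim : Tendsto (fun m : ℕ => S.app (0 - m) (v m)) atTop (𝓝 x) := by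
      refine S.tendsto_of_nrm_le (C := S.rad) ?_
      filter_upwards [eventually_ge_atTop S.w] with m hm
      have h1 := S.tile_subset_ball _ (hutile (m - S.w))
      simp only [hv]
      rw [if_neg (by omega)]
      rw [mem_ball, ← app_add, show ((m - S.w : ℕ) : ℤ) + S.w = m - 0 by omega] at h1
      exact h1
    refine ⟨S.nafOfPath v 0, ⟨S.isNAF_nafOfPath hpath 0, fun i hi => S.nafOfPath_of_le _ hi, ?_⟩, ?_⟩
    · have := S.nafOfPath_apply v 0 (S.w - 1)
      rw [show (0 : ℤ) - 1 - ((S.w - 1 : ℕ) : ℤ) = -S.w by omega, Nat.sub_add_cancel hw] at this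
      rw [this]
      simp only [hv, lt_irrefl, if_false, Nat.sub_self, hu0]
      exact S.dig_digit hη
    · exact tendsto_nhds_unique (S.tendsto_value hpath (fun i hi => S.nafOfPath_of_le _ hi)
        (fun m => (S.nafOfPath_apply v 0 m).symm)) hlim

/-- Truncated forms correspond to the `j`-th descendants of `η`. Hence `β` measures the mixing error
at `η`. -/
theorem act_charSetAt {η : S.Λ} (hη : (η : Fin n → ℝ) ∈ S.D) (hη0 : η ≠ 0) (j : ℕ) :
    S.act (j + S.w) (S.charSetAt η j) = Subtype.val '' (S.desc j η : Set S.Λ) := by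
  have hw := S.w_pos
  rw [act_eq]
  ext z
  rw [mem_app_image]
  constructor
  · rintro ⟨ξ, ⟨hnaf, hpos, hlow, hξη⟩, hval⟩
    obtain ⟨u, hu, hdig⟩ := S.exists_path_of_isNAF hnaf 0
    have h1 := S.tendsto_value hu hpos hdig
    have h2 := hu.tendsto_of_dig_eq_zero S (L := S.w + j) (fun m hm => by
      rw [hdig]
      exact hlow _ (by omega)) 0
    have h3 := tendsto_nhds_unique h1 h2
    have h4 : u S.w = η := by
      refine hu.eq_of_dig S hη0 ?_
      have := hdig (S.w - 1)
      rw [Nat.sub_add_cancel hw] at this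
      rw [this, ← hξη]
      congr 1
      omega
    refine ⟨u (S.w + j), ?_, ?_⟩
    · rw [Finset.mem_coe, mem_desc, hu.par_iterate S, h4]
    · rw [hval, show (0 : ℤ) - ((S.w + j : ℕ) : ℤ) = -(j + S.w : ℤ) by push_cast; ring] at h3
      exact ((S.app _).injective h3).symm
  · rintro ⟨t, ht, rfl⟩
    rw [Finset.mem_coe, mem_desc] at ht
    have hzero : S.par^[j + S.w] t = 0 := by
      rw [add_comm, Function.iterate_add_apply, ht, show S.w = (S.w - 1) + 1 by omega,
        Function.iterate_succ_apply, S.par_digit hη, par_iterate_zero]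
    have hp := S.isPath_natPath hzero
    set u := S.natPath (j + S.w) t with hu
    refine ⟨S.nafOfPath u 0, ⟨S.isNAF_nafOfPath hp 0, fun i hi => S.nafOfPath_of_le _ hi,
      fun i hi => ?_, ?_⟩, ?_⟩
    · obtain ⟨m, hm⟩ : ∃ m : ℕ, i = 0 - 1 - m := ⟨(-1 - i).toNat, by omega⟩
      rw [hm, nafOfPath_apply, hu, S.natPath_of_ge (by omega)]
      exact S.dig_up_iterate (by omega)
    · have := S.nafOfPath_apply u 0 (S.w - 1)
      rw [show (0 : ℤ) - 1 - ((S.w - 1 : ℕ) : ℤ) = -S.w by omega, Nat.sub_add_cancel hw] at this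
      rw [this, hu]
      have h1 := S.natPath_sub (L := j + S.w) (j := j) (by omega) t
      rw [Nat.add_sub_cancel_left, ht] at h1
      rw [h1, S.dig_digit hη]
    · have h1 := tendsto_nhds_unique (S.tendsto_value hp (fun i hi => S.nafOfPath_of_le _ hi)
        (fun m => (S.nafOfPath_apply u 0 m).symm)) (S.tendsto_natPath (j + S.w) t 0)
      rw [h1]
      congr 2
      push_cast
      ring

theorem volume_coverV_finset (F : Finset S.Λ) :
    volume.real (S.coverV (Subtype.val '' (F : Set S.Λ))) = F.card * S.dΛ := by
  have h : S.coverV (Subtype.val '' (F : Set S.Λ)) = ⋃ u ∈ F, S.cell u := by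
    ext x
    simp only [coverV, mem_iUnion, exists_prop]
    constructor
    · rintro ⟨_, ⟨⟨u, hu, rfl⟩, -⟩, hx⟩
      exact ⟨u, hu, hx⟩
    · rintro ⟨u, hu, hx⟩
      exact ⟨u, ⟨⟨u, hu, rfl⟩, u.2⟩, hx⟩
  rw [h, measureReal_biUnion_finset₀ (fun u _ v _ huv => S.aedisjoint_cell huv)
    (fun u _ => (S.measurableSet_cell u).nullMeasurableSet)
    (fun u _ => by rw [volume_cell]; exact S.volume_T_lt_top.ne)]
  simp [volumeReal_cell]

theorem volume_charSet {η : S.Λ} (hη : (η : Fin n → ℝ) ∈ S.D) (hη0 : η ≠ 0) :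
    volume.real (S.charSet η) = S.κ η / S.q ^ S.w := by
  rw [S.charSet_eq hη hη0, volumeReal_app_image, zpow_neg, zpow_natCast, κ, inv_mul_eq_div]

theorem β_eq_dev {η : S.Λ} (hη : (η : Fin n → ℝ) ∈ S.D) (hη0 : η ≠ 0) (j : ℕ) :
    S.β η j = S.dev η j := by
  have hq := S.q_pos
  rw [β, coverVAt, S.act_charSetAt hη hη0, act_eq, volumeReal_app_image, volume_coverV_finset,
    S.volume_charSet hη hη0, dev, show -((j : ℤ) + S.w) = -((j + S.w : ℕ) : ℤ) by push_cast; ring,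
    zpow_neg, zpow_natCast, pow_add]
  field_simp

/-- This is where the constant `E` of the main term comes from: the volume of a characteristic set
relative to that of a cell. -/
theorem κ_div {t : S.Λ} (ht : t ∉ range S.up) : S.κ t / S.q ^ S.w = S.dΛ * S.E := by
  have h := S.κ_eq ht
  have hq := S.q_pos
  have hw := S.w_pos
  have hq1 := S.one_lt_q
  have hcast : ((S.w - 1 : ℕ) : ℝ) = S.w - 1 := by push_cast [Nat.one_le_iff_ne_zero.2 hw.ne']; ring
  rw [hcast] at h
  have hw1 : (1 : ℝ) ≤ S.w := by exact_mod_cast hw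
  have hpos : 0 < (S.q - 1) * S.w + 1 := by nlinarith
  have hE : S.E = 1 / (S.q ^ (S.w - 1) * ((S.q - 1) * S.w + 1)) := by
    rw [E, q, pow_mul]
  have hqw : S.q ^ S.w = S.q ^ (S.w - 1) * S.q := by rw [← pow_succ]; congr 1; omega
  have hne := hpos.ne'
  have hq0 := hq.ne'
  have h1 : S.κ t * ((S.q - 1) * S.w + 1) = S.q * S.dΛ := by
    rw [← h]
    field_simp
    ring
  rw [hE, hqw, mul_one_div, div_eq_div_iff (by positivity) (by positivity)]
  linear_combination S.q ^ (S.w - 1) * h1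

/-! ### Fractional parts and the periodic digit set. -/

theorem frac_mem (x : Fin n → ℝ) : S.frac x ∈ S.T' := (S.restricted_partition x).choose_spec.1.2

theorem sub_frac_mem (x : Fin n → ℝ) : x - S.frac x ∈ S.Λ := by
  have := (S.restricted_partition x).choose_spec.1.1
  rwa [frac, sub_sub_cancel]

theorem frac_eq_of {x y : Fin n → ℝ} (hy : y ∈ S.T') (h : x - y ∈ S.Λ) : S.frac x = y := by
  have h1 := (S.restricted_partition x).choose_spec.2 (x - y) ⟨h, by simpa using hy⟩
  rw [frac, ← h1, sub_sub_cancel]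

theorem frac_eq_frac_iff {x y : Fin n → ℝ} : S.frac x = S.frac y ↔ x - y ∈ S.Λ := by
  constructor
  · intro h
    have h1 := S.Λ.sub_mem (S.sub_frac_mem x) (S.sub_frac_mem y)
    rw [h] at h1
    simpa using h1
  · intro h
    refine S.frac_eq_of (S.frac_mem y) ?_
    have := S.Λ.add_mem h (S.sub_frac_mem y)
    simpa using this

/-- The set of all points which have an expansion with digit `η` at position `0`. -/
def digitSet (η : S.Λ) : Set (Fin n → ℝ) := ⋃ u ∈ S.withDigit η 0, S.tile u

theorem measurableSet_digitSet (η : S.Λ) : MeasurableSet (S.digitSet η) :=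
  MeasurableSet.biUnion (Set.to_countable _) fun u _ => S.measurableSet_tile u

theorem app_image_digitSet (η : S.Λ) (i : ℕ) :
    S.app i '' S.digitSet η = ⋃ u ∈ S.withDigit η i, S.tile u := by
  rw [digitSet, Set.image_iUnion₂]
  simp_rw [app_image_tile]
  ext y
  simp only [mem_iUnion, exists_prop, mem_desc, withDigit, Set.mem_ofPred_eq, Function.iterate_zero, id]
  constructor
  · rintro ⟨v, hv, u, hu, hy⟩
    exact ⟨u, by rw [hu, hv], hy⟩
  · rintro ⟨u, hu, hy⟩
    exact ⟨_, hu, u, rfl, hy⟩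

/-- The tiles of the points with last digit `η` are translates of `tile η` by `Φ^w Λ`. After
division by `Φ^w` they become the `Λ`-translates of the characteristic set. -/
theorem mem_digitSet_iff {η : S.Λ} (hη : (η : Fin n → ℝ) ∈ S.D) (hη0 : η ≠ 0) {x : Fin n → ℝ} :
    S.app S.w x ∈ S.digitSet η ↔ ∃ c ∈ S.charSet η, x - c ∈ S.Λ := by
  have hw := S.w_pos
  rw [S.charSet_eq hη hη0]
  simp only [digitSet, mem_iUnion, exists_prop]
  constructor
  · rintro ⟨u, hu, hx⟩
    have hu' : S.dig u = η := hu
    obtain ⟨h1, h2⟩ := S.eq_add_of_dig hu' hη0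
    have h0 : S.dig u ≠ 0 := fun h' => hη0 (Subtype.ext (by rw [← hu', h']; rfl))
    obtain ⟨y, hy⟩ := S.par_mem_range h0
    rw [h1, tile_add S h2] at hx
    obtain ⟨c, hc, hcx⟩ := hx
    refine ⟨S.app (-S.w) c, ⟨c, hc, rfl⟩, ?_⟩
    have : x - S.app (-S.w) c = y := by
      apply (S.app S.w).injective
      rw [map_sub, app_app_neg, ← hcx]
      simp only [add_sub_cancel_right]
      rw [← hy, ← Function.iterate_succ_apply' S.up, show (S.w - 1).succ = S.w by omega, coe_up_iterate]
    rw [this]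
    exact y.2
  · rintro ⟨_, ⟨c, hc, rfl⟩, hxc⟩
    set y : S.Λ := ⟨_, hxc⟩ with hy
    have hz : S.up^[S.w] y ∈ range S.up^[S.w - 1] := by
      refine ⟨S.up y, ?_⟩
      rw [← Function.iterate_succ_apply, show (S.w - 1).succ = S.w by omega]
    refine ⟨η + S.up^[S.w] y, ?_, ?_⟩
    · show S.dig (η + S.up^[S.w] y) = η
      have h1 := S.dig_add (u := η) (z := S.up^[S.w - 1] y) ⟨y, rfl⟩
      rw [← Function.iterate_succ_apply' S.up, show (S.w - 1).succ = S.w by omega, S.dig_digit hη] at h1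
      exact h1
    · rw [tile_add S hz]
      refine ⟨c, hc, ?_⟩
      simp only [coe_up_iterate, hy, map_sub, app_app_neg, sub_add_cancel]

theorem frac_mem_W_iff {η : S.Λ} (hη : (η : Fin n → ℝ) ∈ S.D) (hη0 : η ≠ 0) {x : Fin n → ℝ} :
    S.frac x ∈ S.W η ↔ S.app S.w x ∈ S.digitSet η := by
  rw [S.mem_digitSet_iff hη hη0, W]
  constructor
  · rintro ⟨c, hc, h⟩
    exact ⟨c, hc, S.frac_eq_frac_iff.1 h.symm⟩
  · rintro ⟨c, hc, h⟩
    exact ⟨c, hc, (S.frac_eq_frac_iff.2 h).symm⟩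

/-- The lattice periodic extension of the characteristic set. -/
def perSet (η : S.Λ) : Set (Fin n → ℝ) := S.app (-S.w) '' S.digitSet η

theorem measurableSet_perSet (η : S.Λ) : MeasurableSet (S.perSet η) :=
  (S.app (-S.w)).toHomeomorph.measurableEmbedding.measurableSet_image.2 (S.measurableSet_digitSet η)

theorem mem_perSet_iff {η : S.Λ} (hη : (η : Fin n → ℝ) ∈ S.D) (hη0 : η ≠ 0) {x : Fin n → ℝ} :
    x ∈ S.perSet η ↔ ∃ c ∈ S.charSet η, x - c ∈ S.Λ := by
  rw [← S.mem_digitSet_iff hη hη0, perSet, mem_app_image, neg_neg]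

/-- A point of `T` outside `T'` also lies in another translate of `T`, hence in `frontier T`. -/
theorem restricted_ae_eq : S.T' =ᵐ[volume] S.T := by
  refine (ae_eq_set).2 ⟨by rw [Set.sdiff_eq_empty.2 S.restricted_subset, measure_empty], ?_⟩
  refine measure_mono_null ?_ S.tile_frontier
  rintro x ⟨hxT, hxT'⟩
  have h1 := S.sub_frac_mem x
  refine S.tile_inter (x - S.frac x) h1 (fun h => ?_) ⟨hxT, S.frac x, S.restricted_subset (S.frac_mem x),
    by simp⟩
  rw [sub_eq_zero] at h
  exact hxT' (h ▸ S.frac_mem x)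

theorem W_eq {η : S.Λ} (hη : (η : Fin n → ℝ) ∈ S.D) (hη0 : η ≠ 0) :
    S.W η = S.T' ∩ S.perSet η := by
  ext x
  rw [mem_inter_iff, S.mem_perSet_iff hη hη0]
  constructor
  · rintro ⟨c, hc, rfl⟩
    refine ⟨S.frac_mem c, c, hc, ?_⟩
    have := S.Λ.neg_mem (S.sub_frac_mem c)
    simpa using this
  · rintro ⟨hx, c, hc, h⟩
    refine ⟨c, hc, ?_⟩
    refine S.frac_eq_of hx ?_
    have := S.Λ.neg_mem h
    simpa using this

/-- The volume of the periodic set within a cell. -/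
theorem volume_T_inter_perSet {η : S.Λ} (hη : (η : Fin n → ℝ) ∈ S.D) (hη0 : η ≠ 0) :
    volume (S.T ∩ S.perSet η) = volume (S.charSet η) := by
  have hm : ∀ z : S.Λ, MeasurableSet ((fun x => (z : Fin n → ℝ) + x) '' S.charSet η) := by
    intro z
    rw [S.charSet_eq hη hη0]
    refine (Homeomorph.addLeft (z : Fin n → ℝ)).measurableEmbedding.measurableSet_image.2 ?_
    exact (S.app (-S.w)).toHomeomorph.measurableEmbedding.measurableSet_image.2 (S.measurableSet_tile η)
  have hmc : MeasurableSet (S.charSet η) := by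
    rw [S.charSet_eq hη hη0]
    exact (S.app (-S.w)).toHomeomorph.measurableEmbedding.measurableSet_image.2 (S.measurableSet_tile η)
  have htrans : ∀ z : S.Λ, (fun x => (z : Fin n → ℝ) + x) '' S.charSet η =
      S.app (-S.w) '' S.tile (η + S.up^[S.w] z) := by
    intro z
    have hz : S.up^[S.w] z ∈ range S.up^[S.w - 1] := by
      refine ⟨S.up z, ?_⟩
      rw [← Function.iterate_succ_apply, show (S.w - 1).succ = S.w by have := S.w_pos; omega]
    rw [tile_add S hz, S.charSet_eq hη hη0, Set.image_image, Set.image_image]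
    refine Set.image_congr fun x _ => ?_
    rw [map_add, coe_up_iterate, app_neg_app]
  -- `T ∩ perSet η` is cut along the translates of `charSet η`, and `charSet η` along the cells.
  have hunion : S.T ∩ S.perSet η = ⋃ z : S.Λ, S.T ∩ (fun x => (z : Fin n → ℝ) + x) '' S.charSet η := by
    ext x
    rw [mem_inter_iff, S.mem_perSet_iff hη hη0, mem_iUnion]
    constructor
    · rintro ⟨hx, c, hc, h⟩
      exact ⟨⟨_, h⟩, hx, c, hc, by simp⟩
    · rintro ⟨z, hx, c, hc, rfl⟩
      exact ⟨hx, c, hc, by simp⟩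
  have hdisj : Pairwise (Function.onFun (AEDisjoint volume) fun z : S.Λ =>
      S.T ∩ (fun x => (z : Fin n → ℝ) + x) '' S.charSet η) := by
    intro z z' hzz
    refine AEDisjoint.mono (s := S.app (-S.w) '' S.tile (η + S.up^[S.w] z))
      (t := S.app (-S.w) '' S.tile (η + S.up^[S.w] z')) ?_ (by rw [← htrans]; exact inter_subset_right)
      (by rw [← htrans]; exact inter_subset_right)
    have hne : η + S.up^[S.w] z ≠ η + S.up^[S.w] z' := fun h =>
      hzz ((S.up_injective.iterate S.w) (add_left_cancel h))
    rw [AEDisjoint, ← Set.image_inter (S.app (-S.w)).injective, volume_app_image,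
      S.aedisjoint_tile hne, mul_zero]
  have hcells : S.charSet η = ⋃ z : S.Λ, S.charSet η ∩ S.cell (-z : S.Λ) := by
    ext x
    rw [mem_iUnion]
    constructor
    · intro hx
      obtain ⟨u, hu⟩ := S.exists_mem_cell x
      exact ⟨-u, hx, by simpa using hu⟩
    · rintro ⟨z, hx, -⟩
      exact hx
  have hdisj2 : Pairwise (Function.onFun (AEDisjoint volume) fun z : S.Λ =>
      S.charSet η ∩ S.cell (-z : S.Λ)) := by
    intro z z' hzz
    exact (S.aedisjoint_cell (fun h => hzz (neg_injective h))).mono inter_subset_right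
      inter_subset_right
  rw [hunion, measure_iUnion₀ hdisj fun z => (S.tile_closed.measurableSet.inter (hm z)).nullMeasurableSet]
  conv_rhs => rw [hcells]
  rw [measure_iUnion₀ hdisj2 fun z => (hmc.inter (S.measurableSet_cell _)).nullMeasurableSet]
  -- The two pieces with index `z` are translates of each other by `z`.
  refine tsum_congr fun z => ?_
  rw [← volume_translate (z : Fin n → ℝ) (S.charSet η ∩ S.cell (-z : S.Λ))]
  congr 1
  ext x
  constructor
  · rintro ⟨hx, c, hc, rfl⟩
    refine ⟨c, ⟨hc, ?_⟩, rfl⟩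
    rw [mem_cell]
    simpa [add_comm] using hx
  · rintro ⟨c, ⟨hc, hcell⟩, rfl⟩
    rw [mem_cell] at hcell
    exact ⟨by simpa [add_comm] using hcell, c, hc, rfl⟩

theorem volume_W {η : S.Λ} (hη : (η : Fin n → ℝ) ∈ S.D) (hη0 : η ≠ 0) :
    volume.real (S.W η) = S.dΛ * S.E := by
  rw [S.W_eq hη hη0, measureReal_def,
    measure_congr (S.restricted_ae_eq.inter (ae_eq_refl (S.perSet η))),
    S.volume_T_inter_perSet hη hη0, ← measureReal_def, S.volume_charSet hη hη0,
    S.κ_div (S.digit_notMem_range hη hη0)]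

theorem volume_cell_inter_perSet {η : S.Λ} (hη : (η : Fin n → ℝ) ∈ S.D) (hη0 : η ≠ 0) (u : S.Λ) :
    volume.real (S.cell u ∩ S.perSet η) = S.dΛ * S.E := by
  have h : S.cell u ∩ S.perSet η = (fun x => (u : Fin n → ℝ) + x) '' (S.T ∩ S.perSet η) := by
    ext x
    constructor
    · rintro ⟨⟨t, ht, rfl⟩, hx⟩
      refine ⟨t, ⟨ht, ?_⟩, rfl⟩
      rw [S.mem_perSet_iff hη hη0] at hx ⊢
      obtain ⟨c, hc, h⟩ := hx
      refine ⟨c, hc, ?_⟩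
      have := S.Λ.sub_mem h u.2
      rwa [show (u : Fin n → ℝ) + t - c - u = t - c by abel] at this
    · rintro ⟨t, ⟨ht, hx⟩, rfl⟩
      refine ⟨⟨t, ht, rfl⟩, ?_⟩
      rw [S.mem_perSet_iff hη hη0] at hx ⊢
      obtain ⟨c, hc, h⟩ := hx
      refine ⟨c, hc, ?_⟩
      have := S.Λ.add_mem u.2 h
      rwa [show (u : Fin n → ℝ) + (t - c) = u + t - c by abel] at this
  rw [measureReal_def, h, volume_translate, S.volume_T_inter_perSet hη hη0, ← measureReal_def,
    S.volume_charSet hη hη0, S.κ_div (S.digit_notMem_range hη hη0)]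


/-! ### Lower bounds in terms of the leading digit. -/

/-- The least norm of a lattice point plus a point of the tile, up to the maximal tail. -/
theorem expansion_margin_pos : 0 < S.r - S.R / (S.ρ ^ S.w - 1) := by
  have h := S.one_lt_rho_pow
  rw [sub_pos, div_lt_iff₀ (by linarith)]
  exact S.R_lt

/-- Follow the digits of `x` after the non-zero digit of `v`: either the next non-zero digit comes
at distance `i ≥ w`, or the first `m` digits are zero. -/
theorem mem_tile_digit_cases {x : Fin n → ℝ} {v : S.Λ} (hx : x ∈ S.tile v) (hv : v ∉ range S.up)
    (m : ℕ) : (∃ i : ℕ, S.w ≤ i ∧ ∃ u : S.Λ, S.dig u ≠ 0 ∧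
      (u : Fin n → ℝ) = S.app i v + S.dig u ∧ S.app i x ∈ S.tile u) ∨
      S.app m x ∈ S.tile (S.up^[m] v) := by
  induction m with
  | zero => exact Or.inr (by simpa using hx)
  | succ m ih =>
    rcases ih with h | h
    · exact Or.inl h
    obtain ⟨u, hu, hxu⟩ := S.exists_mem_tile_of_par h
    rw [← S.app_add, add_comm, ← Nat.cast_succ] at hxu
    by_cases hd : S.dig u = 0
    · obtain ⟨t, rfl⟩ := S.dig_eq_zero_iff.1 hd
      rw [S.par_up] at hu
      subst hu
      rw [Function.iterate_succ_apply']
      exact Or.inr hxu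
    · refine Or.inl ⟨m + 1, ?_, u, hd, ?_, hxu⟩
      · by_contra! hlt
        have hr := S.par_mem_range hd
        rw [hu] at hr
        obtain ⟨y, hy⟩ := hr
        obtain ⟨k, hk⟩ : ∃ k, S.w - 1 = m + (k + 1) := ⟨S.w - 1 - m - 1, by omega⟩
        rw [hk, Function.iterate_add_apply] at hy
        have := (S.up_injective.iterate m) hy
        rw [Function.iterate_succ_apply'] at this
        exact hv ⟨_, this⟩
      · have h1 := S.coe_eq_par u
        rw [hu, S.coe_up_iterate, ← S.app_add, add_comm (1 : ℤ), ← Nat.cast_succ] at h1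
        exact h1

/-- `c = ρ^w R / (ρ^w - 1)` is the fixed point of `c ↦ (c + ρ^w R) / ρ^w`, which bounds a tail by
the tail after its first non-zero digit. Every such jump shrinks the remaining error by at least
`ρ^w`. -/
theorem nrm_sub_le_add_geometric (k : ℕ) {x : Fin n → ℝ} {v : S.Λ} (hx : x ∈ S.tile v)
    (hv : v ∉ range S.up) :
    S.nrm (x - v) ≤ S.ρ ^ S.w * (S.R / (S.ρ ^ S.w - 1)) + S.rad * ((S.ρ ^ S.w)⁻¹) ^ k := by
  have hρ := S.rho_pos
  have h1 := S.one_lt_rho_pow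
  have h1' : 0 < S.ρ ^ S.w - 1 := by linarith
  have hR := S.R_pos
  have hrad := S.rad_pos
  have hpos : 0 < S.ρ ^ S.w := by positivity
  induction k generalizing x v with
  | zero =>
    have := S.mem_ball.1 (S.tile_subset_ball v hx)
    have h0 : 0 ≤ S.ρ ^ S.w * (S.R / (S.ρ ^ S.w - 1)) := by positivity
    simp only [pow_zero, mul_one]
    linarith
  | succ k ih =>
    rcases S.mem_tile_digit_cases hx hv (S.w * (k + 1)) with ⟨i, hi, u, hu, hua, hxu⟩ | h
    · have h2 := ih hxu (fun h => hu (S.dig_eq_zero_iff.2 h))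
      have h3 : S.app i (x - v) = (S.app i x - u) + S.dig u := by
        rw [hua, map_sub]; abel
      have h4 := congrArg S.nrm h3
      rw [S.nrm_app_nat] at h4
      have h5 := map_add_le_add S.nrm (S.app i x - u) (S.dig u)
      have h6 := S.nrm_digit_le' (S.dig_mem u)
      have h7 : S.ρ ^ S.w * S.nrm (x - v) ≤ S.ρ ^ i * S.nrm (x - v) := by
        have := apply_nonneg S.nrm (x - v)
        have := pow_le_pow_right₀ S.one_lt_rho.le hi
        gcongr
      have h8 : S.ρ ^ S.w * S.nrm (x - v) ≤ S.ρ ^ S.w * (S.ρ ^ S.w * (S.R / (S.ρ ^ S.w - 1)) +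
          S.rad * ((S.ρ ^ S.w)⁻¹) ^ (k + 1)) := by
        have e1 : S.ρ ^ S.w * (S.ρ ^ S.w * (S.R / (S.ρ ^ S.w - 1))) =
            S.ρ ^ S.w * (S.R / (S.ρ ^ S.w - 1)) + S.ρ ^ S.w * S.R := by
          field_simp; ring
        have e2 : S.ρ ^ S.w * (S.rad * ((S.ρ ^ S.w)⁻¹) ^ (k + 1)) =
            S.rad * ((S.ρ ^ S.w)⁻¹) ^ k := by
          rw [pow_succ]; field_simp
        rw [mul_add, e1, e2]
        linarith
      exact le_of_mul_le_mul_left h8 hpos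
    · have h2 := S.mem_ball.1 (S.tile_subset_ball _ h)
      rw [S.coe_up_iterate, ← map_sub, S.nrm_app_nat, pow_mul] at h2
      have h0 : 0 ≤ S.ρ ^ S.w * (S.R / (S.ρ ^ S.w - 1)) := by positivity
      have h3 : S.nrm (x - v) ≤ S.rad * ((S.ρ ^ S.w)⁻¹) ^ (k + 1) := by
        rw [inv_pow, ← div_eq_mul_inv, le_div_iff₀ (by positivity), mul_comm]
        exact h2
      linarith

theorem nrm_sub_le_of_mem_tile {x : Fin n → ℝ} {v : S.Λ} (hx : x ∈ S.tile v)
    (hv : v ∉ range S.up) : S.nrm (x - v) ≤ S.ρ ^ S.w * (S.R / (S.ρ ^ S.w - 1)) := by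
  have h1 := S.one_lt_rho_pow
  have ht : Tendsto (fun k : ℕ => S.ρ ^ S.w * (S.R / (S.ρ ^ S.w - 1)) +
      S.rad * ((S.ρ ^ S.w)⁻¹) ^ k) atTop
      (𝓝 (S.ρ ^ S.w * (S.R / (S.ρ ^ S.w - 1)) + S.rad * 0)) :=
    ((tendsto_pow_atTop_nhds_zero_of_lt_one (by positivity)
      (inv_lt_one_of_one_lt₀ h1)).const_mul _).const_add _
  rw [mul_zero, add_zero] at ht
  exact ge_of_tendsto' ht fun k => S.nrm_sub_le_add_geometric k hx hv

theorem eq_of_forall_mem_tile_up {x : Fin n → ℝ} {v : S.Λ}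
    (h : ∀ m : ℕ, S.app m x ∈ S.tile (S.up^[m] v)) : x = v := by
  have h1 : ∀ m : ℕ, S.nrm (x - v) ≤ S.rad * (S.ρ⁻¹) ^ m := by
    intro m
    have h2 := S.mem_ball.1 (S.tile_subset_ball _ (h m))
    rw [S.coe_up_iterate, ← map_sub, S.nrm_app_nat] at h2
    rw [inv_pow, ← div_eq_mul_inv, le_div_iff₀ (pow_pos S.rho_pos m), mul_comm]
    exact h2
  have ht : Tendsto (fun k : ℕ => S.rad * (S.ρ⁻¹) ^ k) atTop (𝓝 (S.rad * 0)) :=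
    (tendsto_pow_atTop_nhds_zero_of_lt_one (inv_nonneg.2 S.rho_pos.le)
      (inv_lt_one_of_one_lt₀ S.one_lt_rho)).const_mul _
  rw [mul_zero] at ht
  have h3 := ge_of_tendsto' ht h1
  exact sub_eq_zero.1 (S.nrm_definite _ (le_antisymm h3 (apply_nonneg _ _)))

theorem r_le_nrm_add {u : S.Λ} {t : Fin n → ℝ} (ht : t ∈ S.T) (hu : u ≠ 0) :
    S.r ≤ S.nrm (u + t) := by
  by_contra! h
  exact hu (S.eq_zero_of_nrm_lt ht h)

theorem app_neg_mem_T (h : S.app (-1) '' S.T ⊆ S.T) (k : ℕ) {x : Fin n → ℝ} (hx : x ∈ S.T) :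
    S.app (-k) x ∈ S.T := by
  induction k with
  | zero => simpa using hx
  | succ k ih =>
    have := h ⟨_, ih, rfl⟩
    rw [← S.app_add] at this
    convert this using 2
    congr 1
    push_cast
    ring

/-- The admissible lower bounds for the norm of a value with leading digit at position zero. -/
def IsLowerBound (BL : ℝ) : Prop :=
  (S.act (-1) S.T ⊆ S.T ∧ BL = S.r - S.R / (S.ρ ^ S.w - 1)) ∨
    BL = (S.r - S.R / (S.ρ ^ S.w - 1)) / S.ρ ^ (S.w - 1)

variable {S} in
theorem IsLowerBound.pos {BL : ℝ} (h : S.IsLowerBound BL) : 0 < BL := by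
  have h1 := S.expansion_margin_pos
  have := S.rho_pos
  rcases h with ⟨-, rfl⟩ | rfl
  · exact h1
  · positivity

variable {S} in
theorem IsLowerBound.le {BL : ℝ} (h : S.IsLowerBound BL) :
    BL ≤ S.r - S.R / (S.ρ ^ S.w - 1) := by
  rcases h with ⟨-, rfl⟩ | rfl
  · exact le_rfl
  · exact div_le_self S.expansion_margin_pos.le (one_le_pow₀ S.one_lt_rho.le)

-- Let the next non-zero digit `a` of `x` have distance `k + w`. Then `Φ^k x` is `Φ^k v + Φ^(-w) a`
-- plus a tail of norm at most `R / (ρ^w - 1)`, and a non-zero lattice point plus a point of `T` has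
-- norm at least `r`. For `k ≤ w - 1` division by `ρ^k` costs at most `ρ^(w-1)`; for `k ≥ w` already
-- `‖x - v‖ ≤ R / (ρ^w - 1)`. If `Φ⁻¹ T ⊆ T`, the term `Φ^(-k) Φ^(-w) a` stays in `T` and nothing is
-- lost.
variable {S} in
theorem IsLowerBound.le_nrm {BL : ℝ} (h : S.IsLowerBound BL) {v : S.Λ}
    (hvD : (v : Fin n → ℝ) ∈ S.D) (hv0 : v ≠ 0) {x : Fin n → ℝ} (hx : x ∈ S.tile v) :
    BL ≤ S.nrm x := by
  have hv := S.digit_notMem_range hvD hv0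
  have hρ := S.rho_pos
  have hpos := S.expansion_margin_pos
  have h1 := S.one_lt_rho_pow
  have h1' : 0 < S.ρ ^ S.w - 1 := by linarith
  have hR := S.R_pos
  have hε : 0 < S.R / (S.ρ ^ S.w - 1) := by positivity
  by_cases hall : ∀ m : ℕ, S.app m x ∈ S.tile (S.up^[m] v)
  · rw [S.eq_of_forall_mem_tile_up hall]
    have := S.r_le_nrm hv0
    linarith [h.le]
  push Not at hall
  obtain ⟨m, hm⟩ := hall
  obtain ⟨i, hi, u, hu, hua, hxu⟩ := (S.mem_tile_digit_cases hx hv m).resolve_right hm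
  have htail := S.nrm_sub_le_of_mem_tile hxu (fun h => hu (S.dig_eq_zero_iff.2 h))
  obtain ⟨k, rfl⟩ : ∃ k, i = k + S.w := ⟨i - S.w, by omega⟩
  have hT := S.app_digit_mem (S.dig_mem u)
  set e := S.app ((k + S.w : ℕ) : ℤ) x - u with he
  have hx1 : S.app k x = (S.app k v + S.app (-S.w) (S.dig u)) + S.app (-S.w) e := by
    have h2 : S.app ((k + S.w : ℕ) : ℤ) x = S.app ((k + S.w : ℕ) : ℤ) v + S.dig u + e := by
      rw [he, ← hua]; abel
    have h3 := congrArg (S.app (-S.w)) h2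
    rw [map_add, map_add, ← S.app_add, ← S.app_add] at h3
    rwa [show (-(S.w : ℤ) + ((k + S.w : ℕ) : ℤ)) = k by push_cast; ring] at h3
  have he1 : S.nrm (S.app (-S.w) e) ≤ S.R / (S.ρ ^ S.w - 1) := by
    rw [S.nrm_app, zpow_neg, zpow_natCast, inv_mul_le_iff₀ (by positivity)]
    exact htail
  have hsub : ∀ a b : Fin n → ℝ, S.nrm a - S.nrm b ≤ S.nrm (a + b) := by
    intro a b
    have := map_add_le_add S.nrm (a + b) (-b)
    rw [add_neg_cancel_right, map_neg_eq_map] at this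
    linarith
  rcases h with ⟨hmap, rfl⟩ | rfl
  · have hx2 : x = (v + S.app (-k) (S.app (-S.w) (S.dig u))) + S.app (-k) (S.app (-S.w) e) := by
      have := congrArg (S.app (-k)) hx1
      simpa [map_add] using this
    have h2 := S.r_le_nrm_add (S.app_neg_mem_T hmap k hT) hv0
    have h3 : S.nrm (S.app (-k) (S.app (-S.w) e)) ≤ S.R / (S.ρ ^ S.w - 1) := by
      rw [S.nrm_app, zpow_neg, zpow_natCast]
      refine le_trans (mul_le_of_le_one_left (apply_nonneg _ _) ?_) he1
      exact inv_le_one_of_one_le₀ (one_le_pow₀ S.one_lt_rho.le)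
    rw [hx2]
    linarith [hsub (v + S.app (-k) (S.app (-S.w) (S.dig u))) (S.app (-k) (S.app (-S.w) e))]
  · by_cases hk : k ≤ S.w - 1
    · have hne : S.up^[k] v ≠ 0 := by
        intro h0
        rw [← S.up_iterate_zero k] at h0
        exact hv0 (S.up_injective.iterate k h0)
      have h2 := S.r_le_nrm_add hT hne
      rw [S.coe_up_iterate] at h2
      have h3 : S.r - S.R / (S.ρ ^ S.w - 1) ≤ S.ρ ^ k * S.nrm x := by
        rw [← S.nrm_app_nat, hx1]
        linarith [hsub (S.app k v + S.app (-S.w) (S.dig u)) (S.app (-S.w) e)]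
      rw [div_le_iff₀ (by positivity), mul_comm]
      refine h3.trans ?_
      have := apply_nonneg S.nrm x
      have := pow_le_pow_right₀ S.one_lt_rho.le hk
      gcongr
    · have h2 : S.app k (x - v) = S.app (-S.w) (S.dig u) + S.app (-S.w) e := by
        rw [map_sub, hx1]; abel
      have h3 := congrArg S.nrm h2
      rw [S.nrm_app_nat] at h3
      have h4 := map_add_le_add S.nrm (S.app (-S.w) (S.dig u)) (S.app (-S.w) e)
      have h5 := S.nrm_digit_le (S.dig_mem u)
      have h6 : S.ρ ^ S.w * S.nrm (x - v) ≤ S.ρ ^ k * S.nrm (x - v) := by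
        have := apply_nonneg S.nrm (x - v)
        have := pow_le_pow_right₀ S.one_lt_rho.le (show S.w ≤ k by omega)
        gcongr
      have h7 : S.ρ ^ S.w * S.nrm (x - v) ≤ S.ρ ^ S.w * (S.R / (S.ρ ^ S.w - 1)) := by
        have : S.ρ ^ S.w * (S.R / (S.ρ ^ S.w - 1)) = S.R + S.R / (S.ρ ^ S.w - 1) := by
          field_simp; ring
        linarith
      have h8 := le_of_mul_le_mul_left h7 (by positivity)
      have h9 := hsub v (x - v)
      rw [add_sub_cancel] at h9
      have h10 := S.r_le_nrm hv0
      refine (div_le_self hpos.le (one_le_pow₀ S.one_lt_rho.le)).trans ?_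
      linarith

-- The leading digit stands at some position `t ≥ i`; scaling by `Φ^(-t)` reduces to `le_nrm`.
variable {S} in
theorem IsLowerBound.pow_mul_le_nrm {BL : ℝ} (h : S.IsLowerBound BL) {u : S.Λ} {i : ℕ}
    (hi : S.dig (S.par^[i] u) ≠ 0) {y : Fin n → ℝ} (hy : y ∈ S.tile u) :
    S.ρ ^ i * BL ≤ S.nrm y := by
  classical
  have hex := S.exists_par_iterate_eq_zero u
  set s := Nat.find hex with hs
  have hs0 : S.par^[s] u = 0 := Nat.find_spec hex
  have his : i < s := by
    by_contra! hle
    obtain ⟨k, rfl⟩ := Nat.exists_eq_add_of_le' hle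
    rw [Function.iterate_add_apply, hs0, S.par_iterate_zero] at hi
    exact hi S.dig_zero
  obtain ⟨t, ht⟩ : ∃ t, s = t + 1 := ⟨s - 1, by omega⟩
  have hv0 : S.par^[t] u ≠ 0 := Nat.find_min hex (by omega)
  rw [ht, Function.iterate_succ_apply'] at hs0
  have hvD : ((S.par^[t] u : S.Λ) : Fin n → ℝ) ∈ S.D := by
    rw [S.coe_eq_par, hs0]
    simpa using S.dig_mem _
  have hmem : S.app (-t) y ∈ S.tile (S.par^[t] u) := by
    rw [← S.mem_app_image (j := (t : ℤ)), S.app_image_tile]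
    exact mem_biUnion (show u ∈ _ by simp) hy
  have h1 := h.le_nrm hvD hv0 hmem
  rw [S.nrm_app, zpow_neg, zpow_natCast, le_inv_mul_iff₀ (pow_pos S.rho_pos t)] at h1
  refine le_trans ?_ h1
  have := h.pos
  have := pow_le_pow_right₀ S.one_lt_rho.le (show i ≤ t by omega)
  gcongr


/-! ### Discrepancies and the integrals of the fluctuation. -/

theorem E_nonneg : 0 ≤ S.E := by
  have h := S.one_lt_q
  have := S.rho_pos
  rw [E]
  rw [q] at h
  have : 0 ≤ S.ρ ^ n - 1 := by linarith
  positivity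

theorem E_le_one {η : S.Λ} (hη : (η : Fin n → ℝ) ∈ S.D) (hη0 : η ≠ 0) : S.E ≤ 1 := by
  have h1 := S.volume_cell_inter_perSet hη hη0 0
  have h2 : volume.real (S.cell (0 : S.Λ) ∩ S.perSet η) ≤ volume.real (S.cell (0 : S.Λ)) :=
    measureReal_mono inter_subset_left (by rw [volume_cell]; exact S.volume_T_lt_top.ne)
  rw [h1, volumeReal_cell] at h2
  exact le_of_mul_le_mul_left (by linarith) S.dΛ_pos

/-- The excess of the volume of a periodic set inside a region over its expected value. -/
def excess (η : S.Λ) (B : Set (Fin n → ℝ)) : ℝ :=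
  volume.real (B ∩ S.perSet η) - S.E * volume.real B

theorem abs_excess_le {η : S.Λ} (hη : (η : Fin n → ℝ) ∈ S.D) (hη0 : η ≠ 0)
    {B : Set (Fin n → ℝ)} (hB : volume B ≠ ⊤) : |S.excess η B| ≤ volume.real B := by
  have h1 : volume.real (B ∩ S.perSet η) ≤ volume.real B := measureReal_mono inter_subset_left hB
  have h2 : 0 ≤ volume.real (B ∩ S.perSet η) := measureReal_nonneg
  have h3 : 0 ≤ volume.real B := measureReal_nonneg
  have h4 := mul_le_of_le_one_left h3 (S.E_le_one hη hη0)
  have h5 := mul_nonneg S.E_nonneg h3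
  rw [excess, abs_le]
  constructor <;> linarith

theorem finite_cell_subset {B : Set (Fin n → ℝ)} {X : ℝ} (hB : B ⊆ S.ball 0 X) :
    {u : S.Λ | S.cell u ⊆ B}.Finite := by
  refine (S.finite_lattice_ball 0 X).subset fun u hu => hB (hu ?_)
  exact S.mem_cell.2 (by simpa using S.zero_mem_T)

theorem floorV_eq {B : Set (Fin n → ℝ)} {X : ℝ} (hB : B ⊆ S.ball 0 X) :
    S.floorV B = ⋃ u ∈ (S.finite_cell_subset hB).toFinset, S.cell u := by
  ext x
  simp only [floorV, mem_iUnion, exists_prop, Set.Finite.mem_toFinset, Set.mem_ofPred_eq]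
  constructor
  · rintro ⟨z, ⟨hz, hzB⟩, hx⟩
    exact ⟨⟨z, hz⟩, hzB, hx⟩
  · rintro ⟨u, hu, hx⟩
    exact ⟨u, ⟨u.2, hu⟩, hx⟩

theorem floorV_subset (B : Set (Fin n → ℝ)) : S.floorV B ⊆ B := iUnion₂_subset fun _ hz => hz.2

theorem measurableSet_floorV {B : Set (Fin n → ℝ)} {X : ℝ} (hB : B ⊆ S.ball 0 X) :
    MeasurableSet (S.floorV B) := by
  rw [S.floorV_eq hB]
  exact Finset.measurableSet_biUnion _ fun u _ => S.measurableSet_cell u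

theorem volume_ne_top_of_subset_ball {B : Set (Fin n → ℝ)} {X : ℝ} (hB : B ⊆ S.ball 0 X) :
    volume B ≠ ⊤ := ((measure_mono hB).trans_lt (S.volume_ball_lt_top _ _)).ne

theorem volumeReal_fracV_inter {B : Set (Fin n → ℝ)} {X : ℝ} (hB : B ⊆ S.ball 0 X)
    {A : Set (Fin n → ℝ)} (hA : MeasurableSet A) {c : ℝ}
    (hc : ∀ u : S.Λ, volume.real (S.cell u ∩ A) = c) :
    volume.real (S.fracV B ∩ A) =
      volume.real (B ∩ A) - (S.finite_cell_subset hB).toFinset.card * c := by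
  have h1 : S.fracV B ∩ A = (B ∩ A) \ (S.floorV B ∩ A) := by
    ext x
    simp only [fracV, mem_inter_iff, Set.mem_sdiff]
    tauto
  have h2 : volume.real (S.floorV B ∩ A) = (S.finite_cell_subset hB).toFinset.card * c := by
    rw [S.floorV_eq hB, iUnion₂_inter, measureReal_biUnion_finset₀
      (fun u _ v _ huv => (S.aedisjoint_cell huv).mono inter_subset_left inter_subset_left)
      (fun u _ => ((S.measurableSet_cell u).inter hA).nullMeasurableSet)
      (fun u _ => ne_top_of_le_ne_top (by rw [volume_cell]; exact S.volume_T_lt_top.ne)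
        (measure_mono inter_subset_left : _ ≤ volume (S.cell u)))]
    simp [hc]
  have hfin : volume (B ∩ A) ≠ ⊤ :=
    ne_top_of_le_ne_top (S.volume_ne_top_of_subset_ball hB) (measure_mono inter_subset_left)
  rw [h1, measureReal_sdiff (inter_subset_inter_left _ (S.floorV_subset B))
    ((S.measurableSet_floorV hB).inter hA) hfin, h2]

/-- Every complete cell contains exactly the expected share of the periodic set, so only the
fractional cells contribute to the excess. -/
theorem excess_fracV {η : S.Λ} (hη : (η : Fin n → ℝ) ∈ S.D) (hη0 : η ≠ 0)
    {B : Set (Fin n → ℝ)} {X : ℝ} (hB : B ⊆ S.ball 0 X) :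
    S.excess η (S.fracV B) = S.excess η B := by
  have h1 := S.volumeReal_fracV_inter hB (S.measurableSet_perSet η)
    (S.volume_cell_inter_perSet hη hη0)
  have h2 := S.volumeReal_fracV_inter hB MeasurableSet.univ
    (c := S.dΛ) (fun u => by rw [inter_univ, volumeReal_cell])
  rw [inter_univ, inter_univ] at h2
  rw [excess, excess, h1, h2]
  ring

theorem volume_fracV_le {B : Set (Fin n → ℝ)} {X : ℝ} (hB : B ⊆ S.ball 0 X) :
    volume.real (S.fracV B) ≤ S.dΛ * (S.mixed S.R B).ncard := by
  have hfin := S.finite_mixed S.R hB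
  have hsub : S.fracV B ⊆ ⋃ u ∈ hfin.toFinset, S.cell u := by
    rintro x ⟨hx, hxf⟩
    obtain ⟨u, hu⟩ := S.exists_mem_cell x
    refine mem_biUnion (x := u) ?_ hu
    rw [Finset.mem_coe, Set.Finite.mem_toFinset]
    refine ⟨⟨x, hx, S.cell_subset_ball u hu⟩, ?_⟩
    have : ¬ S.cell u ⊆ B := fun h => hxf (mem_biUnion (x := (u : Fin n → ℝ)) ⟨u.2, h⟩ hu)
    obtain ⟨y, hy, hyB⟩ := not_subset.1 this
    exact ⟨y, hyB, S.cell_subset_ball u hy⟩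
  calc volume.real (S.fracV B) ≤ volume.real (⋃ u ∈ hfin.toFinset, S.cell u) := by
        refine measureReal_mono hsub (ne_of_lt ?_)
        exact (measure_biUnion_lt_top hfin.toFinset.finite_toSet fun u _ => by
          rw [volume_cell]; exact S.volume_T_lt_top)
    _ ≤ ∑ u ∈ hfin.toFinset, volume.real (S.cell u) := measureReal_biUnion_finset_le _ _
    _ = S.dΛ * (S.mixed S.R B).ncard := by
        simp only [volumeReal_cell, Finset.sum_const, nsmul_eq_mul]
        rw [Set.ncard_eq_toFinset_card _ hfin, mul_comm]

theorem abs_excess_le_mixed {η : S.Λ} (hη : (η : Fin n → ℝ) ∈ S.D) (hη0 : η ≠ 0)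
    {B : Set (Fin n → ℝ)} {X : ℝ} (hB : B ⊆ S.ball 0 X) :
    |S.excess η B| ≤ S.dΛ * (S.mixed S.R B).ncard := by
  rw [← S.excess_fracV hη hη0 hB]
  refine (S.abs_excess_le hη hη0 (ne_top_of_le_ne_top (S.volume_ne_top_of_subset_ball hB)
    (measure_mono Set.sdiff_subset))).trans (S.volume_fracV_le hB)

theorem integrand_eq {η : S.Λ} (hη : (η : Fin n → ℝ) ∈ S.D) (hη0 : η ≠ 0) (j : ℕ) :
    S.integrand η j = fun y => (S.app (j - S.w) ⁻¹' S.perSet η).indicator 1 y - S.E := by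
  funext y
  rw [integrand, S.volume_W hη hη0, mul_div_cancel_left₀ _ S.dΛ_pos.ne', ← app_apply]
  congr 1
  by_cases h : S.app (j - S.w) y ∈ S.perSet η
  · have h' : S.frac (S.app (j - S.w) y) ∈ S.W η := by
      rw [S.frac_mem_W_iff hη hη0]
      rwa [perSet, mem_app_image, neg_neg] at h
    rw [indicator_of_mem h', indicator_of_mem (show y ∈ S.app (j - S.w) ⁻¹' S.perSet η from h)]
    rfl
  · have h' : S.frac (S.app (j - S.w) y) ∉ S.W η := by
      rw [S.frac_mem_W_iff hη hη0]
      rwa [perSet, mem_app_image, neg_neg] at h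
    rw [indicator_of_notMem h',
      indicator_of_notMem (show y ∉ S.app (j - S.w) ⁻¹' S.perSet η from h)]

theorem measurableSet_app_preimage_perSet (η : S.Λ) (j : ℤ) :
    MeasurableSet (S.app j ⁻¹' S.perSet η) :=
  (S.app j).continuous.measurable (S.measurableSet_perSet η)

theorem integrableOn_integrand {η : S.Λ} (hη : (η : Fin n → ℝ) ∈ S.D) (hη0 : η ≠ 0) (j : ℕ)
    {B : Set (Fin n → ℝ)} (hB : volume B ≠ ⊤) : IntegrableOn (S.integrand η j) B := by
  rw [S.integrand_eq hη hη0]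
  have : IsFiniteMeasure (volume.restrict B) := ⟨by simpa using lt_top_iff_ne_top.2 hB⟩
  refine Integrable.sub ?_ (integrable_const _)
  exact (integrable_const (1 : ℝ)).indicator (S.measurableSet_app_preimage_perSet η _)

theorem integral_integrand {η : S.Λ} (hη : (η : Fin n → ℝ) ∈ S.D) (hη0 : η ≠ 0) (j : ℕ)
    {A : Set (Fin n → ℝ)} (hA : volume A ≠ ⊤) :
    ∫ y in S.app (-(j - S.w)) '' A, S.integrand η j y =
      S.q ^ (-((j : ℤ) - S.w)) * S.excess η A := by
  have hB : volume (S.app (-((j : ℤ) - S.w)) '' A) ≠ ⊤ := by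
    rw [volume_app_image]
    exact ENNReal.mul_ne_top ENNReal.ofReal_ne_top hA
  have hfm : IsFiniteMeasure (volume.restrict (S.app (-((j : ℤ) - S.w)) '' A)) :=
    ⟨by simpa using lt_top_iff_ne_top.2 hB⟩
  have hm := S.measurableSet_app_preimage_perSet η ((j : ℤ) - S.w)
  rw [S.integrand_eq hη hη0, integral_sub
    (f := (S.app (j - S.w) ⁻¹' S.perSet η).indicator 1)
    ((integrable_const (1 : ℝ)).indicator hm) (integrable_const _), integral_indicator_one hm,
    integral_const, measureReal_restrict_apply hm, measureReal_restrict_apply MeasurableSet.univ,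
    univ_inter, smul_eq_mul, excess, volumeReal_app_image]
  have : S.app ((j : ℤ) - S.w) ⁻¹' S.perSet η ∩ S.app (-((j : ℤ) - S.w)) '' A =
      S.app (-((j : ℤ) - S.w)) '' (A ∩ S.perSet η) := by
    ext x
    rw [mem_inter_iff, mem_app_image, mem_app_image, neg_neg, mem_preimage, mem_inter_iff, and_comm]
  rw [this, volumeReal_app_image]
  ring

/-- The discrepancy of the digit `η` at position `i` in the region `B`. -/
def disc (η : S.Λ) (B : Set (Fin n → ℝ)) (i : ℤ) : ℝ :=
  volume.real (B ∩ S.app i '' S.digitSet η) - S.E * volume.real B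

theorem excess_app_image (η : S.Λ) (B : Set (Fin n → ℝ)) (i : ℤ) :
    S.excess η (S.app (-i - S.w) '' B) = S.q ^ (-i - S.w) * S.disc η B i := by
  have : S.app (-i - S.w) '' B ∩ S.perSet η =
      S.app (-i - S.w) '' (B ∩ S.app i '' S.digitSet η) := by
    rw [image_inter (S.app (-i - S.w)).injective, ← app_image_add, perSet,
      show -i - (S.w : ℤ) + i = -S.w by ring]
  rw [excess, this, volumeReal_app_image, volumeReal_app_image, disc]
  ring

theorem volume_region_ne_top {U : Set (Fin n → ℝ)} {d : ℝ} (hUd : U ⊆ {x | S.nrm x < d})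
    (J : ℤ) (x : ℝ) (j : ℕ) : volume (S.region U J x j) ≠ ⊤ := by
  have h := S.app_image_subset_ball (S.app_image_subset_ball
    (S.smul_subset_ball hUd (Real.rpow_nonneg S.rho_pos.le x)) (-⌊x⌋ - J)) (j - S.w)
  rw [region, fracVAt, act_eq, volume_app_image]
  exact ENNReal.mul_ne_top ENNReal.ofReal_ne_top
    (ne_top_of_le_ne_top (S.volume_ne_top_of_subset_ball h) (measure_mono Set.sdiff_subset))

/-- The `j`-th integral of `ψP` is, up to scaling, the discrepancy at position `⌊x⌋ + J - j`; the
series over `j` runs through the digit positions downwards. -/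
theorem integral_region {η : S.Λ} (hη : (η : Fin n → ℝ) ∈ S.D) (hη0 : η ≠ 0)
    {U : Set (Fin n → ℝ)} {d : ℝ} (hUd : U ⊆ {x | S.nrm x < d}) (J : ℤ) (x : ℝ) (j : ℕ) :
    ∫ y in S.region U J x j, S.integrand η j y =
      S.q ^ (-(⌊x⌋ + J)) * S.disc η (S.ρ ^ x • U) (⌊x⌋ + J - j) := by
  have h := S.app_image_subset_ball (S.app_image_subset_ball
    (S.smul_subset_ball hUd (Real.rpow_nonneg S.rho_pos.le x)) (-⌊x⌋ - J)) (j - S.w)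
  have hfin : volume (S.fracV (S.app (j - S.w) '' (S.app (-⌊x⌋ - J) '' (S.ρ ^ x • U)))) ≠ ⊤ :=
    ne_top_of_le_ne_top (S.volume_ne_top_of_subset_ball h) (measure_mono Set.sdiff_subset)
  rw [region, fracVAt, act_eq, act_eq, act_eq, S.integral_integrand hη hη0 j hfin,
    S.excess_fracV hη hη0 h, ← app_image_add,
    show (j : ℤ) - S.w + (-⌊x⌋ - J) = -(⌊x⌋ + J - j) - S.w by ring, excess_app_image,
    ← mul_assoc, ← zpow_add₀ S.q_pos.ne']
  congr 2
  ring

/-- Scaled by `Φ^(-i-w)`, the discrepancy is the excess of a periodic set, which is bounded by the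
number of cells at the boundary on that scale. -/
theorem exists_disc_bound {η : S.Λ} (hη : (η : Fin n → ℝ) ∈ S.D) (hη0 : η ≠ 0)
    {U : Set (Fin n → ℝ)} {d : ℝ} (hd : 0 < d) (hUd : U ⊆ {x | S.nrm x < d}) {δ : ℝ} (hδ0 : 0 ≤ δ)
    (hδ : (fun N : ℝ => (S.cardV (S.boundaryV (N • U)) : ℝ)) =O[atTop] fun N : ℝ => N ^ δ) :
    ∃ C : ℝ, 0 ≤ C ∧ ∀ (i : ℤ) (N : ℝ), 0 < N →
      |S.disc η (N • U) i| ≤ C * S.q ^ i * (max 1 (N * S.ρ ^ (-i))) ^ δ := by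
  obtain ⟨C, hC, h⟩ := S.exists_mixed_bound hd hUd hδ0 hδ S.R
  have hq := S.q_pos
  have hρ := S.rho_pos
  have hdΛ := S.dΛ_pos
  refine ⟨S.q ^ (S.w : ℤ) * S.dΛ * C, by positivity, fun i N hN => ?_⟩
  have h1 := S.excess_app_image η (N • U) i
  have h2 := S.abs_excess_le_mixed hη hη0 (S.app_image_subset_ball
    (S.smul_subset_ball hUd hN.le) (-i - S.w))
  rw [h1, abs_mul, abs_of_pos (zpow_pos hq _)] at h2
  have h3 := h (-i - S.w) N hN
  have h4 : (max 1 (N * S.ρ ^ (-i - S.w : ℤ))) ^ δ ≤ (max 1 (N * S.ρ ^ (-i))) ^ δ := by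
    have : S.ρ ^ (-i - S.w : ℤ) ≤ S.ρ ^ (-i) :=
      zpow_le_zpow_right₀ S.one_lt_rho.le (by omega)
    gcongr
  calc |S.disc η (N • U) i| = S.q ^ (i + S.w) * (S.q ^ (-i - S.w : ℤ) * |S.disc η (N • U) i|) := by
        rw [← mul_assoc, ← zpow_add₀ hq.ne']
        simp
    _ ≤ S.q ^ (i + S.w) * (S.dΛ * (C * (max 1 (N * S.ρ ^ (-i))) ^ δ)) := by
        refine mul_le_mul_of_nonneg_left (h2.trans ?_) (by positivity)
        exact mul_le_mul_of_nonneg_left (h3.trans (by gcongr)) hdΛ.le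
    _ = _ := by rw [zpow_add₀ hq.ne']; ring

-- `J₀` is chosen for this inequality: beyond position `⌊x⌋ + J₀` every value with that leading
-- position is too large for `ρ^x U`.
variable {S} in
theorem IsLowerBound.lt_of_floor_lt {BL : ℝ} (h : S.IsLowerBound BL) {d : ℝ} (hd : 0 < d) {x : ℝ}
    {i : ℤ} (hi : ⌊x⌋ + S.J₀ d BL < i) : S.ρ ^ x * d < S.ρ ^ i * BL := by
  have hρ := S.rho_pos
  have hBL := h.pos
  by_contra! h3
  have h4 := Real.logb_le_logb_of_le S.one_lt_rho (by positivity) h3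
  rw [Real.logb_mul (by positivity) hBL.ne', Real.logb_mul (by positivity) hd.ne',
    Real.logb_rpow hρ S.one_lt_rho.ne', ← Real.rpow_intCast,
    Real.logb_rpow hρ S.one_lt_rho.ne'] at h4
  have h5 := Int.lt_floor_add_one x
  have h6 := Int.lt_floor_add_one (Real.logb S.ρ d - Real.logb S.ρ BL)
  have h7 : (⌊x⌋ : ℝ) + (⌊Real.logb S.ρ d - Real.logb S.ρ BL⌋ + 1) + 1 ≤ i := by
    have : ⌊x⌋ + S.J₀ d BL + 1 ≤ i := hi
    rw [J₀] at this
    exact_mod_cast this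
  linarith

-- The digit set at such a position misses the region altogether, so only the expected value is
-- left.
variable {S} in
theorem IsLowerBound.disc_eq {BL : ℝ} (h : S.IsLowerBound BL) {η : S.Λ} (hη0 : η ≠ 0)
    {U : Set (Fin n → ℝ)} {d : ℝ} (hd : 0 < d) (hUd : U ⊆ {x | S.nrm x < d}) {x : ℝ} {i : ℤ}
    (hi : ⌊x⌋ + S.J₀ d BL < i) :
    S.disc η (S.ρ ^ x • U) i = -(S.E * volume.real (S.ρ ^ x • U)) := by
  have hρ := S.rho_pos
  have hBL := h.pos
  have hempty : S.ρ ^ x • U ∩ S.app i '' S.digitSet η = ∅ := by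
    rw [Set.eq_empty_iff_forall_notMem]
    rintro y ⟨hy, hyd⟩
    rw [mem_app_image] at hyd
    simp only [digitSet, mem_iUnion, exists_prop] at hyd
    obtain ⟨u, hu, hyu⟩ := hyd
    have h1 := h.pow_mul_le_nrm (i := 0) (u := u) (by
      intro h0
      exact hη0 (Subtype.ext (by rw [← show S.dig (S.par^[0] u) = η from hu, h0]; rfl))) hyu
    have h2 := S.mem_ball.1 (S.smul_subset_ball hUd (Real.rpow_nonneg hρ.le x) hy)
    rw [sub_zero] at h2
    rw [pow_zero, one_mul, S.nrm_app, zpow_neg, le_inv_mul_iff₀ (zpow_pos hρ i)] at h1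
    exact (h.lt_of_floor_lt hd hi).not_ge (h1.trans h2)
  rw [disc, hempty]
  simp


/-! ### Continuity of the fluctuation. -/

theorem locallyFinite_tile : LocallyFinite S.tile := by
  intro x
  refine ⟨S.ball x 1, S.ball_mem_nhds x one_pos, (S.finite_lattice_ball x (1 + S.rad)).subset ?_⟩
  rintro u ⟨y, hyu, hy⟩
  have h1 := S.mem_ball.1 (S.tile_subset_ball u hyu)
  have h2 := S.mem_ball.1 hy
  rw [Set.mem_ofPred_eq, mem_ball]
  have h3 : (u : Fin n → ℝ) - x = (y - x) - (y - u) := by abel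
  rw [h3]
  exact (map_sub_le_add _ _ _).trans (add_le_add h2 h1)

theorem isClosed_biUnion_tile (I : Set S.Λ) : IsClosed (⋃ u ∈ I, S.tile u) := by
  rw [biUnion_eq_iUnion]
  exact (S.locallyFinite_tile.comp_injective Subtype.val_injective).isClosed_iUnion
    fun u => S.isClosed_tile u

/-- The complement is covered by the remaining tiles, whose union is closed by local finiteness. A
boundary point therefore lies in two different tiles, and there are countably many null overlaps. -/
theorem volume_frontier_biUnion_tile (I : Set S.Λ) : volume (frontier (⋃ u ∈ I, S.tile u)) = 0 := by
  have hsub : frontier (⋃ u ∈ I, S.tile u) ⊆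
      ⋃ p ∈ {p : S.Λ × S.Λ | p.1 ≠ p.2}, S.tile p.1 ∩ S.tile p.2 := by
    intro x hx
    rw [frontier_eq_closure_inter_closure, (S.isClosed_biUnion_tile I).closure_eq] at hx
    obtain ⟨h1, h2⟩ := hx
    have h3 : (⋃ u ∈ I, S.tile u)ᶜ ⊆ ⋃ u ∈ Iᶜ, S.tile u := by
      intro y hy
      obtain ⟨u, hu⟩ := S.exists_mem_tile y
      exact mem_biUnion (x := u) (fun huI => hy (mem_biUnion huI hu)) hu
    have h4 := (closure_minimal h3 (S.isClosed_biUnion_tile _)) h2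
    simp only [mem_iUnion, exists_prop] at h1 h4 ⊢
    obtain ⟨u, hu, hxu⟩ := h1
    obtain ⟨v, hv, hxv⟩ := h4
    exact ⟨(u, v), fun h => hv (by rw [← show u = v from h]; exact hu), hxu, hxv⟩
  refine measure_mono_null hsub ?_
  rw [measure_biUnion_null_iff (Set.to_countable _)]
  exact fun p hp => S.aedisjoint_tile hp

theorem volume_frontier_app_image_digitSet (η : S.Λ) (i : ℤ) :
    volume (frontier (S.app i '' S.digitSet η)) = 0 := by
  have h := (S.app i).toHomeomorph.image_frontier (S.digitSet η)
  have h' : frontier (S.app i '' S.digitSet η) = S.app i '' frontier (S.digitSet η) := h.symm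
  rw [h', volume_app_image, digitSet, volume_frontier_biUnion_tile, mul_zero]

theorem continuousAt_indicator_one {X : Type*} [TopologicalSpace X] {A : Set X} {x : X}
    (hx : x ∉ frontier A) : ContinuousAt (A.indicator (1 : X → ℝ)) x := by
  have h : A ∈ 𝓝 x ∨ Aᶜ ∈ 𝓝 x := by
    by_cases h1 : x ∈ interior A
    · exact Or.inl (mem_interior_iff_mem_nhds.1 h1)
    · refine Or.inr (mem_of_superset (isClosed_closure.isOpen_compl.mem_nhds fun h2 => hx ⟨h2, h1⟩) ?_)
      exact compl_subset_compl.2 subset_closure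
  rcases h with h | h
  · refine (continuousAt_const (y := (1 : ℝ))).congr ?_
    filter_upwards [h] with y hy
    rw [indicator_of_mem hy]; rfl
  · refine (continuousAt_const (y := (0 : ℝ))).congr ?_
    filter_upwards [h] with y hy
    rw [indicator_of_notMem hy]

/-- The volume is `t^n` times the integral over `U` of the indicator of `A` at `t y`. For almost all
`y` the point `t₀ y` avoids the null set `frontier A`, and dominated convergence applies. -/
theorem continuousAt_volume_smul_inter {U A : Set (Fin n → ℝ)} (hU : volume U ≠ ⊤)
    (hA : MeasurableSet A) (hAf : volume (frontier A) = 0) {t₀ : ℝ} (ht₀ : 0 < t₀) :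
    ContinuousAt (fun t : ℝ => volume.real (t • U ∩ A)) t₀ := by
  have hfm : IsFiniteMeasure (volume.restrict U) := ⟨by simpa using lt_top_iff_ne_top.2 hU⟩
  have hm : ∀ t : ℝ, MeasurableSet ((fun y : Fin n → ℝ => t • y) ⁻¹' A) := fun t =>
    (continuous_const_smul t).measurable hA
  have h1 : ContinuousAt (fun t : ℝ => ∫ y in U, A.indicator (1 : (Fin n → ℝ) → ℝ) (t • y)) t₀ := by
    refine continuousAt_of_dominated (bound := fun _ => 1) ?_ ?_ (integrable_const _) ?_
    · refine Eventually.of_forall fun t => ?_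
      exact ((measurable_one.indicator hA).comp (measurable_const_smul t)).aestronglyMeasurable
    · refine Eventually.of_forall fun t => Eventually.of_forall fun y => ?_
      by_cases hy : t • y ∈ A <;> simp [hy]
    · have h2 : ∀ᵐ y : Fin n → ℝ, t₀ • y ∉ frontier A := by
        have h3 : volume ((fun y : Fin n → ℝ => t₀ • y) ⁻¹' frontier A) = 0 := by
          rw [Measure.addHaar_preimage_smul _ ht₀.ne', hAf, mul_zero]
        exact measure_eq_zero_iff_ae_notMem.1 h3
      filter_upwards [ae_restrict_of_ae h2] with y hy
      exact ContinuousAt.comp (f := fun t : ℝ => t • y) (continuousAt_indicator_one hy)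
        (continuousAt_id.smul continuousAt_const)
  have h2 : ∀ᶠ t : ℝ in 𝓝 t₀, t ^ n * ∫ y in U, A.indicator (1 : (Fin n → ℝ) → ℝ) (t • y) =
      volume.real (t • U ∩ A) := by
    filter_upwards [lt_mem_nhds ht₀] with t ht
    have h3 : t • U ∩ A = t • (((fun y : Fin n → ℝ => t • y) ⁻¹' A) ∩ U) := by
      ext y
      constructor
      · rintro ⟨⟨u, hu, rfl⟩, hy⟩
        exact ⟨u, ⟨hy, hu⟩, rfl⟩
      · rintro ⟨u, ⟨hy, hu⟩, rfl⟩
        exact ⟨⟨u, hu, rfl⟩, hy⟩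
    have h4 : ∀ y : Fin n → ℝ, A.indicator (1 : (Fin n → ℝ) → ℝ) (t • y) =
        ((fun y : Fin n → ℝ => t • y) ⁻¹' A).indicator 1 y := fun y => rfl
    simp only [h4]
    rw [integral_indicator_one (hm t), measureReal_restrict_apply (hm t), h3, volume_smul t ht.le]
  exact ((continuousAt_id.pow n).mul h1).congr h2

theorem continuous_disc (η : S.Λ) {U : Set (Fin n → ℝ)} (hU : volume U ≠ ⊤) (i : ℤ) :
    Continuous fun x : ℝ => S.disc η (S.ρ ^ x • U) i := by
  have hρ := S.rho_pos
  have hm : MeasurableSet (S.app i '' S.digitSet η) :=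
    (S.app i).toHomeomorph.measurableEmbedding.measurableSet_image.2 (S.measurableSet_digitSet η)
  have hc : Continuous fun x : ℝ => S.ρ ^ x := Real.continuous_const_rpow hρ.ne'
  have h1 : Continuous fun x : ℝ => volume.real (S.ρ ^ x • U ∩ S.app i '' S.digitSet η) :=
    continuous_iff_continuousAt.2 fun x =>
      ContinuousAt.comp (f := fun x : ℝ => S.ρ ^ x)
        (continuousAt_volume_smul_inter hU hm
        (S.volume_frontier_app_image_digitSet η i) (Real.rpow_pos_of_pos hρ x)) hc.continuousAt
  have h2 : ∀ x : ℝ, volume.real (S.ρ ^ x • U) = (S.ρ ^ x) ^ n * volume.real U := fun x =>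
    volume_smul _ (Real.rpow_nonneg hρ.le x) U
  simp only [disc, h2]
  exact h1.sub (continuous_const.mul ((hc.pow n).mul continuous_const))

theorem volume_rpow_smul (x : ℝ) (U : Set (Fin n → ℝ)) :
    volume.real (S.ρ ^ x • U) = S.ρ ^ (n * x) * volume.real U := by
  rw [volume_smul _ (Real.rpow_nonneg S.rho_pos.le x), mul_comm (n : ℝ), Real.rpow_mul S.rho_pos.le,
    Real.rpow_natCast]

/-- The ratio `ρ^δ / q` is less than `1` when `δ < n`. Uniformity in `x ≤ X` provides summability
and the Weierstrass test at once. -/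
theorem exists_disc_geometric_bound {η : S.Λ} (hη : (η : Fin n → ℝ) ∈ S.D) (hη0 : η ≠ 0)
    {U : Set (Fin n → ℝ)} {d : ℝ} (hd : 0 < d) (hUd : U ⊆ {x | S.nrm x < d}) {δ : ℝ} (hδ0 : 0 ≤ δ)
    (hδ : (fun N : ℝ => (S.cardV (S.boundaryV (N • U)) : ℝ)) =O[atTop] fun N : ℝ => N ^ δ)
    (X : ℝ) (M : ℤ) :
    ∃ C : ℝ, ∀ (j : ℕ) (x : ℝ), x ≤ X →
      |S.disc η (S.ρ ^ x • U) (M - j)| ≤ C * (S.q⁻¹ * S.ρ ^ δ) ^ j := by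
  obtain ⟨C, hC, h⟩ := S.exists_disc_bound hη hη0 hd hUd hδ0 hδ
  have hρ := S.rho_pos
  have hq := S.q_pos
  set K := max 1 (S.ρ ^ X * S.ρ ^ (-M)) with hK
  have hK1 : 1 ≤ K := le_max_left _ _
  refine ⟨C * S.q ^ M * K ^ δ, fun j x hx => ?_⟩
  refine (h (M - j) _ (Real.rpow_pos_of_pos hρ x)).trans ?_
  have h1 : max 1 (S.ρ ^ x * S.ρ ^ (-(M - j) : ℤ)) ≤ K * S.ρ ^ j := by
    have hj : 1 ≤ S.ρ ^ j := one_le_pow₀ S.one_lt_rho.le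
    refine max_le (one_le_mul_of_one_le_of_one_le hK1 hj) ?_
    rw [show -(M - (j : ℤ)) = -M + j by ring, zpow_add₀ hρ.ne', zpow_natCast, ← mul_assoc]
    gcongr
    refine le_trans ?_ (le_max_right _ _)
    have := Real.rpow_le_rpow_of_exponent_le S.one_lt_rho.le hx
    gcongr
  have h2 : (max 1 (S.ρ ^ x * S.ρ ^ (-(M - j) : ℤ))) ^ δ ≤ K ^ δ * (S.ρ ^ δ) ^ j := by
    refine (Real.rpow_le_rpow (by positivity) h1 hδ0).trans (le_of_eq ?_)
    rw [Real.mul_rpow (by positivity) (by positivity), ← Real.rpow_natCast, ← Real.rpow_natCast,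
      ← Real.rpow_mul hρ.le, ← Real.rpow_mul hρ.le, mul_comm δ]
  calc _ ≤ C * S.q ^ (M - j : ℤ) * (K ^ δ * (S.ρ ^ δ) ^ j) := by gcongr
    _ = _ := by
      rw [zpow_sub₀ hq.ne', zpow_natCast, mul_pow, inv_pow]
      field_simp

theorem inv_q_mul_lt_one {δ : ℝ} (hδn : δ < n) : S.q⁻¹ * S.ρ ^ δ < 1 := by
  rw [inv_mul_lt_iff₀ S.q_pos, mul_one, q, ← Real.rpow_natCast]
  exact Real.rpow_lt_rpow_of_exponent_lt S.one_lt_rho hδn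

theorem summable_geometric_ratio {δ : ℝ} (hδn : δ < n) (C : ℝ) :
    Summable fun j : ℕ => C * (S.q⁻¹ * S.ρ ^ δ) ^ j := by
  have := S.q_pos
  have := Real.rpow_pos_of_pos S.rho_pos δ
  exact (summable_geometric_of_lt_one (by positivity) (S.inv_q_mul_lt_one hδn)).mul_left C

/-- The fluctuation without the constant part, in terms of the discrepancies up to position `M`. -/
def fluct (η : S.Λ) (U : Set (Fin n → ℝ)) (M : ℤ) (x : ℝ) : ℝ :=
  (S.ρ ^ (-(n * x)) * ∑' j : ℕ, S.disc η (S.ρ ^ x • U) (M - j) +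
    volume.real U * S.E * (M + 1 - x)) / S.dΛ

-- Raising `M` by one adds a discrepancy `-E λ(ρ^x U)`, which the increase of the linear term `M + 1
-- - x` cancels.
variable {S} in
theorem IsLowerBound.fluct_eq {BL : ℝ} (h : S.IsLowerBound BL) {η : S.Λ}
    (hη : (η : Fin n → ℝ) ∈ S.D) (hη0 : η ≠ 0)
    {U : Set (Fin n → ℝ)} {d : ℝ} (hd : 0 < d) (hUd : U ⊆ {x | S.nrm x < d}) {δ : ℝ} (hδ0 : 0 ≤ δ)
    (hδn : δ < n)
    (hδ : (fun N : ℝ => (S.cardV (S.boundaryV (N • U)) : ℝ)) =O[atTop] fun N : ℝ => N ^ δ)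
    {x : ℝ} {M : ℤ} (hM : ⌊x⌋ + S.J₀ d BL ≤ M) :
    S.fluct η U M x = S.fluct η U (⌊x⌋ + S.J₀ d BL) x := by
  have hρ := S.rho_pos
  induction M, hM using Int.leInduction with
  | base => rfl
  | succ M hM ih =>
    rw [← ih]
    obtain ⟨C, hC⟩ := S.exists_disc_geometric_bound hη hη0 hd hUd hδ0 hδ x (M + 1)
    have hs : Summable fun j : ℕ => S.disc η (S.ρ ^ x • U) (M + 1 - j) :=
      Summable.of_norm_bounded (S.summable_geometric_ratio hδn C) fun j => hC j x le_rfl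
    rw [fluct, fluct, hs.tsum_eq_zero_add]
    have h1 : S.disc η (S.ρ ^ x • U) (M + 1 - (0 : ℕ)) =
        -(S.E * (S.ρ ^ (n * x) * volume.real U)) := by
      rw [h.disc_eq hη0 hd hUd (by push_cast; linarith), volume_rpow_smul]
    have h2 : ∀ j : ℕ, M + 1 - ((j + 1 : ℕ) : ℤ) = M - j := fun j => by push_cast; ring
    rw [h1]
    simp only [h2]
    have h3 : S.ρ ^ (-(n * x)) * S.ρ ^ (n * x) = 1 := by
      rw [← Real.rpow_add hρ]; simp
    congr 1
    push_cast
    linear_combination -(S.E * volume.real U) * h3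

theorem ψ_eq_fluct {η : S.Λ} (hη : (η : Fin n → ℝ) ∈ S.D) (hη0 : η ≠ 0)
    {U : Set (Fin n → ℝ)} {d : ℝ} (hUd : U ⊆ {x | S.nrm x < d}) (J : ℤ) (x : ℝ) :
    S.ψ η U J x = S.fluct η U (⌊x⌋ + J) x + S.ψQ η U := by
  have hρ := S.rho_pos
  have hd := S.dΛ_pos
  have h1 : S.ρ ^ (n * (J - Int.fract x)) * S.q ^ (-(⌊x⌋ + J)) = S.ρ ^ (-(n * x)) := by
    rw [q, ← Real.rpow_natCast, ← Real.rpow_intCast, ← Real.rpow_mul hρ.le, ← Real.rpow_add hρ]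
    congr 1
    push_cast
    linear_combination (-(n : ℝ)) * Int.floor_add_fract x
  rw [ψ, ψP, ψM, fluct]
  simp only [S.integral_region hη hη0 hUd]
  rw [tsum_mul_left, ← h1]
  have h2 := Int.floor_add_fract x
  congr 1
  push_cast
  field_simp
  linear_combination (-(volume.real U * S.E)) * h2

-- Both the floor in `ψ` and the cut-off jump at integers. With a cut-off that works for all `x < x₀
-- + 1` no floor is left near `x₀`.
variable {S} in
theorem IsLowerBound.continuous_ψ {BL : ℝ} (h : S.IsLowerBound BL) {η : S.Λ}
    (hη : (η : Fin n → ℝ) ∈ S.D) (hη0 : η ≠ 0)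
    {U : Set (Fin n → ℝ)} {d : ℝ} (hd : 0 < d) (hUd : U ⊆ {x | S.nrm x < d}) {δ : ℝ} (hδ0 : 0 ≤ δ)
    (hδn : δ < n)
    (hδ : (fun N : ℝ => (S.cardV (S.boundaryV (N • U)) : ℝ)) =O[atTop] fun N : ℝ => N ^ δ) :
    Continuous (S.ψ η U (S.J₀ d BL)) := by
  have hUfin : volume U ≠ ⊤ := by
    have := S.smul_subset_ball hUd zero_le_one
    rw [one_smul] at this
    exact S.volume_ne_top_of_subset_ball this
  refine continuous_iff_continuousAt.2 fun x₀ => ?_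
  set M : ℤ := ⌊x₀ + 1⌋ + S.J₀ d BL with hM
  obtain ⟨C, hC⟩ := S.exists_disc_geometric_bound hη hη0 hd hUd hδ0 hδ (x₀ + 1) M
  have h1 : ContinuousOn (fun x : ℝ => ∑' j : ℕ, S.disc η (S.ρ ^ x • U) (M - j)) (Iio (x₀ + 1)) :=
    continuousOn_tsum (fun j => (S.continuous_disc η hUfin _).continuousOn)
      (S.summable_geometric_ratio hδn C) fun j x hx => hC j x (le_of_lt hx)
  have hmem : Iio (x₀ + 1) ∈ 𝓝 x₀ := Iio_mem_nhds (by linarith)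
  have h2 : ContinuousAt (fun x => S.fluct η U M x + S.ψQ η U) x₀ := by
    have h3 : Continuous fun x : ℝ => S.ρ ^ (-(n * x)) :=
      (Real.continuous_const_rpow S.rho_pos.ne').comp (by fun_prop)
    have h4 : Continuous fun x : ℝ => volume.real U * S.E * (M + 1 - x) := by fun_prop
    exact (((h3.continuousAt.mul (h1.continuousAt hmem)).add h4.continuousAt).div_const _).add
      continuousAt_const
  refine h2.congr ?_
  filter_upwards [hmem] with x hx
  rw [S.ψ_eq_fluct hη hη0 hUd, h.fluct_eq hη hη0 hd hUd hδ0 hδn hδ (M := M)]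
  rw [hM]
  gcongr
  exact le_of_lt hx


/-! ### Periodicity of the fluctuation. -/

theorem map_ofReal_mulVec (A : Matrix (Fin n) (Fin n) ℝ) (x : Fin n → ℝ) :
    (A.map Complex.ofReal) *ᵥ (fun i => (x i : ℂ)) = fun i => ((A *ᵥ x) i : ℂ) := by
  funext i
  simp [Matrix.mulVec, dotProduct]

theorem diagonal_conj_pow (Q : Matrix (Fin n) (Fin n) ℂ) (hQ : IsUnit Q.det) (v : Fin n → ℂ) (p : ℕ) :
    (Q * Matrix.diagonal v * Q⁻¹) ^ p = Q * Matrix.diagonal (v ^ p) * Q⁻¹ := by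
  induction p with
  | zero => simp [Matrix.mul_nonsing_inv Q hQ]
  | succ p ih =>
    rw [pow_succ, ih]
    calc Q * Matrix.diagonal (v ^ p) * Q⁻¹ * (Q * Matrix.diagonal v * Q⁻¹)
        = Q * Matrix.diagonal (v ^ p) * (Q⁻¹ * Q) * Matrix.diagonal v * Q⁻¹ := by
          simp only [Matrix.mul_assoc]
      _ = Q * Matrix.diagonal (v ^ (p + 1)) * Q⁻¹ := by
          rw [Matrix.nonsing_inv_mul Q hQ, Matrix.mul_one, Matrix.mul_assoc Q,
            Matrix.diagonal_mul_diagonal]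
          rfl

/-- The rotation matrix is the complexification of `ρ^(-p) Φ^p`, and the embedding of real vectors
into complex ones is injective on sets. -/
theorem app_image_eq_smul {Q : Matrix (Fin n) (Fin n) ℂ} {θ : Fin n → ℝ} (hQ : IsUnit Q.det)
    (hΦ : S.Φ.map Complex.ofReal =
      Q * Matrix.diagonal (fun k => (S.ρ : ℂ) * Complex.exp (Complex.I * θ k)) * Q⁻¹) {p : ℕ}
    {U : Set (Fin n → ℝ)}
    (hU : (fun x => (Q * Matrix.diagonal (fun k => Complex.exp (Complex.I * θ k * p)) * Q⁻¹) *ᵥ x) ''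
        ((fun (x : Fin n → ℝ) (i : Fin n) => (x i : ℂ)) '' U) =
      (fun (x : Fin n → ℝ) (i : Fin n) => (x i : ℂ)) '' U) :
    S.app p '' U = S.ρ ^ p • U := by
  have hρ := S.rho_pos
  have hrot : ∀ x : Fin n → ℝ,
      (Q * Matrix.diagonal (fun k => Complex.exp (Complex.I * θ k * p)) * Q⁻¹) *ᵥ
        (fun i => (x i : ℂ)) = fun i => (((S.ρ ^ p)⁻¹ • S.app p x) i : ℂ) := by
    intro x
    have h1 : (S.Φ ^ p).map Complex.ofReal = (S.ρ ^ p : ℂ) •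
        (Q * Matrix.diagonal (fun k => Complex.exp (Complex.I * θ k * p)) * Q⁻¹) := by
      have h2 : (S.Φ ^ p).map Complex.ofReal = (S.Φ.map Complex.ofReal) ^ p :=
        Matrix.map_pow S.Φ Complex.ofRealHom p
      rw [h2, hΦ, diagonal_conj_pow Q hQ, ← Matrix.smul_mul, ← Matrix.mul_smul,
        ← Matrix.diagonal_smul]
      congr 3
      funext k
      simp only [Pi.pow_apply, Pi.smul_apply, smul_eq_mul, mul_pow, ← Complex.exp_nat_mul]
      ring_nf
    have h3 := map_ofReal_mulVec (S.Φ ^ p) x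
    rw [h1, Matrix.smul_mulVec] at h3
    have h4 : (S.ρ ^ p : ℂ) ≠ 0 := pow_ne_zero _ (by exact_mod_cast hρ.ne')
    rw [← inv_smul_smul₀ h4 ((Q * Matrix.diagonal
      (fun k => Complex.exp (Complex.I * θ k * p)) * Q⁻¹) *ᵥ fun i => (x i : ℂ)), h3]
    funext i
    simp [app_natCast]
  have hinj : Function.Injective (fun (x : Fin n → ℝ) (i : Fin n) => (x i : ℂ)) := by
    intro x y h
    funext i
    exact Complex.ofReal_injective (congrFun h i)
  rw [image_image] at hU
  simp only [hrot] at hU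
  rw [← image_image (fun (x : Fin n → ℝ) (i : Fin n) => (x i : ℂ))
    (fun x => (S.ρ ^ p)⁻¹ • S.app p x)] at hU
  have h5 := hinj.image_injective hU
  rw [← image_image (fun x => (S.ρ ^ p)⁻¹ • x) (S.app p), image_smul] at h5
  have hp : S.ρ ^ p ≠ 0 := (pow_pos hρ p).ne'
  conv_rhs => rw [← h5]
  rw [smul_inv_smul₀ hp]

theorem app_image_smul (j : ℤ) (t : ℝ) (U : Set (Fin n → ℝ)) :
    S.app j '' (t • U) = t • (S.app j '' U) := by
  rw [← image_smul, ← image_smul, image_image, image_image]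
  simp

/-- Only the regions depend on more than the fractional part of `x`; in them the additional `Φ^(-p)`
and `ρ^p` cancel. -/
theorem periodic_ψ {U : Set (Fin n → ℝ)} {p : ℕ} (hU : S.app p '' U = S.ρ ^ p • U)
    (η : Fin n → ℝ) (J : ℤ) : Function.Periodic (S.ψ η U J) p := by
  intro x
  have hρ := S.rho_pos
  have hreg : ∀ j, S.region U J (x + p) j = S.region U J x j := by
    intro j
    rw [region, region]
    congr 1
    rw [act_eq, act_eq, Int.floor_add_natCast, Real.rpow_add hρ, Real.rpow_natCast, mul_smul, ← hU,
      ← app_image_smul, ← app_image_add]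
    congr 3
    ring
  rw [ψ, ψ, ψM, ψM, ψP, ψP, Int.fract_add_natCast]
  simp only [hreg]


/-! ### The asymptotic formula. -/

theorem α_lt : S.α < n := by
  have : Real.logb S.ρ S.μ < 0 := Real.logb_neg S.one_lt_rho S.μ_pos S.μ_lt_one
  rw [α]
  linarith

theorem q_mul_μ : S.q * S.μ = S.ρ ^ S.α := by
  rw [α, Real.rpow_add S.rho_pos, Real.rpow_natCast,
    Real.rpow_logb S.rho_pos S.one_lt_rho.ne' S.μ_pos, q]

/-- The number of digits needed for an integer of size `N`. -/
def len (N : ℝ) : ℕ := ⌊Real.logb S.ρ N⌋₊ + 1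

theorem pow_le_of_lt_len {N : ℝ} (hN : 1 ≤ N) {k : ℕ} (hk : k < S.len N) : S.ρ ^ k ≤ N := by
  have h1 : (k : ℝ) ≤ Real.logb S.ρ N :=
    (Nat.le_floor_iff (Real.logb_nonneg S.one_lt_rho hN)).1 (Nat.lt_succ_iff.1 hk)
  rwa [Real.le_logb_iff_rpow_le S.one_lt_rho (by linarith), Real.rpow_natCast] at h1

theorem le_pow_len {N : ℝ} (hN : 1 ≤ N) : N ≤ S.ρ ^ S.len N := by
  have h1 : Real.logb S.ρ N ≤ S.len N := by
    rw [len]; push_cast; exact (Nat.lt_floor_add_one _).le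
  rwa [Real.logb_le_iff_le_rpow S.one_lt_rho (by linarith), Real.rpow_natCast] at h1

/-- `len N` exceeds `log_ρ N` by at most `1`; the absolute value in the exponent makes the sign of
`α` irrelevant. -/
theorem pow_len_le {N : ℝ} (hN : 1 ≤ N) :
    (S.q * S.μ) ^ S.len N ≤ S.ρ ^ |S.α| * N ^ S.α := by
  have hρ := S.rho_pos
  have hx := Real.logb_nonneg S.one_lt_rho hN
  have h1 := Nat.floor_le hx
  have h2 := Nat.lt_floor_add_one (Real.logb S.ρ N)
  have h3 : S.ρ ^ Real.logb S.ρ N = N := Real.rpow_logb hρ S.one_lt_rho.ne' (by linarith)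
  have h4 : ((S.len N : ℕ) : ℝ) = ⌊Real.logb S.ρ N⌋₊ + 1 := by rw [len]; push_cast; rfl
  nth_rewrite 2 [← h3]
  rw [q_mul_μ, ← Real.rpow_natCast, ← Real.rpow_mul hρ.le, ← Real.rpow_mul hρ.le, ← Real.rpow_add hρ]
  refine Real.rpow_le_rpow_of_exponent_le S.one_lt_rho.le ?_
  rw [h4]
  have h5 := le_abs_self S.α
  have h6 := neg_abs_le S.α
  have h7 := abs_nonneg S.α
  nlinarith

/-- If `q θ = ρ^δ`, the sum over levels would acquire a second logarithm. Since `θ < μ` is strict,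
the rate can be increased slightly to avoid this resonance. -/
theorem exists_mixing_ne {t : S.Λ} (ht : t ∉ range S.up) (c : ℝ) :
    ∃ θ : ℝ, 0 < θ ∧ θ < S.μ ∧ S.q * θ ≠ c ∧ ∃ C : ℝ, 0 ≤ C ∧
      ∀ v k, |S.dΛ * (S.desc k v).card - S.q ^ k * S.κ v| ≤ C * (S.q * θ) ^ k := by
  obtain ⟨θ, hθ0, hθμ, C, hC, hmix⟩ := S.exists_mixing ht
  have hq := S.q_pos
  by_cases hc : S.q * θ = c
  · refine ⟨(θ + S.μ) / 2, by linarith, by linarith, ?_, C, hC, fun v k => (hmix v k).trans ?_⟩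
    · rw [← hc]
      intro h
      have := mul_left_cancel₀ hq.ne' h
      linarith
    · have : θ ≤ (θ + S.μ) / 2 := by linarith
      gcongr
  · exact ⟨θ, hθ0, hθμ, hc, C, hC, hmix⟩

theorem geom_sum_le {s : ℝ} (hs0 : 0 ≤ s) (hs1 : s ≠ 1) (L : ℕ) :
    ∑ k ∈ Finset.range L, s ^ k ≤ |s - 1|⁻¹ * (s ^ L + 1) := by
  rw [geom_sum_eq hs1]
  refine (le_abs_self _).trans ?_
  rw [abs_div, div_eq_inv_mul]
  gcongr
  have := pow_nonneg hs0 L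
  rw [abs_le]
  constructor <;> linarith

theorem card_pts_le {B : Set (Fin n → ℝ)} {X : ℝ} (hB : B ⊆ S.ball 0 X) {M : ℕ}
    (hM : ∀ x, {u : S.Λ | (u : Fin n → ℝ) ∈ S.ball x X}.ncard ≤ M) : (S.pts B).card ≤ M := by
  refine le_trans ?_ (hM 0)
  rw [← Set.ncard_coe_finset]
  exact Set.ncard_le_ncard (fun u hu => hB ((S.mem_pts hB).1 hu)) (S.finite_lattice_ball 0 X)

theorem exists_sum_compareFun_bound {η : S.Λ} (hη : (η : Fin n → ℝ) ∈ S.D) (hη0 : η ≠ 0)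
    {U : Set (Fin n → ℝ)} {d : ℝ} (hd : 0 < d) (hUd : U ⊆ {x | S.nrm x < d}) {δ : ℝ} (hδ0 : 0 ≤ δ)
    (hδ : (fun N : ℝ => (S.cardV (S.boundaryV (N • U)) : ℝ)) =O[atTop] fun N : ℝ => N ^ δ) :
    ∃ C : ℝ, 0 ≤ C ∧ ∀ N : ℝ, 1 ≤ N → ∀ i,
      |∑ u ∈ S.pts (N • U), S.compareFun η i u| ≤ C * (N ^ S.α + N ^ δ) := by
  have hρ := S.rho_pos
  have hq := S.q_pos
  obtain ⟨θ, hθ0, hθμ, hne, C₀, hC₀, hmix⟩ :=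
    S.exists_mixing_ne (S.digit_notMem_range hη hη0) (S.ρ ^ δ)
  obtain ⟨C₁, hC₁, h₁⟩ :=
    S.exists_compareFun_bound hη hη0 hθ0 (hθμ.le.trans S.μ_lt_one.le) hC₀ hmix
  obtain ⟨C₂, hC₂, h₂⟩ := S.exists_mixed_bound hd hUd hδ0 hδ S.bigRad
  obtain ⟨M, hM⟩ := S.exists_card_ball_le d
  set s : ℝ := S.q * θ * (S.ρ ^ δ)⁻¹ with hs
  have hρδ : 0 < S.ρ ^ δ := Real.rpow_pos_of_pos hρ δ
  have hs0 : 0 ≤ s := by positivity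
  have hs1 : s ≠ 1 := by
    rw [hs, ← div_eq_mul_inv, Ne, div_eq_one_iff_eq hρδ.ne']
    exact hne
  set K : ℝ := C₁ * (C₂ * |s - 1|⁻¹ + M) * S.ρ ^ |S.α| + C₁ * C₂ * |s - 1|⁻¹ with hK
  have hρα : 0 < S.ρ ^ |S.α| := Real.rpow_pos_of_pos hρ _
  refine ⟨K, by positivity, fun N hN i => ?_⟩
  have hN0 : 0 < N := by linarith
  have hNδ : 0 < N ^ δ := Real.rpow_pos_of_pos hN0 δ
  have hNα : 0 < N ^ S.α := Real.rpow_pos_of_pos hN0 _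
  -- For `k < L` the scale `N ρ^(-k)` is at least `1`, so the boundary bound is a pure power and the
  -- terms form a geometric series with ratio `s`. At level `L` the region lies in the ball of
  -- radius `d` and holds at most `M` lattice points.
  set L := S.len N with hL
  have hsum := S.sum_pts_le (S.smul_subset_ball hUd hN0.le) (h₁ i) L
  have hlast : ((S.pts (S.app (-L) '' (N • U))).card : ℝ) ≤ M := by
    have hsub := S.app_image_subset_ball (S.smul_subset_ball hUd hN0.le) (-L)
    have hle : S.ρ ^ (-(L : ℤ)) * (N * d) ≤ d := by
      rw [zpow_neg, zpow_natCast, inv_mul_le_iff₀ (by positivity)]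
      have := S.le_pow_len hN
      gcongr
    exact_mod_cast S.card_pts_le (hsub.trans (S.ball_mono 0 hle)) hM
  have hterm : ∀ k ∈ Finset.range L, C₁ * (S.q * θ) ^ k *
      (S.mixed S.bigRad (S.app (-k) '' (N • U))).ncard ≤ C₁ * C₂ * N ^ δ * s ^ k := by
    intro k hk
    have h3 := h₂ (-k) N hN0
    have h4 : 1 ≤ N * S.ρ ^ (-(k : ℤ)) := by
      rw [zpow_neg, zpow_natCast, ← div_eq_mul_inv, one_le_div (by positivity)]
      exact S.pow_le_of_lt_len hN (Finset.mem_range.1 hk)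
    have h5 : (N * S.ρ ^ (-(k : ℤ))) ^ δ = N ^ δ * ((S.ρ ^ δ)⁻¹) ^ k := by
      rw [Real.mul_rpow hN0.le (by positivity), zpow_neg, zpow_natCast, Real.inv_rpow (by positivity),
        inv_pow, ← Real.rpow_natCast, ← Real.rpow_natCast, ← Real.rpow_mul hρ.le,
        ← Real.rpow_mul hρ.le, mul_comm δ]
    rw [max_eq_right h4, h5] at h3
    calc _ ≤ C₁ * (S.q * θ) ^ k * (C₂ * (N ^ δ * ((S.ρ ^ δ)⁻¹) ^ k)) := by gcongr
      _ = _ := by rw [hs, mul_pow]; ring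
  have hqθ : (S.q * θ) ^ L ≤ S.ρ ^ |S.α| * N ^ S.α := by
    refine le_trans ?_ (S.pow_len_le hN)
    gcongr
  have hsL : N ^ δ * s ^ L ≤ S.ρ ^ |S.α| * N ^ S.α := by
    refine le_trans ?_ hqθ
    have h6 : N ^ δ ≤ (S.ρ ^ δ) ^ L := by
      refine (Real.rpow_le_rpow hN0.le (S.le_pow_len hN) hδ0).trans (le_of_eq ?_)
      rw [← Real.rpow_natCast, ← Real.rpow_natCast, ← Real.rpow_mul hρ.le, ← Real.rpow_mul hρ.le,
        mul_comm δ]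
    rw [hs, mul_pow, inv_pow, ← div_eq_mul_inv, mul_div_assoc', div_le_iff₀ (by positivity), mul_comm]
    gcongr
  calc |∑ u ∈ S.pts (N • U), S.compareFun η i u|
      ≤ ∑ k ∈ Finset.range L, C₁ * C₂ * N ^ δ * s ^ k + C₁ * (S.q * θ) ^ L * M :=
        hsum.trans (add_le_add (Finset.sum_le_sum hterm) (by gcongr))
    _ ≤ C₁ * C₂ * N ^ δ * (|s - 1|⁻¹ * (s ^ L + 1)) + C₁ * (S.ρ ^ |S.α| * N ^ S.α) * M := by
        rw [← Finset.mul_sum]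
        gcongr
        exact geom_sum_le hs0 hs1 L
    _ = C₁ * C₂ * |s - 1|⁻¹ * (N ^ δ * s ^ L) + C₁ * C₂ * |s - 1|⁻¹ * N ^ δ +
          C₁ * M * S.ρ ^ |S.α| * N ^ S.α := by ring
    _ ≤ C₁ * C₂ * |s - 1|⁻¹ * (S.ρ ^ |S.α| * N ^ S.α) + C₁ * C₂ * |s - 1|⁻¹ * N ^ δ +
          C₁ * M * S.ρ ^ |S.α| * N ^ S.α := by gcongr
    _ = K * N ^ S.α - C₁ * C₂ * |s - 1|⁻¹ * N ^ S.α + C₁ * C₂ * |s - 1|⁻¹ * N ^ δ := by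
        rw [hK]; ring
    _ ≤ K * N ^ S.α + K * N ^ δ := by
        have h7 : C₁ * C₂ * |s - 1|⁻¹ ≤ K := by
          rw [hK]
          have : 0 ≤ C₁ * (C₂ * |s - 1|⁻¹ + M) * S.ρ ^ |S.α| := by positivity
          linarith
        have h8 : 0 ≤ C₁ * C₂ * |s - 1|⁻¹ * N ^ S.α := by positivity
        have h9 := mul_le_mul_of_nonneg_right h7 hNδ.le
        linarith
    _ = K * (N ^ S.α + N ^ δ) := by ring

theorem exists_dev_bound {η : S.Λ} (hη : (η : Fin n → ℝ) ∈ S.D) (hη0 : η ≠ 0) :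
    ∃ θ : ℝ, 0 < θ ∧ θ < S.μ ∧ ∃ C : ℝ, 0 ≤ C ∧ ∀ i, |S.dev η i| ≤ C * θ ^ i := by
  obtain ⟨θ, hθ0, hθμ, C, hC, hmix⟩ := S.exists_mixing (S.digit_notMem_range hη hη0)
  have hq := S.q_pos
  exact ⟨θ, hθ0, hθμ, C / S.q ^ S.w, by positivity, fun i => S.abs_dev_le hq hmix i⟩

theorem summable_dev {η : S.Λ} (hη : (η : Fin n → ℝ) ∈ S.D) (hη0 : η ≠ 0) :
    Summable (S.dev η) := by
  obtain ⟨θ, hθ0, hθμ, C, hC, h⟩ := S.exists_dev_bound hη hη0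
  exact Summable.of_norm_bounded
    ((summable_geometric_of_lt_one hθ0.le (hθμ.trans S.μ_lt_one)).mul_left C) h

theorem exists_count_bound {η : S.Λ} (hη : (η : Fin n → ℝ) ∈ S.D) (hη0 : η ≠ 0)
    {U : Set (Fin n → ℝ)} (hU : NullMeasurableSet U)
    {d : ℝ} (hd : 0 < d) (hUd : U ⊆ {x | S.nrm x < d}) {δ : ℝ} (hδ0 : 0 ≤ δ)
    (hδ : (fun N : ℝ => (S.cardV (S.boundaryV (N • U)) : ℝ)) =O[atTop] fun N : ℝ => N ^ δ) :
    ∃ C : ℝ, 0 ≤ C ∧ ∀ N : ℝ, 1 ≤ N → ∀ i : ℕ,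
      |S.dΛ * ∑ u ∈ S.pts (N • U), (S.withDigit η i).indicator (fun _ => (1 : ℝ)) u -
        volume.real (N • U ∩ S.app i '' S.digitSet η) - S.dev η i / S.dΛ * volume.real (N • U)| ≤
      C * (N ^ S.α + N ^ δ) := by
  have hdΛ := S.dΛ_pos
  obtain ⟨C₁, hC₁, h₁⟩ := S.exists_sum_compareFun_bound hη hη0 hd hUd hδ0 hδ
  obtain ⟨C₂, hC₂, h₂⟩ := S.exists_mixed_bound hd hUd hδ0 hδ S.bigRad
  obtain ⟨θ, hθ0, hθμ, C₃, hC₃, h₃⟩ := S.exists_dev_bound hη hη0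
  set V := volume.real (S.ball 0 S.rad) with hV
  have hV0 : 0 ≤ V := measureReal_nonneg
  refine ⟨C₁ + V * (1 + C₃ / S.dΛ) * C₂, by positivity, fun N hN i => ?_⟩
  have hN0 : 0 < N := by linarith
  have hNδ : 0 < N ^ δ := Real.rpow_pos_of_pos hN0 δ
  have hNα : 0 < N ^ S.α := Real.rpow_pos_of_pos hN0 _
  have h := S.count_compare η i (Measure.NullMeasurableSet.const_smul hU N)
    (S.smul_subset_ball hUd hN0.le)
  rw [← app_image_digitSet] at h
  refine h.trans ?_
  have h4 : |S.dev η i| ≤ C₃ := (h₃ i).trans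
    (mul_le_of_le_one_right hC₃ (pow_le_one₀ hθ0.le (hθμ.le.trans S.μ_lt_one.le)))
  have h5 := h₂ 0 N hN0
  rw [zpow_zero, mul_one, max_eq_right hN,
    show S.app 0 '' (N • U) = N • U by simp] at h5
  calc _ ≤ C₁ * (N ^ S.α + N ^ δ) + V * (1 + C₃ / S.dΛ) * (C₂ * N ^ δ) :=
        add_le_add (h₁ N hN i) (by gcongr)
    _ ≤ _ := by
        have : 0 ≤ V * (1 + C₃ / S.dΛ) * C₂ * N ^ S.α := by positivity
        linarith

theorem mem_occurrences {η : S.Λ} {B : Set (Fin n → ℝ)} {z : Fin n → ℝ} {j : ℕ} :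
    (z, j) ∈ S.occurrences η B ↔ z ∈ B ∧ ∃ hz : z ∈ S.Λ, (⟨z, hz⟩ : S.Λ) ∈ S.withDigit η j := by
  constructor
  · rintro ⟨hzB, -, ξ, hξ, hj⟩
    obtain ⟨hz, h⟩ := hξ.digit S
    exact ⟨hzB, hz, by rw [withDigit, Set.mem_ofPred_eq, ← h j]; exact hj⟩
  · rintro ⟨hzB, hz, h⟩
    obtain ⟨ξ, hξ⟩ := S.exists_isExpansion ⟨z, hz⟩
    obtain ⟨hz', h'⟩ := hξ.digit S
    exact ⟨hzB, hz, ξ, hξ, by rw [h' j]; exact h⟩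

theorem occurrences_eq {η : S.Λ} {B : Set (Fin n → ℝ)} {X : ℝ} (hB : B ⊆ S.ball 0 X) {m : ℕ}
    (hm : ∀ u : S.Λ, (u : Fin n → ℝ) ∈ B → ∀ i, u ∈ S.withDigit η i → i ≤ m) :
    (S.occurrences η B).Finite ∧ ((S.occurrences η B).ncard : ℝ) =
      ∑ i ∈ Finset.range (m + 1),
        ∑ u ∈ S.pts B, (S.withDigit η i).indicator (fun _ => (1 : ℝ)) u := by
  classical
  set F : Finset (S.Λ × ℕ) :=
    (S.pts B ×ˢ Finset.range (m + 1)).filter fun p => p.1 ∈ S.withDigit η p.2 with hF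
  have hinj : Function.Injective fun p : S.Λ × ℕ => ((p.1 : Fin n → ℝ), p.2) := by
    rintro ⟨u, i⟩ ⟨v, j⟩ h
    simp only [Prod.mk.injEq] at h
    exact Prod.ext (Subtype.ext h.1) h.2
  have hocc : S.occurrences η B = (fun p : S.Λ × ℕ => ((p.1 : Fin n → ℝ), p.2)) '' F := by
    ext ⟨z, j⟩
    rw [mem_occurrences]
    constructor
    · rintro ⟨hzB, hz, h⟩
      refine ⟨(⟨z, hz⟩, j), ?_, rfl⟩
      rw [Finset.mem_coe, hF, Finset.mem_filter, Finset.mem_product, Finset.mem_range]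
      exact ⟨⟨(S.mem_pts hB).2 hzB, Nat.lt_succ_of_le (hm _ hzB j h)⟩, h⟩
    · rintro ⟨⟨u, i⟩, hp, h⟩
      simp only [Prod.mk.injEq] at h
      obtain ⟨rfl, rfl⟩ := h
      rw [Finset.mem_coe, hF, Finset.mem_filter, Finset.mem_product] at hp
      exact ⟨(S.mem_pts hB).1 hp.1.1, u.2, hp.2⟩
  refine ⟨by rw [hocc]; exact F.finite_toSet.image _, ?_⟩
  rw [hocc, Set.ncard_image_of_injective _ hinj, Set.ncard_coe_finset, hF, Finset.card_filter,
    Finset.sum_product_right]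
  push_cast
  refine Finset.sum_congr rfl fun i _ => Finset.sum_congr rfl fun u _ => ?_
  by_cases h : u ∈ S.withDigit η i <;> simp [h]


-- The lattice point lies in its own tile, so the lower bound for values limits the positions of its
-- non-zero digits.
variable {S} in
theorem IsLowerBound.le_of_withDigit {BL : ℝ} (h : S.IsLowerBound BL) {η : S.Λ} (hη0 : η ≠ 0)
    {U : Set (Fin n → ℝ)} {d : ℝ} (hd : 0 < d) (hUd : U ⊆ {x | S.nrm x < d}) {N : ℝ} (hN : 0 < N)
    {u : S.Λ} (hu : (u : Fin n → ℝ) ∈ N • U) {i : ℕ} (hi : u ∈ S.withDigit η i) :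
    (i : ℤ) ≤ ⌊Real.logb S.ρ N⌋ + S.J₀ d BL := by
  by_contra! hlt
  have h1 := h.lt_of_floor_lt hd hlt
  rw [Real.rpow_logb S.rho_pos S.one_lt_rho.ne' hN, zpow_natCast] at h1
  have h2 := S.mem_ball.1 (S.smul_subset_ball hUd hN.le hu)
  rw [sub_zero] at h2
  have h3 := h.pow_mul_le_nrm (i := i) (fun h0 => hη0 (Subtype.ext
    (by rw [← show S.dig (S.par^[i] u) = η from hi, h0]; rfl))) (S.coe_mem_tile u)
  exact absurd (h1.trans_le (h3.trans h2)) (lt_irrefl _)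

/-- The fluctuation also includes discrepancies at negative positions, where no digits are counted;
there the bounds decay like `(ρ^δ / q)^j` with leading size `N^δ`. -/
theorem exists_tail_disc_bound {η : S.Λ} (hη : (η : Fin n → ℝ) ∈ S.D) (hη0 : η ≠ 0)
    {U : Set (Fin n → ℝ)} {d : ℝ} (hd : 0 < d) (hUd : U ⊆ {x | S.nrm x < d}) {δ : ℝ} (hδ0 : 0 ≤ δ)
    (hδn : δ < n)
    (hδ : (fun N : ℝ => (S.cardV (S.boundaryV (N • U)) : ℝ)) =O[atTop] fun N : ℝ => N ^ δ) :
    ∃ C : ℝ, 0 ≤ C ∧ ∀ N : ℝ, 1 ≤ N → |∑' j : ℕ, S.disc η (N • U) (-1 - j)| ≤ C * N ^ δ := by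
  obtain ⟨C, hC, h⟩ := S.exists_disc_bound hη hη0 hd hUd hδ0 hδ
  have hρ := S.rho_pos
  have hq := S.q_pos
  have hρδ : 0 < S.ρ ^ δ := Real.rpow_pos_of_pos hρ δ
  set s := S.q⁻¹ * S.ρ ^ δ with hs
  have hs0 : 0 < s := by positivity
  have hs1 : s < 1 := S.inv_q_mul_lt_one hδn
  refine ⟨C * s * (1 - s)⁻¹, by have : 0 < 1 - s := by linarith
                                positivity, fun N hN => ?_⟩
  have hN0 : 0 < N := by linarith
  have hb : ∀ j : ℕ, |S.disc η (N • U) (-1 - j)| ≤ C * N ^ δ * s * s ^ j := by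
    intro j
    refine (h (-1 - j) N hN0).trans (le_of_eq ?_)
    have h1 : -(-1 - (j : ℤ)) = ((j + 1 : ℕ) : ℤ) := by push_cast; ring
    have h2 : (-1 - (j : ℤ)) = -((j + 1 : ℕ) : ℤ) := by push_cast; ring
    have h3 : 1 ≤ N * S.ρ ^ (j + 1) :=
      one_le_mul_of_one_le_of_one_le hN (one_le_pow₀ S.one_lt_rho.le)
    rw [h1, zpow_natCast, max_eq_right h3, h2, zpow_neg, zpow_natCast,
      Real.mul_rpow hN0.le (by positivity), ← Real.rpow_natCast S.ρ, ← Real.rpow_mul hρ.le,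
      mul_comm ((j + 1 : ℕ) : ℝ) δ, Real.rpow_mul hρ.le, Real.rpow_natCast, mul_assoc, mul_assoc,
      mul_assoc, ← pow_succ', hs, mul_pow, inv_pow]
    ring
  have hsum : Summable fun j : ℕ => C * N ^ δ * s * s ^ j :=
    (summable_geometric_of_lt_one hs0.le hs1).mul_left _
  refine (tsum_of_norm_bounded (f := fun j : ℕ => S.disc η (N • U) (-1 - j))
    hsum.hasSum hb).trans (le_of_eq ?_)
  rw [tsum_mul_left, tsum_geometric_of_lt_one hs0.le hs1]
  ring

/-- Since `N ≤ ρ^(len N)`, one has `N^n θ^m ≤ (q μ)^(len N)`, which is `O(N^α)`. -/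
theorem exists_tail_dev_bound {η : S.Λ} (hη : (η : Fin n → ℝ) ∈ S.D) (hη0 : η ≠ 0) :
    ∃ C : ℝ, 0 ≤ C ∧ ∀ N : ℝ, 1 ≤ N → ∀ m : ℕ, S.len N ≤ m →
      N ^ n * |∑' j : ℕ, S.dev η (j + m)| ≤ C * N ^ S.α := by
  obtain ⟨θ, hθ0, hθμ, C, hC, h⟩ := S.exists_dev_bound hη hη0
  have hρ := S.rho_pos
  have hμ := S.μ_pos
  have hθ1 : θ < 1 := hθμ.trans S.μ_lt_one
  have hθ1' : 0 < 1 - θ := by linarith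
  have hρα : 0 < S.ρ ^ |S.α| := Real.rpow_pos_of_pos hρ _
  refine ⟨C * (1 - θ)⁻¹ * S.ρ ^ |S.α|, by positivity, fun N hN m hm => ?_⟩
  have hN0 : 0 < N := by linarith
  have hsum : Summable fun j : ℕ => C * θ ^ m * θ ^ j :=
    (summable_geometric_of_lt_one hθ0.le hθ1).mul_left _
  have h1 : |∑' j : ℕ, S.dev η (j + m)| ≤ C * θ ^ m * (1 - θ)⁻¹ := by
    refine (tsum_of_norm_bounded (f := fun j : ℕ => S.dev η (j + m))
      hsum.hasSum fun j => ?_).trans (le_of_eq ?_)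
    · refine (h (j + m)).trans (le_of_eq ?_)
      rw [pow_add]; ring
    · rw [tsum_mul_left, tsum_geometric_of_lt_one hθ0.le hθ1]
  have h2 : N ^ n * θ ^ m ≤ (S.q * S.μ) ^ S.len N := by
    have h3 : N ^ n ≤ S.q ^ S.len N := by
      rw [q, ← pow_mul, mul_comm n, pow_mul]
      have := S.le_pow_len hN
      gcongr
    have h4 : θ ^ m ≤ S.μ ^ S.len N :=
      (pow_le_pow_of_le_one hθ0.le hθ1.le hm).trans (by gcongr)
    rw [mul_pow]
    have := S.q_pos
    gcongr
  calc N ^ n * |∑' j : ℕ, S.dev η (j + m)| ≤ N ^ n * (C * θ ^ m * (1 - θ)⁻¹) := by gcongr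
    _ = C * (1 - θ)⁻¹ * (N ^ n * θ ^ m) := by ring
    _ ≤ C * (1 - θ)⁻¹ * (S.ρ ^ |S.α| * N ^ S.α) := by
        exact mul_le_mul_of_nonneg_left (h2.trans (S.pow_len_le hN)) (by positivity)
    _ = _ := by ring

-- An exact identity for any cut-off `m` beyond the last occupied position. The terms with `E`
-- combine with the linear part of `fluct`, and the right-hand side keeps the error of each position
-- and the two tails.
variable {S} in
theorem IsLowerBound.count_sub_eq {BL : ℝ} (h : S.IsLowerBound BL) {η : S.Λ}
    (hη : (η : Fin n → ℝ) ∈ S.D) (hη0 : η ≠ 0)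
    {U : Set (Fin n → ℝ)} {d : ℝ} (hd : 0 < d) (hUd : U ⊆ {x | S.nrm x < d}) {δ : ℝ} (hδ0 : 0 ≤ δ)
    (hδn : δ < n)
    (hδ : (fun N : ℝ => (S.cardV (S.boundaryV (N • U)) : ℝ)) =O[atTop] fun N : ℝ => N ^ δ)
    {N : ℝ} (hN : 0 < N) {m : ℕ} (hm : ⌊Real.logb S.ρ N⌋ + S.J₀ d BL ≤ m) :
    S.dΛ * ((S.Z η U N : ℝ) - (N ^ n * (volume.real U / S.dΛ) * S.E * Real.logb S.ρ N +
        N ^ n * S.ψ η U (S.J₀ d BL) (Real.logb S.ρ N))) =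
      ∑ i ∈ Finset.range (m + 1),
        (S.dΛ * ∑ u ∈ S.pts (N • U), (S.withDigit η i).indicator (fun _ => (1 : ℝ)) u -
          volume.real (N • U ∩ S.app i '' S.digitSet η) -
          S.dev η i / S.dΛ * volume.real (N • U)) -
      ∑' j : ℕ, S.disc η (N • U) (-1 - j) -
      volume.real U / S.dΛ * (N ^ n * ∑' j : ℕ, S.dev η (j + (m + 1))) := by
  have hρ := S.rho_pos
  have hdΛ := S.dΛ_pos
  have hx : S.ρ ^ Real.logb S.ρ N = N := Real.rpow_logb hρ S.one_lt_rho.ne' hN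
  have hB := S.smul_subset_ball hUd hN.le
  have hvol : volume.real (N • U) = N ^ n * volume.real U := volume_smul N hN.le U
  have hZ : (S.Z η U N : ℝ) = _ := (S.occurrences_eq hB (m := m) fun u hu i hi =>
    Int.ofNat_le.1 ((h.le_of_withDigit hη0 hd hUd hN hu hi).trans hm)).2
  have hψ : S.ψ η U (S.J₀ d BL) (Real.logb S.ρ N) =
      S.fluct η U m (Real.logb S.ρ N) + S.ψQ η U := by
    rw [S.ψ_eq_fluct hη hη0 hUd, ← h.fluct_eq hη hη0 hd hUd hδ0 hδn hδ hm]
  have hN' : N ^ n * S.ρ ^ (-(n * Real.logb S.ρ N)) = 1 := by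
    rw [Real.rpow_neg hρ.le, mul_comm (n : ℝ), Real.rpow_mul hρ.le, hx, Real.rpow_natCast]
    exact mul_inv_cancel₀ (pow_pos hN n).ne'
  have hdisc : ∑' j : ℕ, S.disc η (N • U) (m - j) =
      ∑ i ∈ Finset.range (m + 1), S.disc η (N • U) i + ∑' j : ℕ, S.disc η (N • U) (-1 - j) := by
    obtain ⟨C, hC⟩ := S.exists_disc_geometric_bound hη hη0 hd hUd hδ0 hδ (Real.logb S.ρ N) m
    have hs : Summable fun j : ℕ => S.disc η (N • U) (m - j) :=
      Summable.of_norm_bounded (S.summable_geometric_ratio hδn C) fun j => by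
        have := hC j _ le_rfl
        rwa [hx] at this
    rw [← hs.sum_add_tsum_nat_add (m + 1), ← Finset.sum_range_reflect]
    congr 1
    · refine Finset.sum_congr rfl fun i hi => ?_
      congr 1
      have := Finset.mem_range.1 hi
      omega
    · refine tsum_congr fun j => ?_
      congr 1
      push_cast
      ring
  have hdev : ∑' j : ℕ, S.β η j =
      ∑ i ∈ Finset.range (m + 1), S.dev η i + ∑' j : ℕ, S.dev η (j + (m + 1)) := by
    rw [(S.summable_dev hη hη0).sum_add_tsum_nat_add (m + 1)]
    exact tsum_congr fun j => S.β_eq_dev hη hη0 j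
  rw [hψ, fluct, ψQ, hx, hdisc, hdev, hZ, hvol]
  simp only [disc, Finset.sum_sub_distrib, ← Finset.mul_sum, ← Finset.sum_mul, ← Finset.sum_div,
    Finset.sum_const, Finset.card_range, nsmul_eq_mul, hvol]
  push_cast
  set A := ∑ i ∈ Finset.range (m + 1),
    ∑ u ∈ S.pts (N • U), (S.withDigit η i).indicator (fun _ => (1 : ℝ)) u
  set T := ∑' j : ℕ, (volume.real (N • U ∩ S.app (-1 - j) '' S.digitSet η) -
    S.E * (N ^ n * volume.real U))
  set G := ∑ i ∈ Finset.range (m + 1), volume.real (N • U ∩ S.app i '' S.digitSet η)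
  set P := S.ρ ^ (-(n * Real.logb S.ρ N))
  have hfin : S.dΛ * (A - (N ^ n * (volume.real U / S.dΛ) * S.E * Real.logb S.ρ N +
      N ^ n * ((P * (G - S.E * (N ^ n * ((m + 1) * volume.real U)) + T) +
        volume.real U * S.E * (m + 1 - Real.logb S.ρ N)) / S.dΛ +
        volume.real U / S.dΛ ^ 2 * (∑ i ∈ Finset.range (m + 1), S.dev η i +
          ∑' j : ℕ, S.dev η (j + (m + 1)))))) =
      S.dΛ * A - N ^ n * P * (G - S.E * (N ^ n * ((m + 1) * volume.real U)) + T) -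
        N ^ n * volume.real U * S.E * (m + 1) -
        N ^ n * volume.real U / S.dΛ * (∑ i ∈ Finset.range (m + 1), S.dev η i +
          ∑' j : ℕ, S.dev η (j + (m + 1))) := by
    field_simp
    ring
  rw [hfin, hN']
  ring

variable {S} in
theorem IsLowerBound.isBigO_count_sub {BL : ℝ} (h : S.IsLowerBound BL) {η : S.Λ}
    (hη : (η : Fin n → ℝ) ∈ S.D) (hη0 : η ≠ 0)
    {U : Set (Fin n → ℝ)} (hU : NullMeasurableSet U)
    {d : ℝ} (hd : 0 < d) (hUd : U ⊆ {x | S.nrm x < d}) {δ : ℝ} (hδ0 : 0 ≤ δ) (hδn : δ < n)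
    (hδ : (fun N : ℝ => (S.cardV (S.boundaryV (N • U)) : ℝ)) =O[atTop] fun N : ℝ => N ^ δ) :
    (fun N : ℝ => (S.Z η U N : ℝ) -
        (N ^ n * (volume.real U / S.dΛ) * S.E * Real.logb S.ρ N +
          N ^ n * S.ψ η U (S.J₀ d BL) (Real.logb S.ρ N)))
      =O[atTop] (fun N : ℝ => N ^ S.α * Real.logb S.ρ N + N ^ δ * Real.logb S.ρ N) := by
  obtain ⟨C₁, hC₁, h₁⟩ := S.exists_count_bound hη hη0 hU hd hUd hδ0 hδ
  obtain ⟨C₂, hC₂, h₂⟩ := S.exists_tail_disc_bound hη hη0 hd hUd hδ0 hδn hδ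
  obtain ⟨C₃, hC₃, h₃⟩ := S.exists_tail_dev_bound hη hη0
  have hdΛ := S.dΛ_pos
  have hvU : 0 ≤ volume.real U := measureReal_nonneg
  -- `J₀` may be negative; its truncation keeps the number of positions a natural number that still
  -- exceeds every occupied one.
  set K := (S.J₀ d BL).toNat with hK
  refine IsBigO.of_bound ((C₁ * (K + 2) + C₂ + volume.real U / S.dΛ * C₃) / S.dΛ) ?_
  -- From `N ≥ ρ` on, `log_ρ N ≥ 1` absorbs the terms without logarithm.
  filter_upwards [eventually_ge_atTop S.ρ] with N hNρ
  have hN1 : 1 ≤ N := S.one_lt_rho.le.trans hNρ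
  have hN0 : 0 < N := by linarith
  have hx1 : 1 ≤ Real.logb S.ρ N := by
    rw [Real.le_logb_iff_rpow_le S.one_lt_rho hN0, Real.rpow_one]
    exact hNρ
  set x := Real.logb S.ρ N with hx
  have hx0 : 0 ≤ x := by linarith
  have hNδ : 0 < N ^ δ := Real.rpow_pos_of_pos hN0 δ
  have hNα : 0 < N ^ S.α := Real.rpow_pos_of_pos hN0 _
  set m := ⌊x⌋₊ + K with hm
  have hmJ : ⌊Real.logb S.ρ N⌋ + S.J₀ d BL ≤ m := by
    have h1 : ((⌊x⌋₊ : ℕ) : ℤ) = ⌊x⌋ := Int.natCast_floor_eq_floor hx0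
    have h2 := Int.self_le_toNat (S.J₀ d BL)
    rw [hm]
    push_cast
    rw [h1]
    linarith
  have hmx : ((m + 1 : ℕ) : ℝ) ≤ (K + 2) * x := by
    have h1 := Nat.floor_le hx0
    have h2 : (K : ℝ) ≤ K * x := le_mul_of_one_le_right (Nat.cast_nonneg K) hx1
    rw [hm]
    push_cast
    linarith
  have heq := h.count_sub_eq hη hη0 hd hUd hδ0 hδn hδ hN0 hmJ
  have hlen : S.len N ≤ m + 1 := by rw [len, hm, hx]; omega
  rw [← hx] at heq
  have hb : |S.dΛ * ((S.Z η U N : ℝ) - (N ^ n * (volume.real U / S.dΛ) * S.E * x +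
      N ^ n * S.ψ η U (S.J₀ d BL) x))| ≤
      (C₁ * (K + 2) + C₂ + volume.real U / S.dΛ * C₃) * (N ^ S.α * x + N ^ δ * x) := by
    rw [heq]
    refine ((abs_sub _ _).trans (add_le_add (abs_sub _ _) le_rfl)).trans ?_
    have e1 : |∑ i ∈ Finset.range (m + 1),
        (S.dΛ * ∑ u ∈ S.pts (N • U), (S.withDigit η i).indicator (fun _ => (1 : ℝ)) u -
          volume.real (N • U ∩ S.app i '' S.digitSet η) -
          S.dev η i / S.dΛ * volume.real (N • U))| ≤
        C₁ * (K + 2) * (N ^ S.α * x + N ^ δ * x) := by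
      refine (Finset.abs_sum_le_sum_abs _ _).trans
        ((Finset.sum_le_sum fun i _ => h₁ N hN1 i).trans ?_)
      rw [Finset.sum_const, Finset.card_range, nsmul_eq_mul]
      calc ((m + 1 : ℕ) : ℝ) * (C₁ * (N ^ S.α + N ^ δ))
          ≤ ((K + 2) * x) * (C₁ * (N ^ S.α + N ^ δ)) := by gcongr
        _ = _ := by ring
    have e2 := h₂ N hN1
    have e3 : |volume.real U / S.dΛ * (N ^ n * ∑' j : ℕ, S.dev η (j + (m + 1)))| ≤
        volume.real U / S.dΛ * (C₃ * N ^ S.α) := by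
      rw [abs_mul, abs_of_nonneg (div_nonneg hvU hdΛ.le), abs_mul,
        abs_of_pos (pow_pos hN0 n)]
      exact mul_le_mul_of_nonneg_left (h₃ N hN1 (m + 1) hlen) (div_nonneg hvU hdΛ.le)
    have e4 : N ^ δ ≤ N ^ S.α * x + N ^ δ * x := by nlinarith
    have e5 : N ^ S.α ≤ N ^ S.α * x + N ^ δ * x := by nlinarith
    have e6 := mul_le_mul_of_nonneg_left e4 hC₂
    have e7 := mul_le_mul_of_nonneg_left e5 (mul_nonneg (div_nonneg hvU hdΛ.le) hC₃)
    linarith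
  have hnn : 0 ≤ N ^ S.α * x + N ^ δ * x := by positivity
  rw [Real.norm_eq_abs, Real.norm_of_nonneg hnn, div_mul_eq_mul_div, le_div_iff₀ hdΛ]
  rwa [abs_mul, abs_of_pos hdΛ, mul_comm] at hb

end NAFSystem

end

theorem mainTheorem1 {n : ℕ} (S : NAFSystem n)
    (η : Fin n → ℝ) (hη : η ∈ S.D) (hη0 : η ≠ 0)
    (U : Set (Fin n → ℝ)) (hU : NullMeasurableSet U volume)
    (d : ℝ) (hd : 0 < d) (hUd : U ⊆ {x | S.nrm x < d})
    (δ : ℝ) (hδ1 : 1 ≤ δ) (hδn : δ < n)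
    (hδ : (fun N : ℝ => (S.cardV (S.boundaryV (N • U)) : ℝ)) =O[atTop] fun N : ℝ => N ^ δ)
    (BL : ℝ)
    (hBL : (S.act (-1) S.T ⊆ S.T ∧ BL = S.r - S.R / (S.ρ ^ S.w - 1)) ∨
      BL = (S.r - S.R / (S.ρ ^ S.w - 1)) / S.ρ ^ (S.w - 1)) :
    -- each lattice point has exactly one expansion, and all counted sets are finite
    (∀ z ∈ S.Λ, ∃! ξ, S.IsExpansion ξ z) ∧
    (∀ N : ℝ, 0 < N → (S.occurrences η (N • U)).Finite) ∧
    -- the integrals and series in the fluctuation exist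
    (∀ x : ℝ, ∀ j : ℕ, IntegrableOn (S.integrand η j) (S.region U (S.J₀ d BL) x j)) ∧
    (∀ x : ℝ, Summable fun j : ℕ =>
      ∫ y in S.region U (S.J₀ d BL) x j, S.integrand η j y) ∧
    Summable (S.β η) ∧
    -- the asymptotic formula
    S.μ < 1 ∧ S.α < n ∧
    (fun N : ℝ => (S.Z η U N : ℝ) -
        (N ^ n * (volume.real U / S.dΛ) * S.E * Real.logb S.ρ N +
          N ^ n * S.ψ η U (S.J₀ d BL) (Real.logb S.ρ N)))
      =O[atTop] (fun N : ℝ => N ^ S.α * Real.logb S.ρ N + N ^ δ * Real.logb S.ρ N) ∧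
    -- periodicity
    (∀ (Q : Matrix (Fin n) (Fin n) ℂ) (θ : Fin n → ℝ), IsUnit Q.det →
      S.Φ.map Complex.ofReal =
        Q * Matrix.diagonal (fun k => (S.ρ : ℂ) * Complex.exp (Complex.I * θ k)) * Q⁻¹ →
      ∀ p : ℕ, 0 < p →
        (fun x => (Q * Matrix.diagonal (fun k => Complex.exp (Complex.I * θ k * p)) * Q⁻¹) *ᵥ x) ''
            ((fun (x : Fin n → ℝ) (i : Fin n) => (x i : ℂ)) '' U) =
          (fun (x : Fin n → ℝ) (i : Fin n) => (x i : ℂ)) '' U →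
        Function.Periodic (S.ψ η U (S.J₀ d BL)) p) ∧
    -- continuity
    (∀ p : ℕ, 0 < p → Function.Periodic (S.ψ η U (S.J₀ d BL)) p →
      Continuous (S.ψ η U (S.J₀ d BL))) := by
  have hδ0 : 0 ≤ δ := by linarith
  have hB : S.IsLowerBound BL := hBL
  obtain ⟨a, rfl⟩ : ∃ a : S.Λ, (a : Fin n → ℝ) = η := ⟨⟨η, S.digits_lattice η hη⟩, rfl⟩
  have ha0 : a ≠ 0 := fun h => hη0 (by rw [h]; rfl)
  refine ⟨fun z hz => S.existsUnique_isExpansion hz, fun N hN => ?_,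
    fun x j => S.integrableOn_integrand hη ha0 j (S.volume_region_ne_top hUd _ x j), fun x => ?_, ?_,
    S.μ_lt_one, S.α_lt, hB.isBigO_count_sub hη ha0 hU hd hUd hδ0 hδn hδ,
    fun Q θ hQ hΦ p _ hUp => S.periodic_ψ (S.app_image_eq_smul hQ hΦ hUp) a _,
    fun _ _ _ => hB.continuous_ψ hη ha0 hd hUd hδ0 hδn hδ⟩
  · refine (S.occurrences_eq (S.smul_subset_ball hUd hN.le)
      (m := (⌊Real.logb S.ρ N⌋ + S.J₀ d BL).toNat) fun u hu i hi => ?_).1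
    have h1 := hB.le_of_withDigit ha0 hd hUd hN hu hi
    omega
  · simp only [S.integral_region hη ha0 hUd]
    obtain ⟨C, hC⟩ := S.exists_disc_geometric_bound hη ha0 hd hUd hδ0 hδ x (⌊x⌋ + S.J₀ d BL)
    have h1 : Summable fun j : ℕ => S.disc a (S.ρ ^ x • U) (⌊x⌋ + S.J₀ d BL - j) :=
      Summable.of_norm_bounded (S.summable_geometric_ratio hδn C) fun j => hC j x le_rfl
    exact h1.mul_left _
  · exact (S.summable_dev hη ha0).congr fun j => (S.β_eq_dev hη ha0 j).symm
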